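/- Let $\square=[-\pi,\pi)^2$ and $\square^*=[-\tfrac12,\tfrac12)^2$. Let $R\subset\mathbb R^2$ be a non-empty open set with $\overline R\subset\square$, let $\epsilon_0>1$ and put $\gamma=\epsilon_0-1$. Let $H^1_{per}(\square)$ be the space of $\square$-periodic $H^1$ functions and, for $\theta\in\square^*$, let $H^1_\theta(\square;\mathbb C^2)=\{e^{i\theta\cdot y}v(y): v\in H^1_{per}(\square)^2\}$. Set $$V(\theta)=\{v\in H^1_\theta(\square;\mathbb C^2):\ v_{1,1}+v_{2,2}=0 \text{ and } v_{2,1}-v_{1,2}=0 \text{ in } \square\setminus R\},$$ where $f_{,j}$ denotes the $j$-th partial derivative. With $\nabla^\perp p=(-p_{,2},p_{,1})$ consider the sesquilinear forms $$b(u,\phi)=-\tfrac12\int_{\square\setminus R}\big(\nabla^\perp u_1\cdot\overline{\nabla\phi_2}+\nabla u_2\cdot\overline{\nabla^\perp\phi_1}\big)+\tfrac1\gamma\int_R\big(\nabla u_1\cdot\overline{\nabla\phi_1}+\epsilon_0\nabla u_2\cdot\overline{\nabla\phi_2}+\nabla^\perp u_1\cdot\overline{\nabla\phi_2}+\nabla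 u_2\cdot\overline{\nabla^\perp\phi_1}\big),$$ $$c(u,\phi)=\int_\square u\cdot\overline\phi+\gamma\int_R u_2\overline{\phi_2}.$$ Let $\mathcal H(\theta)$ be the closure of $V(\theta)$ in $L^2(\square;\mathbb C^2)$, equipped with the inner product $c$, and let $\mathcal B(\theta)$ be the operator in $\mathcal H(\theta)$ generated by the form $b$ with form domain $V(\theta)$: $v\in\mathrm{dom}\,\mathcal B(\theta)$ and $\mathcal B(\theta)v=w$ if and only if $v\in V(\theta)$, $w\in\mathcal H(\theta)$ and $b(v,\phi)=c(w,\phi)$ for all $\phi\in V(\theta)$. Then, for every $\theta\in\square^*$, the eigenvalues of $\mathcal B(\theta)$, repeated according to multiplicity, form a (unique) sequence $0\le\lambda_1(\theta)\le\lambda_2(\theta)\le\dots$ with $\lambda_n(\theta)\to\infty$, and for each $n\in\mathbb N$ the function $\theta\mapsto\lambda_n(\theta)$ is continuous on $\square^*$. -/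

import Mathlib

open MeasureTheory Filter Topology
open scoped ContDiff Matrix ENNReal

noncomputable section

namespace CriticalFibre

/-- Points of the plane; only its topology, smooth structure and Lebesgue measure are used. -/
abbrev Plane : Type := Fin 2 → ℝ

/-- The reference cell `[-π, π)²`. -/
def cell : Set Plane := Set.univ.pi fun _ => Set.Ico (-Real.pi) Real.pi

/-- The set of quasi-momenta `[-1/2, 1/2)²`. -/
def dualCell : Set Plane := Set.univ.pi fun _ => Set.Ico (-(1 / 2 : ℝ)) (1 / 2)

/-- Lebesgue measure on the reference cell. -/
abbrev cellMeasure : Measure Plane := (volume : Measure Plane).restrict cell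

/-- The space of square integrable complex functions on the cell. -/
abbrev ScalarL2 : Type := Lp ℂ 2 cellMeasure

/-- The Hilbert space of pairs of square integrable complex functions on the cell. -/
abbrev VectorL2 : Type := PiLp 2 fun _ : Fin 2 => ScalarL2

/-- The classical partial derivative in direction `j`. -/
def pderiv (j : Fin 2) (φ : Plane → ℂ) (y : Plane) : ℂ := fderiv ℝ φ y (Pi.single j 1)

/-- `g` is the weak (distributional) `j`-th partial derivative of `u` in the interior of the
cell. -/
def HasWeakDeriv (j : Fin 2) (u g : ScalarL2) : Prop :=
  ∀ φ : Plane → ℂ, ContDiff ℝ ∞ φ → HasCompactSupport φ → tsupport φ ⊆ interior cell →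
    ∫ y, u y * pderiv j φ y ∂cellMeasure = -∫ y, g y * φ y ∂cellMeasure

open Classical in
/-- The weak `j`-th partial derivative of `u` (it is unique; zero if there is none). -/
def weakDeriv (j : Fin 2) (u : ScalarL2) : ScalarL2 :=
  if h : ∃ g, HasWeakDeriv j u g then h.choose else 0

lemma measurableSet_cell : MeasurableSet cell :=
  MeasurableSet.univ_pi fun _ => measurableSet_Ico

lemma interior_cell_eq :
    interior cell = Set.univ.pi fun _ : Fin 2 => Set.Ioo (-Real.pi) Real.pi := by
  simp [cell, interior_pi_set Set.finite_univ]

lemma cell_ae_eq_interior : (interior cell : Set Plane) =ᵐ[volume] cell := by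
  rw [interior_cell_eq, cell]
  exact Measure.univ_pi_Ioo_ae_eq_Icc.trans Measure.univ_pi_Ico_ae_eq_Icc.symm

instance : IsFiniteMeasure cellMeasure := by
  refine ⟨?_⟩
  rw [Measure.restrict_apply_univ, cell, volume_pi_pi]
  simp

lemma integrable_mul_test {φ : Plane → ℂ} (hφ : Continuous φ) (hc : HasCompactSupport φ)
    (u : ScalarL2) : Integrable (fun y => u y * φ y) cellMeasure := by
  have h1 : Integrable u cellMeasure := (Lp.memLp u).integrable (by norm_num)
  obtain ⟨C, hC⟩ := hφ.bounded_above_of_compact_support hc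
  exact h1.mul_bdd (c := C) hφ.aestronglyMeasurable (Eventually.of_forall hC)

lemma continuous_pderiv {φ : Plane → ℂ} (hφ : ContDiff ℝ ∞ φ) (j : Fin 2) :
    Continuous (pderiv j φ) :=
  (hφ.continuous_fderiv (by simp)).clm_apply continuous_const

lemma hasCompactSupport_pderiv {φ : Plane → ℂ} (hφ : HasCompactSupport φ) (j : Fin 2) :
    HasCompactSupport (pderiv j φ) :=
  hφ.fderiv_apply ℝ (Pi.single j 1)

lemma HasWeakDeriv.unique {j : Fin 2} {u g g' : ScalarL2} (h : HasWeakDeriv j u g)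
    (h' : HasWeakDeriv j u g') : g = g' := by
  have key : ∀ᵐ y ∂(volume : Measure Plane), y ∈ interior cell → (g y - g' y) = 0 := by
    refine isOpen_interior.ae_eq_zero_of_integral_contDiff_smul_eq_zero ?_ ?_
    · have hi : Integrable (fun y => g y - g' y) cellMeasure :=
        ((Lp.memLp g).integrable (by norm_num)).sub ((Lp.memLp g').integrable (by norm_num))
      have : IntegrableOn (fun y => g y - g' y) (interior cell) volume :=
        IntegrableOn.mono_set hi interior_subset
      exact this.locallyIntegrableOn
    · intro ψ hψ hc hs
      let φ : Plane → ℂ := fun y => (ψ y : ℂ)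
      have hφ : ContDiff ℝ ∞ φ := Complex.ofRealCLM.contDiff.comp hψ
      have hφc : HasCompactSupport φ := hc.comp_left (g := fun x : ℝ => (x : ℂ)) (by simp)
      have hsub : tsupport φ ⊆ tsupport ψ := by
        refine closure_mono fun y hy => ?_
        simpa [φ] using hy
      have e := (h φ hφ hφc (hsub.trans hs)).symm.trans (h' φ hφ hφc (hsub.trans hs))
      have e2 : ∫ y, (g y * φ y - g' y * φ y) ∂cellMeasure = 0 := by
        rw [integral_sub (integrable_mul_test hφ.continuous hφc g)
          (integrable_mul_test hφ.continuous hφc g')]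
        rw [neg_inj.mp e, sub_self]
      have e3 : ∫ y, ψ y • (g y - g' y) ∂cellMeasure = 0 := by
        rw [← e2]
        refine integral_congr_ae (Eventually.of_forall fun y => ?_)
        simp only [φ, Complex.real_smul]
        ring
      rw [← e3]
      refine (setIntegral_eq_integral_of_forall_compl_eq_zero fun y hy => ?_).symm
      have : y ∉ tsupport ψ := fun hy' => hy (interior_subset (hs hy'))
      rw [image_eq_zero_of_notMem_tsupport this, zero_smul]
  have h2 : ∀ᵐ y ∂cellMeasure, g y - g' y = 0 := by
    have h3 : (volume : Measure Plane).restrict (interior cell) = cellMeasure :=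
      Measure.restrict_congr_set cell_ae_eq_interior
    have h4 : ∀ m : Measure Plane, (volume : Measure Plane).restrict (interior cell) = m →
        ∀ᵐ y ∂m, g y - g' y = 0 := by
      rintro _ rfl
      exact (ae_restrict_iff' isOpen_interior.measurableSet).2 key
    exact h4 _ h3
  refine Lp.ext ?_
  filter_upwards [h2] with y hy using sub_eq_zero.mp hy

lemma weakDeriv_eq {j : Fin 2} {u g : ScalarL2} (h : HasWeakDeriv j u g) :
    weakDeriv j u = g := by
  have hex : ∃ g, HasWeakDeriv j u g := ⟨g, h⟩
  rw [weakDeriv, dif_pos hex]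
  exact hex.choose_spec.unique h

lemma HasWeakDeriv.add {j : Fin 2} {u u' g g' : ScalarL2} (h : HasWeakDeriv j u g)
    (h' : HasWeakDeriv j u' g') : HasWeakDeriv j (u + u') (g + g') := by
  intro φ hφ hc hs
  have a : ∀ (v v' : ScalarL2) (ψ : Plane → ℂ), Continuous ψ → HasCompactSupport ψ →
      ∫ y, (v + v') y * ψ y ∂cellMeasure
        = ∫ y, v y * ψ y ∂cellMeasure + ∫ y, v' y * ψ y ∂cellMeasure := by
    intro v v' ψ hψ hψc
    rw [← integral_add (integrable_mul_test hψ hψc v) (integrable_mul_test hψ hψc v')]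
    refine integral_congr_ae ?_
    filter_upwards [Lp.coeFn_add v v'] with y hy
    rw [hy, Pi.add_apply, add_mul]
  rw [a _ _ _ (continuous_pderiv hφ j) (hasCompactSupport_pderiv hc j),
    a _ _ _ hφ.continuous hc, h φ hφ hc hs, h' φ hφ hc hs, neg_add]

lemma HasWeakDeriv.smul {j : Fin 2} {u g : ScalarL2} (a : ℂ) (h : HasWeakDeriv j u g) :
    HasWeakDeriv j (a • u) (a • g) := by
  intro φ hφ hc hs
  have b : ∀ (v : ScalarL2) (ψ : Plane → ℂ),
      ∫ y, (a • v) y * ψ y ∂cellMeasure = a * ∫ y, v y * ψ y ∂cellMeasure := by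
    intro v ψ
    rw [← integral_const_mul]
    refine integral_congr_ae ?_
    filter_upwards [Lp.coeFn_smul a v] with y hy
    rw [hy, Pi.smul_apply, smul_eq_mul, mul_assoc]
  rw [b, b, h φ hφ hc hs, mul_neg]

lemma HasWeakDeriv.zero (j : Fin 2) : HasWeakDeriv j 0 0 := by
  intro φ hφ hc hs
  have b : ∀ ψ : Plane → ℂ, ∫ y, (0 : ScalarL2) y * ψ y ∂cellMeasure = 0 := by
    intro ψ
    rw [← integral_zero Plane ℂ (μ := cellMeasure)]
    refine integral_congr_ae ?_
    filter_upwards [Lp.coeFn_zero ℂ 2 cellMeasure] with y hy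
    rw [hy, Pi.zero_apply, zero_mul]
  rw [b, b, neg_zero]

/-- The Sobolev space `H¹` of the cell. -/
def H1 : Set ScalarL2 := {u | ∀ j, ∃ g, HasWeakDeriv j u g}

lemma H1.hasWeakDeriv {u : ScalarL2} (hu : u ∈ H1) (j : Fin 2) :
    HasWeakDeriv j u (weakDeriv j u) := by
  obtain ⟨g, hg⟩ := hu j
  rwa [weakDeriv_eq hg]

lemma weakDeriv_add {u v : ScalarL2} (hu : u ∈ H1) (hv : v ∈ H1) (j : Fin 2) :
    weakDeriv j (u + v) = weakDeriv j u + weakDeriv j v :=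
  weakDeriv_eq ((H1.hasWeakDeriv hu j).add (H1.hasWeakDeriv hv j))

lemma weakDeriv_smul {u : ScalarL2} (a : ℂ) (hu : u ∈ H1) (j : Fin 2) :
    weakDeriv j (a • u) = a • weakDeriv j u :=
  weakDeriv_eq ((H1.hasWeakDeriv hu j).smul a)

/-- `φ` is periodic with respect to the cell. -/
def IsCellPeriodic (φ : Plane → ℂ) : Prop :=
  ∀ (k : Fin 2) (y : Plane), φ (y + Pi.single k (2 * Real.pi)) = φ y

/-- The space `H¹_per` of periodic `H¹` functions: those `H¹` functions on the cell for which
integration by parts against every smooth periodic function produces no boundary term, which is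
to say that the traces on opposite sides of the cell agree. -/
def H1per : Set ScalarL2 :=
  {v | v ∈ H1 ∧ ∀ (j : Fin 2) (φ : Plane → ℂ), ContDiff ℝ ∞ φ → IsCellPeriodic φ →
    ∫ y, v y * pderiv j φ y ∂cellMeasure = -∫ y, weakDeriv j v y * φ y ∂cellMeasure}

/-- The space `H¹_θ` of `θ`-quasi-periodic `H¹` functions `e^{iθ·y} v(y)`, `v` in `H¹_per`. -/
def H1quasi (θ : Plane) : Set ScalarL2 :=
  {u | u ∈ H1 ∧ ∃ v ∈ H1per, ∀ᵐ y ∂cellMeasure,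
    u y = Complex.exp (Complex.I * ((θ ⬝ᵥ y : ℝ) : ℂ)) * v y}

lemma integrable_mul_smooth {φ : Plane → ℂ} (hφ : Continuous φ) (u : ScalarL2) :
    Integrable (fun y => u y * φ y) cellMeasure := by
  have h1 : Integrable u cellMeasure := (Lp.memLp u).integrable (by norm_num)
  have hK : IsCompact (Set.univ.pi fun _ : Fin 2 => Set.Icc (-Real.pi) Real.pi) :=
    isCompact_univ_pi fun _ => isCompact_Icc
  obtain ⟨C, hC⟩ := hK.exists_bound_of_continuousOn hφ.continuousOn
  refine h1.mul_bdd (c := C) hφ.aestronglyMeasurable ?_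
  refine (ae_restrict_iff' measurableSet_cell).2 (Eventually.of_forall fun y hy => hC y ?_)
  exact fun i hi => Set.Ico_subset_Icc_self (hy i hi)

lemma H1.zero : (0 : ScalarL2) ∈ H1 := fun j => ⟨0, HasWeakDeriv.zero j⟩

lemma H1.add {u v : ScalarL2} (hu : u ∈ H1) (hv : v ∈ H1) : u + v ∈ H1 :=
  fun j => ⟨_, (H1.hasWeakDeriv hu j).add (H1.hasWeakDeriv hv j)⟩

lemma H1.smul {u : ScalarL2} (a : ℂ) (hu : u ∈ H1) : a • u ∈ H1 :=
  fun j => ⟨_, (H1.hasWeakDeriv hu j).smul a⟩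

lemma H1per.zero : (0 : ScalarL2) ∈ H1per := by
  refine ⟨H1.zero, fun j φ _ _ => ?_⟩
  have b : ∀ ψ : Plane → ℂ, ∫ y, (0 : ScalarL2) y * ψ y ∂cellMeasure = 0 := by
    intro ψ
    rw [← integral_zero Plane ℂ (μ := cellMeasure)]
    refine integral_congr_ae ?_
    filter_upwards [Lp.coeFn_zero ℂ 2 cellMeasure] with y hy
    rw [hy, Pi.zero_apply, zero_mul]
  rw [weakDeriv_eq (HasWeakDeriv.zero j), b, b, neg_zero]

lemma H1per.add {u v : ScalarL2} (hu : u ∈ H1per) (hv : v ∈ H1per) : u + v ∈ H1per := by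
  refine ⟨H1.add hu.1 hv.1, fun j φ hφ hp => ?_⟩
  have a : ∀ (v v' : ScalarL2) (ψ : Plane → ℂ), Continuous ψ →
      ∫ y, (v + v') y * ψ y ∂cellMeasure
        = ∫ y, v y * ψ y ∂cellMeasure + ∫ y, v' y * ψ y ∂cellMeasure := by
    intro v v' ψ hψ
    rw [← integral_add (integrable_mul_smooth hψ v) (integrable_mul_smooth hψ v')]
    refine integral_congr_ae ?_
    filter_upwards [Lp.coeFn_add v v'] with y hy
    rw [hy, Pi.add_apply, add_mul]
  rw [weakDeriv_add hu.1 hv.1, a _ _ _ (continuous_pderiv hφ j), a _ _ _ hφ.continuous,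
    hu.2 j φ hφ hp, hv.2 j φ hφ hp, neg_add]

lemma H1per.smul {u : ScalarL2} (a : ℂ) (hu : u ∈ H1per) : a • u ∈ H1per := by
  refine ⟨H1.smul a hu.1, fun j φ hφ hp => ?_⟩
  have b : ∀ (v : ScalarL2) (ψ : Plane → ℂ),
      ∫ y, (a • v) y * ψ y ∂cellMeasure = a * ∫ y, v y * ψ y ∂cellMeasure := by
    intro v ψ
    rw [← integral_const_mul]
    refine integral_congr_ae ?_
    filter_upwards [Lp.coeFn_smul a v] with y hy
    rw [hy, Pi.smul_apply, smul_eq_mul, mul_assoc]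
  rw [weakDeriv_smul a hu.1, b, b, hu.2 j φ hφ hp, mul_neg]

lemma H1quasi.zero (θ : Plane) : (0 : ScalarL2) ∈ H1quasi θ := by
  refine ⟨H1.zero, 0, H1per.zero, ?_⟩
  filter_upwards [Lp.coeFn_zero ℂ 2 cellMeasure] with y hy
  rw [hy, Pi.zero_apply, mul_zero]

lemma H1quasi.add {θ : Plane} {u v : ScalarL2} (hu : u ∈ H1quasi θ) (hv : v ∈ H1quasi θ) :
    u + v ∈ H1quasi θ := by
  obtain ⟨hu1, u', hu', hue⟩ := hu
  obtain ⟨hv1, v', hv', hve⟩ := hv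
  refine ⟨H1.add hu1 hv1, u' + v', H1per.add hu' hv', ?_⟩
  filter_upwards [hue, hve, Lp.coeFn_add u v, Lp.coeFn_add u' v'] with y h1 h2 h3 h4
  rw [h3, h4, Pi.add_apply, Pi.add_apply, h1, h2, mul_add]

lemma H1quasi.smul {θ : Plane} {u : ScalarL2} (a : ℂ) (hu : u ∈ H1quasi θ) :
    a • u ∈ H1quasi θ := by
  obtain ⟨hu1, u', hu', hue⟩ := hu
  refine ⟨H1.smul a hu1, a • u', H1per.smul a hu', ?_⟩
  filter_upwards [hue, Lp.coeFn_smul a u, Lp.coeFn_smul a u'] with y h1 h3 h4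
  rw [h3, h4, Pi.smul_apply, Pi.smul_apply, h1, smul_eq_mul, smul_eq_mul, mul_left_comm]

/-- The divergence `u_{1,1} + u_{2,2}` of a vector field. -/
def divergence (u : VectorL2) : ScalarL2 := weakDeriv 0 (u 0) + weakDeriv 1 (u 1)

/-- The two-dimensional curl `u_{2,1} - u_{1,2}` of a vector field. -/
def curl (u : VectorL2) : ScalarL2 := weakDeriv 0 (u 1) - weakDeriv 1 (u 0)

/-- The space `V(θ)` of `θ`-quasi-periodic `H¹` vector fields whose divergence and curl vanish
outside the inclusion `R` (in the cell). -/
def constrainedSpace (R : Set Plane) (θ : Plane) : Submodule ℂ VectorL2 where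
  carrier := {u | (∀ i, u i ∈ H1quasi θ) ∧
    ∀ᵐ y ∂cellMeasure.restrict Rᶜ, divergence u y = 0 ∧ curl u y = 0}
  zero_mem' := by
    refine ⟨fun i => H1quasi.zero θ, ae_restrict_of_ae ?_⟩
    have hd : divergence 0 = 0 := by
      simp [divergence, weakDeriv_eq (HasWeakDeriv.zero _)]
    have hc : curl 0 = 0 := by
      simp [curl, weakDeriv_eq (HasWeakDeriv.zero _)]
    rw [hd, hc]
    filter_upwards [Lp.coeFn_zero ℂ 2 cellMeasure] with y hy
    exact ⟨hy, hy⟩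
  add_mem' := by
    rintro u v ⟨hu, hu'⟩ ⟨hv, hv'⟩
    refine ⟨fun i => H1quasi.add (hu i) (hv i), ?_⟩
    have hd : divergence (u + v) = divergence u + divergence v := by
      simp only [divergence, PiLp.add_apply, weakDeriv_add (hu _).1 (hv _).1]
      abel
    have hc : curl (u + v) = curl u + curl v := by
      simp only [curl, PiLp.add_apply, weakDeriv_add (hu _).1 (hv _).1]
      abel
    rw [hd, hc]
    filter_upwards [hu', hv', ae_restrict_of_ae (Lp.coeFn_add (divergence u) (divergence v)),
      ae_restrict_of_ae (Lp.coeFn_add (curl u) (curl v))] with y h1 h2 h3 h4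
    rw [h3, h4]
    simp [h1.1, h1.2, h2.1, h2.2]
  smul_mem' := by
    rintro a u ⟨hu, hu'⟩
    refine ⟨fun i => H1quasi.smul a (hu i), ?_⟩
    have hd : divergence (a • u) = a • divergence u := by
      simp only [divergence, PiLp.smul_apply, weakDeriv_smul a (hu _).1, smul_add]
    have hc : curl (a • u) = a • curl u := by
      simp only [curl, PiLp.smul_apply, weakDeriv_smul a (hu _).1, smul_sub]
    rw [hd, hc]
    filter_upwards [hu', ae_restrict_of_ae (Lp.coeFn_smul a (divergence u)),
      ae_restrict_of_ae (Lp.coeFn_smul a (curl u))] with y h1 h3 h4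
    rw [h3, h4]
    simp [h1.1, h1.2]

/-- The (weak) gradient `∇u` of a scalar function. -/
def grad (u : ScalarL2) (y : Plane) : Fin 2 → ℂ := ![weakDeriv 0 u y, weakDeriv 1 u y]

/-- The rotated gradient `∇^⊥ u = (-u_{,2}, u_{,1})` of a scalar function. -/
def gradPerp (u : ScalarL2) (y : Plane) : Fin 2 → ℂ := ![-weakDeriv 1 u y, weakDeriv 0 u y]

/-- The sesquilinear form `b`, with `γ = ε₀ - 1`:
`b(u,φ) = -1/2 ∫_{□∖R} (∇^⊥u₁·conj ∇φ₂ + ∇u₂·conj ∇^⊥φ₁)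
  + 1/γ ∫_R (∇u₁·conj ∇φ₁ + ε₀ ∇u₂·conj ∇φ₂ + ∇^⊥u₁·conj ∇φ₂ + ∇u₂·conj ∇^⊥φ₁)`. -/
def formB (R : Set Plane) (ε₀ : ℝ) (u φ : VectorL2) : ℂ :=
  -(1 / 2) * ∫ y in Rᶜ, (gradPerp (u 0) y ⬝ᵥ star (grad (φ 1) y)
      + grad (u 1) y ⬝ᵥ star (gradPerp (φ 0) y)) ∂cellMeasure
  + (1 / ((ε₀ : ℂ) - 1)) * ∫ y in R, (grad (u 0) y ⬝ᵥ star (grad (φ 0) y)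
      + (ε₀ : ℂ) * (grad (u 1) y ⬝ᵥ star (grad (φ 1) y))
      + gradPerp (u 0) y ⬝ᵥ star (grad (φ 1) y)
      + grad (u 1) y ⬝ᵥ star (gradPerp (φ 0) y)) ∂cellMeasure

/-- The sesquilinear form `c(u,φ) = ∫_□ u·conj φ + (ε₀ - 1) ∫_R u₂ conj φ₂`. -/
def formC (R : Set Plane) (ε₀ : ℝ) (u φ : VectorL2) : ℂ :=
  ∫ y, (u 0 y * star (φ 0 y) + u 1 y * star (φ 1 y)) ∂cellMeasure
  + ((ε₀ : ℂ) - 1) * ∫ y in R, u 1 y * star (φ 1 y) ∂cellMeasure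

lemma integrable_mul_star (u v : ScalarL2) :
    Integrable (fun y => u y * star (v y)) cellMeasure :=
  MemLp.integrable_mul (p := 2) (q := 2) (Lp.memLp u) (Lp.memLp v).star

lemma formC_add_left (R : Set Plane) (ε₀ : ℝ) (u v φ : VectorL2) :
    formC R ε₀ (u + v) φ = formC R ε₀ u φ + formC R ε₀ v φ := by
  have hI := integrable_mul_star
  have e1 : ∫ y, ((u + v) 0 y * star (φ 0 y) + (u + v) 1 y * star (φ 1 y)) ∂cellMeasure
      = ∫ y, (u 0 y * star (φ 0 y) + u 1 y * star (φ 1 y)) ∂cellMeasure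
        + ∫ y, (v 0 y * star (φ 0 y) + v 1 y * star (φ 1 y)) ∂cellMeasure := by
    have hII : ∀ a b c d : ScalarL2,
        Integrable (fun y => a y * star (b y) + c y * star (d y)) cellMeasure :=
      fun a b c d => (hI a b).add (hI c d)
    rw [← integral_add (hII _ _ _ _) (hII _ _ _ _)]
    refine integral_congr_ae ?_
    filter_upwards [Lp.coeFn_add (u 0) (v 0), Lp.coeFn_add (u 1) (v 1)] with y h0 h1
    simp only [PiLp.add_apply, h0, h1, Pi.add_apply]
    ring
  have e2 : ∫ y in R, (u + v) 1 y * star (φ 1 y) ∂cellMeasure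
      = ∫ y in R, u 1 y * star (φ 1 y) ∂cellMeasure
        + ∫ y in R, v 1 y * star (φ 1 y) ∂cellMeasure := by
    rw [← integral_add (hI _ _).restrict (hI _ _).restrict]
    refine integral_congr_ae ?_
    filter_upwards [ae_restrict_of_ae (Lp.coeFn_add (u 1) (v 1))] with y h1
    simp only [PiLp.add_apply, h1, Pi.add_apply]
    ring
  rw [formC, e1, e2, formC, formC]
  ring

lemma formC_smul_left (R : Set Plane) (ε₀ : ℝ) (a : ℂ) (u φ : VectorL2) :
    formC R ε₀ (a • u) φ = a * formC R ε₀ u φ := by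
  have e1 : ∫ y, ((a • u) 0 y * star (φ 0 y) + (a • u) 1 y * star (φ 1 y)) ∂cellMeasure
      = a * ∫ y, (u 0 y * star (φ 0 y) + u 1 y * star (φ 1 y)) ∂cellMeasure := by
    rw [← integral_const_mul]
    refine integral_congr_ae ?_
    filter_upwards [Lp.coeFn_smul a (u 0), Lp.coeFn_smul a (u 1)] with y h0 h1
    simp only [PiLp.smul_apply, h0, h1, Pi.smul_apply, smul_eq_mul]
    ring
  have e2 : ∫ y in R, (a • u) 1 y * star (φ 1 y) ∂cellMeasure
      = a * ∫ y in R, u 1 y * star (φ 1 y) ∂cellMeasure := by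
    rw [← integral_const_mul]
    refine integral_congr_ae ?_
    filter_upwards [ae_restrict_of_ae (Lp.coeFn_smul a (u 1))] with y h1
    simp only [PiLp.smul_apply, h1, Pi.smul_apply, smul_eq_mul]
    ring
  rw [formC, e1, e2, formC]
  ring

lemma formB_add_left (R : Set Plane) (ε₀ : ℝ) {u v : VectorL2} (hu : ∀ i, u i ∈ H1)
    (hv : ∀ i, v i ∈ H1) (φ : VectorL2) :
    formB R ε₀ (u + v) φ = formB R ε₀ u φ + formB R ε₀ v φ := by
  have hI := integrable_mul_star
  have hg : ∀ w z : ScalarL2, Integrable (fun y => grad w y ⬝ᵥ star (grad z y)) cellMeasure := by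
    intro w z
    simpa [grad, dotProduct, Fin.sum_univ_two, Pi.add_def, Pi.neg_def] using
      (hI (weakDeriv 0 w) (weakDeriv 0 z)).add (hI (weakDeriv 1 w) (weakDeriv 1 z))
  have hgp : ∀ w z : ScalarL2,
      Integrable (fun y => grad w y ⬝ᵥ star (gradPerp z y)) cellMeasure := by
    intro w z
    simpa [grad, gradPerp, dotProduct, Fin.sum_univ_two, Pi.add_def, Pi.neg_def] using
      (hI (weakDeriv 0 w) (weakDeriv 1 z)).neg.add (hI (weakDeriv 1 w) (weakDeriv 0 z))
  have hpg : ∀ w z : ScalarL2,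
      Integrable (fun y => gradPerp w y ⬝ᵥ star (grad z y)) cellMeasure := by
    intro w z
    simpa [grad, gradPerp, dotProduct, Fin.sum_univ_two, Pi.add_def, Pi.neg_def] using
      (hI (weakDeriv 1 w) (weakDeriv 0 z)).neg.add (hI (weakDeriv 0 w) (weakDeriv 1 z))
  have hD : ∀ i, (∀ᵐ y ∂cellMeasure, grad ((u + v) i) y = grad (u i) y + grad (v i) y) ∧
      ∀ᵐ y ∂cellMeasure, gradPerp ((u + v) i) y = gradPerp (u i) y + gradPerp (v i) y := by
    intro i
    have h0 := Lp.coeFn_add (weakDeriv 0 (u i)) (weakDeriv 0 (v i))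
    have h1 := Lp.coeFn_add (weakDeriv 1 (u i)) (weakDeriv 1 (v i))
    rw [← weakDeriv_add (hu i) (hv i)] at h0 h1
    constructor <;> filter_upwards [h0, h1] with y h0 h1
    · simp [grad, h0, h1]
    · simp [gradPerp, h0, h1, add_comm]
  have e1 : ∫ y in Rᶜ, (gradPerp ((u + v) 0) y ⬝ᵥ star (grad (φ 1) y)
      + grad ((u + v) 1) y ⬝ᵥ star (gradPerp (φ 0) y)) ∂cellMeasure
      = ∫ y in Rᶜ, (gradPerp (u 0) y ⬝ᵥ star (grad (φ 1) y)
      + grad (u 1) y ⬝ᵥ star (gradPerp (φ 0) y)) ∂cellMeasure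
      + ∫ y in Rᶜ, (gradPerp (v 0) y ⬝ᵥ star (grad (φ 1) y)
      + grad (v 1) y ⬝ᵥ star (gradPerp (φ 0) y)) ∂cellMeasure := by
    have hII : ∀ w : VectorL2, Integrable (fun y => gradPerp (w 0) y ⬝ᵥ star (grad (φ 1) y)
      + grad (w 1) y ⬝ᵥ star (gradPerp (φ 0) y)) cellMeasure := fun w =>
      (hpg _ _).add (hgp _ _)
    rw [← integral_add (hII u).restrict (hII v).restrict]
    refine integral_congr_ae (ae_restrict_of_ae ?_)
    filter_upwards [(hD 0).2, (hD 1).1] with y h0 h1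
    simp only [h0, h1, add_dotProduct]
    ring
  have hint : ∀ w : VectorL2, Integrable (fun y => grad (w 0) y ⬝ᵥ star (grad (φ 0) y)
      + (ε₀ : ℂ) * (grad (w 1) y ⬝ᵥ star (grad (φ 1) y))
      + gradPerp (w 0) y ⬝ᵥ star (grad (φ 1) y)
      + grad (w 1) y ⬝ᵥ star (gradPerp (φ 0) y)) cellMeasure := fun w =>
    (((hg _ _).add ((hg _ _).const_mul _)).add (hpg _ _)).add (hgp _ _)
  have e2 : ∫ y in R, (grad ((u + v) 0) y ⬝ᵥ star (grad (φ 0) y)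
      + (ε₀ : ℂ) * (grad ((u + v) 1) y ⬝ᵥ star (grad (φ 1) y))
      + gradPerp ((u + v) 0) y ⬝ᵥ star (grad (φ 1) y)
      + grad ((u + v) 1) y ⬝ᵥ star (gradPerp (φ 0) y)) ∂cellMeasure
      = ∫ y in R, (grad (u 0) y ⬝ᵥ star (grad (φ 0) y)
      + (ε₀ : ℂ) * (grad (u 1) y ⬝ᵥ star (grad (φ 1) y))
      + gradPerp (u 0) y ⬝ᵥ star (grad (φ 1) y)
      + grad (u 1) y ⬝ᵥ star (gradPerp (φ 0) y)) ∂cellMeasure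
      + ∫ y in R, (grad (v 0) y ⬝ᵥ star (grad (φ 0) y)
      + (ε₀ : ℂ) * (grad (v 1) y ⬝ᵥ star (grad (φ 1) y))
      + gradPerp (v 0) y ⬝ᵥ star (grad (φ 1) y)
      + grad (v 1) y ⬝ᵥ star (gradPerp (φ 0) y)) ∂cellMeasure := by
    rw [← integral_add (hint u).restrict (hint v).restrict]
    refine integral_congr_ae (ae_restrict_of_ae ?_)
    filter_upwards [(hD 0).1, (hD 0).2, (hD 1).1] with y h0 h0' h1
    simp only [h0, h0', h1, add_dotProduct]
    ring
  rw [formB, e1, e2, formB, formB]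
  ring

lemma formB_smul_left (R : Set Plane) (ε₀ : ℝ) (a : ℂ) {u : VectorL2} (hu : ∀ i, u i ∈ H1)
    (φ : VectorL2) : formB R ε₀ (a • u) φ = a * formB R ε₀ u φ := by
  have hD : ∀ i, (∀ᵐ y ∂cellMeasure, grad ((a • u) i) y = a • grad (u i) y) ∧
      ∀ᵐ y ∂cellMeasure, gradPerp ((a • u) i) y = a • gradPerp (u i) y := by
    intro i
    have h0 := Lp.coeFn_smul a (weakDeriv 0 (u i))
    have h1 := Lp.coeFn_smul a (weakDeriv 1 (u i))
    rw [← weakDeriv_smul a (hu i)] at h0 h1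
    constructor <;> filter_upwards [h0, h1] with y h0 h1
    · simp [grad, h0, h1]
    · simp [gradPerp, h0, h1]
  have e1 : ∫ y in Rᶜ, (gradPerp ((a • u) 0) y ⬝ᵥ star (grad (φ 1) y)
      + grad ((a • u) 1) y ⬝ᵥ star (gradPerp (φ 0) y)) ∂cellMeasure
      = a * ∫ y in Rᶜ, (gradPerp (u 0) y ⬝ᵥ star (grad (φ 1) y)
      + grad (u 1) y ⬝ᵥ star (gradPerp (φ 0) y)) ∂cellMeasure := by
    rw [← integral_const_mul]
    refine integral_congr_ae (ae_restrict_of_ae ?_)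
    filter_upwards [(hD 0).2, (hD 1).1] with y h0 h1
    simp only [h0, h1, smul_dotProduct, smul_eq_mul]
    ring
  have e2 : ∫ y in R, (grad ((a • u) 0) y ⬝ᵥ star (grad (φ 0) y)
      + (ε₀ : ℂ) * (grad ((a • u) 1) y ⬝ᵥ star (grad (φ 1) y))
      + gradPerp ((a • u) 0) y ⬝ᵥ star (grad (φ 1) y)
      + grad ((a • u) 1) y ⬝ᵥ star (gradPerp (φ 0) y)) ∂cellMeasure
      = a * ∫ y in R, (grad (u 0) y ⬝ᵥ star (grad (φ 0) y)
      + (ε₀ : ℂ) * (grad (u 1) y ⬝ᵥ star (grad (φ 1) y))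
      + gradPerp (u 0) y ⬝ᵥ star (grad (φ 1) y)
      + grad (u 1) y ⬝ᵥ star (gradPerp (φ 0) y)) ∂cellMeasure := by
    rw [← integral_const_mul]
    refine integral_congr_ae (ae_restrict_of_ae ?_)
    filter_upwards [(hD 0).1, (hD 0).2, (hD 1).1] with y h0 h0' h1
    simp only [h0, h0', h1, smul_dotProduct, smul_eq_mul]
    ring
  rw [formB, e1, e2, formB]
  ring

/-- The graph of the operator generated by the form `b` with form domain `V(θ)` in the closure of
`V(θ)` in `L²`, equipped with the inner product `c`: the pairs `(v, w)` with `v` in `V(θ)`, `w` in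
the closure of `V(θ)`, and `b(v, φ) = c(w, φ)` for all `φ` in `V(θ)`. -/
def criticalGraph (R : Set Plane) (ε₀ : ℝ) (θ : Plane) : Submodule ℂ (VectorL2 × VectorL2) where
  carrier := {p | p.1 ∈ constrainedSpace R θ ∧ p.2 ∈ (constrainedSpace R θ).topologicalClosure ∧
    ∀ φ ∈ constrainedSpace R θ, formB R ε₀ p.1 φ = formC R ε₀ p.2 φ}
  zero_mem' := by
    refine ⟨zero_mem _, zero_mem _, fun φ _ => ?_⟩
    have h1 := formB_smul_left R ε₀ 0 (u := 0) (fun _ => H1.zero) φ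
    have h2 := formC_smul_left R ε₀ 0 0 φ
    rw [zero_smul, zero_mul] at h1 h2
    exact h1.trans h2.symm
  add_mem' := by
    rintro p q ⟨h1, h2, h3⟩ ⟨k1, k2, k3⟩
    refine ⟨add_mem h1 k1, add_mem h2 k2, fun φ hφ => ?_⟩
    rw [Prod.fst_add, Prod.snd_add, formC_add_left,
      formB_add_left R ε₀ (fun i => (h1.1 i).1) (fun i => (k1.1 i).1), h3 φ hφ, k3 φ hφ]
  smul_mem' := by
    rintro a p ⟨h1, h2, h3⟩
    refine ⟨Submodule.smul_mem _ a h1, Submodule.smul_mem _ a h2, fun φ hφ => ?_⟩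
    rw [Prod.smul_fst, Prod.smul_snd, formC_smul_left,
      formB_smul_left R ε₀ a (fun i => (h1.1 i).1), h3 φ hφ]

/-- The critical-line operator `𝓑(θ)`. -/
def criticalOperator (R : Set Plane) (ε₀ : ℝ) (θ : Plane) : VectorL2 →ₗ.[ℂ] VectorL2 :=
  (criticalGraph R ε₀ θ).toLinearPMap

lemma formC_eq_inner {R : Set Plane} (hR : MeasurableSet R) (ε₀ : ℝ) (u : VectorL2) :
    ∃ w : ScalarL2, (w =ᵐ[cellMeasure] R.indicator (u 1)) ∧
      ∀ φ : VectorL2, formC R ε₀ u φ = inner ℂ φ u + ((ε₀ : ℂ) - 1) * inner ℂ (φ 1) w := by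
  have hI := integrable_mul_star
  have hm : MemLp (R.indicator (u 1)) 2 cellMeasure := (Lp.memLp (u 1)).indicator hR
  refine ⟨hm.toLp _, hm.coeFn_toLp, fun φ => ?_⟩
  have e1 : ∀ v w : ScalarL2, inner ℂ v w = ∫ y, w y * star (v y) ∂cellMeasure := fun v w => by
    rw [L2.inner_def]
    rfl
  have e2 : inner ℂ (φ 1) (hm.toLp _) = ∫ y in R, u 1 y * star (φ 1 y) ∂cellMeasure := by
    rw [e1, ← integral_indicator hR]
    refine integral_congr_ae ?_
    filter_upwards [hm.coeFn_toLp] with y hy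
    rw [hy]
    by_cases h : y ∈ R <;> simp [h]
  rw [e2, formC, PiLp.inner_apply, Fin.sum_univ_two, integral_add (hI _ _) (hI _ _), e1, e1]

/-- The graph above is single valued, so that the operator is well defined. -/
lemma mem_criticalOperator_graph {R : Set Plane} (hR : MeasurableSet R) {ε₀ : ℝ} (hε : 1 < ε₀)
    (θ : Plane) : (criticalOperator R ε₀ θ).graph = criticalGraph R ε₀ θ := by
  refine Submodule.toLinearPMap_graph_eq _ ?_
  rintro ⟨v, w⟩ ⟨-, h2, h3⟩ (rfl : v = 0)
  obtain ⟨z, hz, hzc⟩ := formC_eq_inner hR ε₀ w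
  have hB : ∀ φ, formB R ε₀ 0 φ = 0 := by
    intro φ
    have h1 := formB_smul_left R ε₀ 0 (u := 0) (fun _ => H1.zero) φ
    rwa [zero_smul, zero_mul] at h1
  have hcl : IsClosed {φ : VectorL2 | formC R ε₀ w φ = 0} := by
    simp only [hzc]
    refine isClosed_eq ?_ continuous_const
    have : Continuous fun φ : VectorL2 => φ 1 := PiLp.continuous_apply 2 _ 1
    fun_prop
  have hw : formC R ε₀ w w = 0 := by
    have hsub : (constrainedSpace R θ : Set VectorL2) ⊆ {φ | formC R ε₀ w φ = 0} :=
      fun φ hφ => (h3 φ hφ).symm.trans (hB φ)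
    exact closure_minimal hsub hcl h2
  have hzz : inner ℂ (w 1) z = ((‖z‖ ^ 2 : ℝ) : ℂ) := by
    have hn : inner ℂ z z = ((‖z‖ ^ 2 : ℝ) : ℂ) := by
      rw [inner_self_eq_norm_sq_to_K]
      push_cast
      rfl
    rw [← hn, L2.inner_def, L2.inner_def]
    refine integral_congr_ae ?_
    filter_upwards [hz] with y hy
    rw [hy]
    by_cases h : y ∈ R <;> simp [h]
  rw [hzc, hzz, inner_self_eq_norm_sq_to_K] at hw
  have hw' : ‖w‖ ^ 2 + (ε₀ - 1) * ‖z‖ ^ 2 = 0 := by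
    have := congrArg Complex.re hw
    norm_cast at this
  have : ‖w‖ ^ 2 = 0 := by nlinarith [sq_nonneg ‖w‖, mul_nonneg (sub_pos.2 hε).le (sq_nonneg ‖z‖)]
  exact norm_eq_zero.mp (pow_eq_zero_iff two_ne_zero |>.mp this)

/-- The eigenspace `{v ∈ dom T | T v = μ v}` of an unbounded operator. -/
def eigenspace (T : VectorL2 →ₗ.[ℂ] VectorL2) (μ : ℂ) : Submodule ℂ VectorL2 :=
  T.graph.comap (LinearMap.id.prod (μ • LinearMap.id))

/-- `l 0 ≤ l 1 ≤ l 2 ≤ …` is the list of all eigenvalues of `T`, in increasing order, tending to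
infinity, each eigenvalue being repeated according to its (geometric) multiplicity. The first
eigenvalue is `l 0`. -/
structure IsOrderedEigenvalues (T : VectorL2 →ₗ.[ℂ] VectorL2) (l : ℕ → ℝ) : Prop where
  nonneg : ∀ n, 0 ≤ l n
  monotone : Monotone l
  tendsto : Tendsto l atTop atTop
  multiplicity : ∀ μ : ℂ, Module.rank ℂ (eigenspace T μ) = Cardinal.mk {n : ℕ // (l n : ℂ) = μ}

end CriticalFibre

end

/-!
The eigenvalues of `𝓑(θ)` are obtained from a pair of quadratic forms depending on `θ` in a
Lipschitz continuous way, and are compared for different `θ` by the min-max principle.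

*The form.* On `V(θ)` the form `b` equals
`∫ ∇u₂·∇φ₂ + γ⁻¹ ∫ (div u div φ + curl u curl φ)` over the whole cell, with the second factors
conjugated (`formB_eq_inner`). Hence `b ≥ 0`, and `b + c` is coercive in `H¹`
(`norm_le_energyMap`): it controls `∇u₂`, and with it `∇u₁` through the divergence and the curl.

*A fixed Hilbert space.* The map `x ↦ e^{iθ·y} (1 - Δ)^{-1/2} x` is a bijection from `L²` vector
fields onto `θ`-quasi-periodic `H¹` vector fields (`blochMap`), because the plane waves form a
Hilbert basis of `L²` of the cell. In this parametrisation derivatives become bounded Fourier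
multipliers, `V(θ)` becomes a closed subspace `fibre R hR θ` of `L²`, and the forms become
`⟨F y, F x⟩ = b + c` and `⟨J y, J x⟩ = c`, where `F = energyMap` is bounded below and depends on
`θ` in a Lipschitz continuous way, while `J = massMap` is compact, injective and independent of `θ`.

*One value of `θ`.* Successive minimisation of `‖F y‖² / ‖J y‖²` produces all the eigenvalues
(`exists_spectralResolution`); they tend to infinity by compactness of `J`, and their multiplicities
are the dimensions of the eigenspaces (`rank_pencilEigenspace`). The sequence is infinite since the
fibre has infinite dimension (`not_finiteDimensional_fibre`), and it is unique since a monotone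
sequence is determined by the cardinalities of its fibres (`eq_of_monotone_of_mk_fiber_eq`).

*Dependence on `θ`.* The fibres themselves vary with `θ`, and the div-curl system degenerates at the
frequency zero when `θ = 0`. For data without zero frequency it has a solution bounded uniformly in
`θ` (`solve`, `norm_solve_le`). The constraints concern the complement of `R` only, so the zero
frequency of the data may be removed by subtracting a multiple of the indicator function of `R`,
whose mean is not zero. Correcting an element of the fibre at `θ` by
such a solution gives an element of the fibre at `θ'` that differs from it by `O(‖θ' - θ‖)`
(`norm_fibreProj_sub_le`), uniformly up to and including `θ = 0`. The min-max principle
(`SpectralResolution.sqrt_compare`) then shows that `(λₙ + 1)^{-1/2}` is Lipschitz continuous in `θ`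
(`exists_lipschitz_eigenvalues`), so that `λₙ` is continuous.
-/

noncomputable section

namespace CriticalFibre

/-! ### Spectral theory of a pair of forms -/

section AbstractSpectral

variable {X Z H : Type*} [NormedAddCommGroup X] [InnerProductSpace ℂ X]
  [NormedAddCommGroup Z] [InnerProductSpace ℂ Z]
  [NormedAddCommGroup H] [InnerProductSpace ℂ H]

lemma inner_self_eq_ofReal (v : X) : inner ℂ v v = ((‖v‖ ^ 2 : ℝ) : ℂ) := by
  rw [inner_self_eq_norm_sq_to_K]
  push_cast
  rfl

/-- A compact operator attains its norm, and a maximising vector is an eigenvector of `J† J`. -/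
lemma exists_norm_maximiser [CompleteSpace X] [CompleteSpace H] [Nontrivial X] (J : X →L[ℂ] H)
    (hJ : IsCompactOperator J) :
    ∃ (x : X) (κ : ℝ), ‖x‖ = 1 ∧ (∀ y, inner ℂ (J y) (J x) = (κ : ℂ) * inner ℂ y x) ∧
      ∀ y, ‖J y‖ ^ 2 ≤ κ * ‖y‖ ^ 2 := by
  by_cases h0 : J = 0
  · obtain ⟨v, hv⟩ := exists_norm_eq X (zero_le_one)
    exact ⟨v, 0, hv, by simp [h0], by simp [h0]⟩
  set K : X →L[ℂ] X := J.adjoint ∘L J with hK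
  have hKc : IsCompactOperator K := hJ.clm_comp J.adjoint
  have hKs : IsSelfAdjoint K := by
    rw [ContinuousLinearMap.isSelfAdjoint_iff', hK, ContinuousLinearMap.adjoint_comp,
      ContinuousLinearMap.adjoint_adjoint]
  have hKn : ‖K‖ = ‖J‖ * ‖J‖ := ContinuousLinearMap.norm_adjoint_comp_self J
  obtain ⟨μ, hμ, hμn⟩ := spectrum.exists_nnnorm_eq_spectralRadius K
  rw [hKs.spectralRadius_eq_nnnorm] at hμn
  have hμn' : ‖μ‖ = ‖K‖ := by
    have : ‖μ‖₊ = ‖K‖₊ := by exact_mod_cast hμn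
    exact congrArg NNReal.toReal this
  have hJpos : 0 < ‖J‖ := norm_pos_iff.2 h0
  have hμ0 : μ ≠ 0 := by
    rw [← norm_pos_iff, hμn', hKn]
    positivity
  obtain ⟨v, hv, hv0⟩ := ((hKc.hasEigenvalue_iff_mem_spectrum hμ0).2 hμ).exists_hasEigenvector
  have hv' : K v = μ • v := Module.End.mem_eigenspace_iff.1 hv
  have hin : ∀ y, inner ℂ (J y) (J v) = μ * inner ℂ y v := by
    intro y
    rw [← ContinuousLinearMap.adjoint_inner_right, ← inner_smul_right, ← hv']
    rfl
  have hvpos : 0 < ‖v‖ := norm_pos_iff.2 hv0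
  have hμr : μ = ((‖J‖ ^ 2 : ℝ) : ℂ) := by
    have h1 := hin v
    rw [inner_self_eq_norm_sq_to_K, inner_self_eq_norm_sq_to_K] at h1
    have h2 : μ = ((‖J v‖ ^ 2 / ‖v‖ ^ 2 : ℝ) : ℂ) := by
      have : ((‖v‖ : ℂ)) ≠ 0 := by exact_mod_cast hvpos.ne'
      push_cast
      rw [eq_div_iff (pow_ne_zero 2 this)]
      exact h1.symm
    have h3 : ‖μ‖ = ‖J v‖ ^ 2 / ‖v‖ ^ 2 := by
      rw [h2, Complex.norm_real, Real.norm_eq_abs, abs_of_nonneg (by positivity)]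
    rw [h2, ← h3, hμn', hKn, sq]
  refine ⟨((‖v‖⁻¹ : ℝ) : ℂ) • v, ‖J‖ ^ 2, ?_, ?_, ?_⟩
  · rw [norm_smul, Complex.norm_real, norm_inv, norm_norm, inv_mul_cancel₀ hvpos.ne']
  · intro y
    rw [map_smul, inner_smul_right, inner_smul_right, hin, hμr]
    ring
  · intro y
    rw [← mul_pow]
    exact pow_le_pow_left₀ (norm_nonneg _) (J.le_opNorm y) 2

/-- The sequence produced by successive maximisation of `‖J y‖` over the unit vectors `y`
orthogonal to those already found. -/
lemma exists_singular_sequence [CompleteSpace X] [CompleteSpace H] (hX : ¬ FiniteDimensional ℂ X)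
    (J : X →L[ℂ] H) (hJ : IsCompactOperator J) :
    ∃ (x : ℕ → X) (κ : ℕ → ℝ), Orthonormal ℂ x ∧
      (∀ n y, inner ℂ (J y) (J (x n)) = (κ n : ℂ) * inner ℂ y (x n)) ∧
      ∀ n y, (∀ m < n, inner ℂ (x m) y = 0) → ‖J y‖ ^ 2 ≤ κ n * ‖y‖ ^ 2 := by
  -- the implication under the quantifier makes the maximiser a function of all subspaces
  have key : ∀ S : Submodule ℂ X, ∃ p : X × ℝ, FiniteDimensional ℂ S →
      p.1 ∈ Sᗮ ∧ ‖p.1‖ = 1 ∧ (∀ y ∈ Sᗮ, inner ℂ (J y) (J p.1) = (p.2 : ℂ) * inner ℂ y p.1) ∧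
      ∀ y ∈ Sᗮ, ‖J y‖ ^ 2 ≤ p.2 * ‖y‖ ^ 2 := by
    intro S
    by_cases hS : FiniteDimensional ℂ S
    swap
    · exact ⟨0, fun h => absurd h hS⟩
    have hne : Sᗮ ≠ ⊥ := by
      intro h
      rw [Submodule.orthogonal_eq_bot_iff] at h
      rw [h] at hS
      exact hX (Module.Finite.equiv (Submodule.topEquiv (R := ℂ) (M := X)))
    have : Nontrivial Sᗮ := Submodule.nontrivial_iff_ne_bot.2 hne
    obtain ⟨x, κ, h1, h2, h3⟩ := exists_norm_maximiser (J ∘L Sᗮ.subtypeL) (hJ.comp_clm _)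
    exact ⟨(x, κ), fun _ => ⟨x.2, h1, fun y hy => h2 ⟨y, hy⟩, fun y hy => h3 ⟨y, hy⟩⟩⟩
  choose p hp using key
  obtain ⟨S, hS0, hS1⟩ : ∃ S : ℕ → Submodule ℂ X, S 0 = ⊥ ∧
      ∀ n, S (n + 1) = S n ⊔ Submodule.span ℂ {(p (S n)).1} :=
    ⟨fun n => Nat.rec ⊥ (fun _ T => T ⊔ Submodule.span ℂ {(p T).1}) n, rfl, fun _ => rfl⟩
  have hfin : ∀ n, FiniteDimensional ℂ (S n) := by
    intro n
    induction n with
    | zero => rw [hS0]; infer_instance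
    | succ n ih => rw [hS1]; infer_instance
  let x : ℕ → X := fun n => (p (S n)).1
  let κ : ℕ → ℝ := fun n => (p (S n)).2
  have hmono : Monotone S := monotone_nat_of_le_succ fun n => by rw [hS1]; exact le_sup_left
  have hmem : ∀ m n, m < n → x m ∈ S n := by
    intro m n hmn
    refine hmono (Nat.succ_le_of_lt hmn) ?_
    rw [Nat.succ_eq_add_one, hS1]
    exact Submodule.mem_sup_right (Submodule.mem_span_singleton_self _)
  have hspan : ∀ n (T : Submodule ℂ X), (∀ m < n, x m ∈ T) → S n ≤ T := by
    intro n
    induction n with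
    | zero => intro T _; rw [hS0]; exact bot_le
    | succ n ih =>
      intro T hT
      rw [hS1]
      refine sup_le (ih T fun m hm => hT m (hm.trans (Nat.lt_succ_self n))) ?_
      rw [Submodule.span_singleton_le_iff_mem]
      exact hT n (Nat.lt_succ_self n)
  have horth : ∀ m n, m < n → inner ℂ (x m) (x n) = 0 := fun m n hmn =>
    (hp (S n) (hfin n)).1 (x m) (hmem m n hmn)
  have hon : Orthonormal ℂ x := by
    refine ⟨fun n => (hp (S n) (hfin n)).2.1, fun m n hmn => ?_⟩
    rcases lt_or_gt_of_ne hmn with h | h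
    · exact horth m n h
    · exact inner_eq_zero_symm.1 (horth n m h)
  have hperp : ∀ n y, (∀ m < n, inner ℂ (x m) y = 0) → y ∈ (S n)ᗮ := by
    intro n y hy
    have : S n ≤ (Submodule.span ℂ {y})ᗮ := hspan n _ fun m hm => by
      rw [Submodule.mem_orthogonal_singleton_iff_inner_left]
      exact hy m hm
    intro u hu
    exact Submodule.mem_orthogonal_singleton_iff_inner_left.1 (this hu)
  refine ⟨x, κ, hon, ?_, fun n y hy => (hp (S n) (hfin n)).2.2.2 y (hperp n y hy)⟩
  intro n
  induction n using Nat.strong_induction_on with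
  | _ n ih =>
    intro y
    have := hfin n
    -- the vectors of `S n` contribute nothing to either side, by the identity for `m < n`
    have hz : ∀ s ∈ S n, inner ℂ (J s) (J (x n)) = 0 := by
      have : S n ≤ ((Submodule.span ℂ {J (x n)})ᗮ).comap J.toLinearMap := hspan n _ fun m hm => by
        rw [Submodule.mem_comap, Submodule.mem_orthogonal_singleton_iff_inner_left]
        refine inner_eq_zero_symm.1 ?_
        have := ih m hm (x n)
        rw [inner_eq_zero_symm.1 (horth m n hm), mul_zero] at this
        exact this
      intro s hs
      exact Submodule.mem_orthogonal_singleton_iff_inner_left.1 (this hs)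
    have hz' : ∀ s ∈ S n, inner ℂ s (x n) = 0 := (hp (S n) (hfin n)).1
    obtain ⟨s, hs, t, ht, rfl⟩ := (S n).exists_add_mem_mem_orthogonal y
    rw [map_add, inner_add_left, inner_add_left, hz s hs, hz' s hs, zero_add, zero_add]
    exact (hp (S n) (hfin n)).2.2.1 t ht

/-- `l 0 ≤ l 1 ≤ …` and `x 0, x 1, …` are the eigenvalues and eigenvectors of the form
`⟨F y, F x⟩` relative to the form `⟨J y, J x⟩`, given by the successive minimisation of the Rayleigh
quotient `‖F y‖² / ‖J y‖²`. -/
structure SpectralResolution (F : X →L[ℂ] Z) (J : X →L[ℂ] H) (l : ℕ → ℝ) (x : ℕ → X) : Prop where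
  orthonormal : Orthonormal ℂ fun n => J (x n)
  eigen : ∀ n y, inner ℂ (F y) (F (x n)) = (l n : ℂ) * inner ℂ (J y) (J (x n))
  min : ∀ n y, (∀ m < n, inner ℂ (J (x m)) (J y) = 0) → l n * ‖J y‖ ^ 2 ≤ ‖F y‖ ^ 2
  tendsto : Tendsto l atTop atTop

/-- The images of an orthonormal sequence under a compact operator cannot be orthogonal to each
other and bounded below. -/
lemma tendsto_singular_values {J : X →L[ℂ] H} (hJ : IsCompactOperator J) {x : ℕ → X} {κ : ℕ → ℝ}
    (hx : Orthonormal ℂ x)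
    (hκ : ∀ n y, inner ℂ (J y) (J (x n)) = (κ n : ℂ) * inner ℂ y (x n)) (hanti : Antitone κ)
    (hpos : ∀ n, 0 ≤ κ n) : Tendsto κ atTop (𝓝 0) := by
  have hn : ∀ m n, m ≠ n → ‖J (x m) - J (x n)‖ ^ 2 = κ m + κ n := by
    intro m n hmn
    have h1 : ∀ k, ‖J (x k)‖ ^ 2 = κ k := by
      intro k
      have := hκ k (x k)
      rw [inner_self_eq_ofReal, inner_self_eq_ofReal, hx.1, one_pow, Complex.ofReal_one,
        mul_one] at this
      exact Complex.ofReal_injective this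
    have h2 : inner ℂ (J (x m)) (J (x n)) = 0 := by
      rw [hκ, hx.2 hmn, mul_zero]
    rw [@norm_sub_sq ℂ, h1, h1, h2]
    simp
  refine Metric.tendsto_atTop.2 fun ε hε => ?_
  by_contra! hcon
  have hlow : ∀ n, ε ≤ κ n := by
    intro n
    obtain ⟨N, hN, h⟩ := hcon n
    rw [Real.dist_eq, sub_zero, abs_of_nonneg (hpos N)] at h
    exact h.trans (hanti hN)
  obtain ⟨C, hC, hC'⟩ := hJ.image_closedBall_subset_compact 1
  obtain ⟨y, -, ψ, hψ, hψy⟩ := hC.tendsto_subseq (x := fun n => J (x n))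
    (fun n => hC' ⟨x n, by simp [hx.1 n], rfl⟩)
  obtain ⟨N, hN⟩ := Metric.cauchySeq_iff'.1 hψy.cauchySeq (Real.sqrt ε) (Real.sqrt_pos.2 hε)
  have h1 := hN (N + 1) (Nat.le_succ N)
  rw [dist_eq_norm] at h1
  have h2 := hn (ψ (N + 1)) (ψ N) (hψ (Nat.lt_succ_self N)).ne'
  have h3 : ‖J (x (ψ (N + 1))) - J (x (ψ N))‖ ^ 2 < ε := by
    have := pow_lt_pow_left₀ h1 (norm_nonneg _) two_ne_zero
    rwa [Real.sq_sqrt hε.le] at this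
  linarith [hlow (ψ (N + 1)), hlow (ψ N)]

/-- If `J` is compact and injective and `F` is bounded below, then the pair has a resolution, namely
that of the compact operator `J F⁻¹` on the range of `F`, with the eigenvectors rescaled. -/
theorem exists_spectralResolution [CompleteSpace X] [CompleteSpace Z] [CompleteSpace H]
    (hX : ¬ FiniteDimensional ℂ X) (F : X →L[ℂ] Z) (J : X →L[ℂ] H)
    (hJ : IsCompactOperator J) (hJi : Function.Injective J) {c : ℝ} (hc : 0 < c)
    (hF : ∀ x, c * ‖x‖ ≤ ‖F x‖) :
    ∃ l x, SpectralResolution F J l x := by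
  have hFa : AntilipschitzWith (Real.toNNReal c⁻¹) F := by
    refine ContinuousLinearMap.antilipschitz_of_bound _ fun x => ?_
    rw [Real.coe_toNNReal _ (by positivity)]
    rw [inv_mul_eq_div, le_div_iff₀ hc, mul_comm]
    exact hF x
  have hFc : IsClosed (Set.range F) := hFa.isClosed_range F.uniformContinuous
  let e := F.equivRange hFa.injective hFc
  have : CompleteSpace F.range := hFc.completeSpace_coe
  have he : ∀ x, (e x : Z) = F x := fun x => rfl
  have he' : ∀ y, F (e.symm y) = y := fun y => by rw [← he, e.apply_symm_apply]
  have hY : ¬ FiniteDimensional ℂ F.range := fun h =>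
    hX (Module.Finite.equiv e.symm.toLinearEquiv)
  obtain ⟨y, κ, hy, hyκ, hymin⟩ := exists_singular_sequence hY
    (J ∘L (e.symm : F.range →L[ℂ] X)) (hJ.comp_clm _)
  have hn : ∀ n, ‖J (e.symm (y n))‖ ^ 2 = κ n := by
    intro n
    have := hyκ n (y n)
    rw [inner_self_eq_ofReal, inner_self_eq_ofReal, hy.1, one_pow, Complex.ofReal_one,
      mul_one] at this
    exact Complex.ofReal_injective this
  have hκpos : ∀ n, 0 < κ n := by
    intro n
    rw [← hn, sq_pos_iff, norm_ne_zero_iff]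
    intro h
    have h2 : y n = 0 := by
      have := hJi (h.trans (map_zero J).symm)
      simpa using this
    have h1 := hy.1 n
    rw [h2, norm_zero] at h1
    exact zero_ne_one h1
  have hanti : Antitone κ := by
    refine antitone_nat_of_succ_le fun n => ?_
    have := hymin n (y (n + 1)) fun m hm => hy.2 (by omega)
    rw [hy.1] at this
    rw [← hn (n + 1)]
    simpa using this
  have htend := tendsto_singular_values (hJ.comp_clm _) hy hyκ hanti fun n => (hκpos n).le
  -- rescaling by `κ⁻¹ᐟ²` turns `‖F x‖ = 1` into `‖J x‖ = 1`
  let r : ℕ → ℝ := fun n => (Real.sqrt (κ n))⁻¹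
  have hr2 : ∀ n, r n * r n = (κ n)⁻¹ := fun n => by
    rw [← mul_inv, Real.mul_self_sqrt (hκpos n).le]
  have hr0 : ∀ n, (r n : ℂ) ≠ 0 := fun n =>
    Complex.ofReal_ne_zero.2 (inv_pos.2 (Real.sqrt_pos.2 (hκpos n))).ne'
  let x : ℕ → X := fun n => (r n : ℂ) • e.symm (y n)
  have hJx : ∀ n v, inner ℂ (J v) (J (x n)) = (r n : ℂ) * (κ n) * inner ℂ (F v) (y n : Z) := by
    intro n v
    have := hyκ n (e v)
    simp only [ContinuousLinearMap.comp_apply, ContinuousLinearEquiv.coe_coe,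
      e.symm_apply_apply] at this
    rw [map_smul, inner_smul_right, this, mul_assoc]
    rfl
  have hFx : ∀ n, F (x n) = (r n : ℂ) • (y n : Z) := fun n => by rw [map_smul, he']
  refine ⟨fun n => (κ n)⁻¹, x, ⟨?_, ?_, ?_, ?_⟩⟩
  · rw [orthonormal_iff_ite]
    intro m n
    have hyy : inner ℂ (y m : Z) (y n : Z) = if m = n then (1 : ℂ) else 0 :=
      orthonormal_iff_ite.1 hy m n
    rw [hJx, hFx, inner_smul_left, hyy]
    by_cases h : m = n
    · subst h
      rw [if_pos rfl, Complex.conj_ofReal, mul_one]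
      have h3 : r m * κ m * r m = 1 := by
        rw [mul_right_comm, hr2, inv_mul_cancel₀ (hκpos m).ne']
      exact_mod_cast h3
    · rw [if_neg h, mul_zero, mul_zero]
  · intro n v
    rw [hFx, hJx, inner_smul_right]
    have : (κ n : ℂ) ≠ 0 := Complex.ofReal_ne_zero.2 (hκpos n).ne'
    push_cast
    field_simp
  · intro n v hv
    have := hymin n (e v) fun m hm => by
      have h := inner_eq_zero_symm.1 (hv m hm)
      rw [hJx] at h
      have h' := (mul_eq_zero.1 h).resolve_left
        (mul_ne_zero (hr0 m) (Complex.ofReal_ne_zero.2 (hκpos m).ne'))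
      exact inner_eq_zero_symm.1 h'
    simp only [ContinuousLinearMap.comp_apply, ContinuousLinearEquiv.coe_coe,
      e.symm_apply_apply] at this
    rw [inv_mul_le_iff₀ (hκpos n)]
    exact this
  · exact tendsto_inv_nhdsGT_zero.comp
      (tendsto_nhdsWithin_iff.2 ⟨htend, Eventually.of_forall hκpos⟩)

namespace SpectralResolution

variable {F : X →L[ℂ] Z} {J : X →L[ℂ] H} {l : ℕ → ℝ} {x : ℕ → X}

lemma norm_sq_eigenvector (h : SpectralResolution F J l x) (n : ℕ) : ‖F (x n)‖ ^ 2 = l n := by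
  have := h.eigen n (x n)
  rw [inner_self_eq_ofReal, inner_self_eq_ofReal, h.orthonormal.1, one_pow, Complex.ofReal_one,
    mul_one] at this
  exact Complex.ofReal_injective this

lemma monotone (h : SpectralResolution F J l x) : Monotone l := by
  refine monotone_nat_of_le_succ fun n => ?_
  have := h.min n (x (n + 1)) fun m hm => h.orthonormal.2 (by omega)
  rwa [h.orthonormal.1, one_pow, mul_one, h.norm_sq_eigenvector] at this

lemma one_le (h : SpectralResolution F J l x) (hle : ∀ y, ‖J y‖ ≤ ‖F y‖) (n : ℕ) : 1 ≤ l n := by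
  have h1 := hle (x n)
  rw [h.orthonormal.1] at h1
  rw [← h.norm_sq_eigenvector]
  exact one_le_pow₀ h1

/-- Completeness of the eigenvectors. -/
lemma eq_zero (h : SpectralResolution F J l x) (hJ : Function.Injective J) {y : X}
    (hy : ∀ n, inner ℂ (J (x n)) (J y) = 0) : y = 0 := by
  by_contra h0
  have hpos : 0 < ‖J y‖ ^ 2 := by
    have : J y ≠ 0 := fun h' => h0 (hJ (h'.trans (map_zero J).symm))
    positivity
  obtain ⟨n, hn⟩ := (h.tendsto.eventually_gt_atTop (‖F y‖ ^ 2 / ‖J y‖ ^ 2)).exists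
  rw [div_lt_iff₀ hpos] at hn
  exact absurd (h.min n y fun m _ => hy m) (not_le.2 hn)

/-- The eigenspace of the pair of forms for the eigenvalue `μ`. -/
def pencilEigenspace (F : X →L[ℂ] Z) (J : X →L[ℂ] H) (μ : ℂ) : Submodule ℂ X where
  carrier := {v | ∀ y, inner ℂ (F y) (F v) = μ * inner ℂ (J y) (J v)}
  zero_mem' := by simp
  add_mem' := by
    intro a b ha hb y
    simp only [map_add, inner_add_right, mul_add, ha y, hb y]
  smul_mem' := by
    intro c a ha y
    simp only [map_smul, inner_smul_right, ha y]
    ring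

lemma pencilEigenspace_eq_span (h : SpectralResolution F J l x) (hJ : Function.Injective J)
    (μ : ℂ) : pencilEigenspace F J μ =
      Submodule.span ℂ (Set.range fun n : {n : ℕ // (l n : ℂ) = μ} => x n) := by
  have hgen : ∀ n : {n : ℕ // (l n : ℂ) = μ}, x n ∈ pencilEigenspace F J μ := fun n y => by
    rw [h.eigen, n.2]
  have hfin : Finite {n : ℕ // (l n : ℂ) = μ} := by
    obtain ⟨N, hN⟩ := (h.tendsto.eventually_gt_atTop μ.re).exists_forall_of_atTop
    refine Set.Finite.subset (Set.finite_Iio N) fun n hn => ?_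
    by_contra hn'
    have h1 : l n = μ.re := by rw [← hn, Complex.ofReal_re]
    exact absurd (hN n (not_lt.1 hn')) (by rw [h1]; exact lt_irrefl _)
  have := Fintype.ofFinite {n : ℕ // (l n : ℂ) = μ}
  refine le_antisymm (fun v hv => ?_) (Submodule.span_le.2 ?_)
  · have hsub : v - ∑ n : {n : ℕ // (l n : ℂ) = μ}, inner ℂ (J (x n)) (J v) • x n = 0 := by
      refine h.eq_zero hJ fun m => ?_
      simp only [map_sub, map_sum, map_smul, inner_sub_right, inner_sum, inner_smul_right,
        orthonormal_iff_ite.1 h.orthonormal]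
      by_cases hm : (l m : ℂ) = μ
      · rw [Finset.sum_eq_single ⟨m, hm⟩]
        · simp
        · intro b _ hb
          have : m ≠ b := fun h' => hb (Subtype.ext h'.symm)
          simp [this]
        · simp
      · -- eigenvectors for different eigenvalues are orthogonal
        have h1 : inner ℂ (J (x m)) (J v) = 0 := by
          have e1 := hv (x m)
          have e2 := congrArg (starRingEnd ℂ) (h.eigen m v)
          rw [map_mul, inner_conj_symm, inner_conj_symm, Complex.conj_ofReal] at e2
          have e3 : ((l m : ℂ) - μ) * inner ℂ (J (x m)) (J v) = 0 := by
            rw [sub_mul, ← e1, ← e2, sub_self]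
          exact (mul_eq_zero.1 e3).resolve_left (sub_ne_zero.2 hm)
        rw [h1, Finset.sum_eq_zero, sub_zero]
        intro b _
        have : m ≠ b := fun h' => hm (by rw [h']; exact b.2)
        simp [this]
    rw [sub_eq_zero.1 hsub]
    exact Submodule.sum_mem _ fun n _ =>
      Submodule.smul_mem _ _ (Submodule.subset_span ⟨n, rfl⟩)
  · rintro _ ⟨n, rfl⟩
    exact hgen n

lemma linearIndependent (h : SpectralResolution F J l x) : LinearIndependent ℂ x :=
  LinearIndependent.of_comp J.toLinearMap h.orthonormal.linearIndependent

/-- The space `X` lies in the lowest universe, for the rank to be comparable with the cardinality of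
a set of natural numbers. -/
lemma rank_pencilEigenspace {X : Type} [NormedAddCommGroup X] [InnerProductSpace ℂ X]
    {F : X →L[ℂ] Z} {J : X →L[ℂ] H} {l : ℕ → ℝ} {x : ℕ → X} (h : SpectralResolution F J l x)
    (hJ : Function.Injective J) (μ : ℂ) :
    Module.rank ℂ (pencilEigenspace F J μ) = Cardinal.mk {n : ℕ // (l n : ℂ) = μ} := by
  have hli := h.linearIndependent.comp (fun n : {n : ℕ // (l n : ℂ) = μ} => (n : ℕ))
    Subtype.val_injective
  rw [h.pencilEigenspace_eq_span hJ μ]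
  refine (rank_span hli).trans ?_
  exact Cardinal.mk_range_eq _ hli.injective

/-- Comparison of two resolutions by the min-max principle: some combination of the first `n + 1`
eigenvectors of the first is mapped by `Φ` to a vector that is admissible for the `n`-th minimum of
the second. -/
lemma sqrt_compare {X' Z' H' : Type*} [NormedAddCommGroup X'] [InnerProductSpace ℂ X']
    [NormedAddCommGroup Z'] [InnerProductSpace ℂ Z']
    [NormedAddCommGroup H'] [InnerProductSpace ℂ H']
    {F' : X' →L[ℂ] Z'} {J' : X' →L[ℂ] H'} {l' : ℕ → ℝ} {x' : ℕ → X'}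
    (h : SpectralResolution F J l x) (h' : SpectralResolution F' J' l' x')
    (Φ : X →ₗ[ℂ] X') {η : ℝ} (hη : 0 ≤ η) (hF : ∀ y, ‖F' (Φ y)‖ ≤ (1 + η) * ‖F y‖)
    (hJ : ∀ y, ‖J y‖ - η * ‖F y‖ ≤ ‖J' (Φ y)‖) (n : ℕ) :
    Real.sqrt (l' n) * (1 - η * Real.sqrt (l n)) ≤ (1 + η) * Real.sqrt (l n) := by
  -- when the second factor on the left is not positive, there is nothing to compare
  rcases le_or_gt (1 - η * Real.sqrt (l n)) 0 with hneg | hpos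
  · exact (mul_nonpos_of_nonneg_of_nonpos (Real.sqrt_nonneg _) hneg).trans (by positivity)
  let comb : (Fin (n + 1) → ℂ) →ₗ[ℂ] X := Fintype.linearCombination ℂ fun i : Fin (n + 1) => x i
  have hcomb : ∀ a, comb a = ∑ i, a i • x (i : ℕ) := fun a => rfl
  let f : (Fin (n + 1) → ℂ) →ₗ[ℂ] (Fin n → ℂ) := LinearMap.pi fun i =>
    (innerSL ℂ (J' (x' i))).toLinearMap ∘ₗ J'.toLinearMap ∘ₗ Φ ∘ₗ comb
  -- `n` linear conditions on `n + 1` coefficients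
  obtain ⟨a, ha, ha0⟩ := Submodule.exists_mem_ne_zero_of_ne_bot
    (f.ker_ne_bot_of_finrank_lt (by simp))
  have hlpos : ∀ m, 0 ≤ l m := fun m => by rw [← h.norm_sq_eigenvector]; positivity
  have hJa : ‖J (comb a)‖ ^ 2 = ∑ i, ‖a i‖ ^ 2 := by
    have hon := h.orthonormal.comp (fun i : Fin (n + 1) => (i : ℕ)) Fin.val_injective
    have := hon.inner_sum a a Finset.univ
    have e : J (comb a) = ∑ i, a i • ((fun n => J (x n)) ∘ fun i : Fin (n + 1) => (i : ℕ)) i := by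
      rw [hcomb, map_sum]
      simp
    rw [← e, inner_self_eq_ofReal] at this
    have e2 : ∀ i, (starRingEnd ℂ) (a i) * a i = ((‖a i‖ ^ 2 : ℝ) : ℂ) := fun i => by
      rw [mul_comm, Complex.mul_conj, Complex.normSq_eq_norm_sq]
    simp only [e2] at this
    exact_mod_cast this
  have hFa : ‖F (comb a)‖ ^ 2 ≤ l n * ‖J (comb a)‖ ^ 2 := by
    have e1 : inner ℂ (F (comb a)) (F (comb a))
        = ((∑ i : Fin (n + 1), l i * ‖a i‖ ^ 2 : ℝ) : ℂ) := by
      have e2 : ∀ j : Fin (n + 1), inner ℂ (J (comb a)) (J (x j)) = starRingEnd ℂ (a j) := by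
        intro j
        rw [hcomb, map_sum, sum_inner]
        simp only [map_smul, inner_smul_left, orthonormal_iff_ite.1 h.orthonormal,
          Fin.val_inj]
        simp
      have e4 : F (comb a) = ∑ j : Fin (n + 1), a j • F (x j) := by
        rw [hcomb, map_sum]
        simp
      nth_rewrite 2 [e4]
      rw [inner_sum]
      push_cast
      refine Finset.sum_congr rfl fun j _ => ?_
      rw [inner_smul_right, h.eigen, e2, ← Complex.ofReal_pow,
        ← Complex.normSq_eq_norm_sq, ← Complex.mul_conj]
      ring
    rw [inner_self_eq_ofReal] at e1
    have e3 : ‖F (comb a)‖ ^ 2 = ∑ i : Fin (n + 1), l i * ‖a i‖ ^ 2 := by exact_mod_cast e1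
    rw [e3, hJa, Finset.mul_sum]
    refine Finset.sum_le_sum fun i _ => ?_
    exact mul_le_mul_of_nonneg_right (h.monotone (Nat.lt_succ_iff.1 i.2)) (by positivity)
  have hJpos : 0 < ‖J (comb a)‖ := by
    have : 0 < ‖J (comb a)‖ ^ 2 := by
      rw [hJa]
      obtain ⟨i, hi⟩ := Function.ne_iff.1 ha0
      exact Finset.sum_pos' (fun _ _ => by positivity) ⟨i, Finset.mem_univ _, by
        have : 0 < ‖a i‖ := norm_pos_iff.2 hi
        positivity⟩
    exact pos_of_mul_pos_left (by rwa [sq] at this) (norm_nonneg _)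
  have hFa' : ‖F (comb a)‖ ≤ Real.sqrt (l n) * ‖J (comb a)‖ := by
    refine le_of_sq_le_sq ?_ (by positivity)
    rw [mul_pow, Real.sq_sqrt (hlpos n)]
    exact hFa
  have hmin : Real.sqrt (l' n) * ‖J' (Φ (comb a))‖ ≤ ‖F' (Φ (comb a))‖ := by
    refine le_of_sq_le_sq ?_ (norm_nonneg _)
    have hl' : 0 ≤ l' n := by rw [← h'.norm_sq_eigenvector]; positivity
    rw [mul_pow, Real.sq_sqrt hl']
    refine h'.min n _ fun m hm => ?_
    exact congrFun (LinearMap.mem_ker.1 ha) ⟨m, hm⟩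
  have h1 : (1 - η * Real.sqrt (l n)) * ‖J (comb a)‖ ≤ ‖J' (Φ (comb a))‖ := by
    have := hJ (comb a)
    have h2 := mul_le_mul_of_nonneg_left hFa' hη
    nlinarith
  have h2 := mul_le_mul_of_nonneg_left h1 (Real.sqrt_nonneg (l' n))
  have h3 := hF (comb a)
  have h4 := mul_le_mul_of_nonneg_left hFa' (by positivity : 0 ≤ 1 + η)
  refine le_of_mul_le_mul_right ?_ hJpos
  linarith

end SpectralResolution

/-- A non-decreasing real sequence is determined by the number of times it takes each value. -/
lemma eq_of_monotone_of_mk_fiber_eq {l l' : ℕ → ℝ} (hl : Monotone l) (hl' : Monotone l')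
    (h : ∀ μ : ℂ, Cardinal.mk {n : ℕ // (l n : ℂ) = μ} = Cardinal.mk {n : ℕ // (l' n : ℂ) = μ}) :
    l = l' := by
  have key : ∀ {l l' : ℕ → ℝ}, Monotone l → Monotone l' →
      (∀ μ : ℂ, Cardinal.mk {n : ℕ // (l n : ℂ) = μ} = Cardinal.mk {n : ℕ // (l' n : ℂ) = μ}) →
      ∀ n, l' n ≤ l n := by
    intro l l' hl hl' h n
    let σ : ℕ ≃ ℕ := Equiv.ofFiberEquiv (f := fun n => (l n : ℂ)) (g := fun n => (l' n : ℂ))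
      fun μ => (Cardinal.eq.1 (h μ)).some
    have hσ : ∀ m, l' (σ m) = l m := fun m => by
      have := Equiv.ofFiberEquiv_map (f := fun n => (l n : ℂ)) (g := fun n => (l' n : ℂ))
        (fun μ => (Cardinal.eq.1 (h μ)).some) m
      exact_mod_cast this
    -- one of the `n + 1` distinct indices `σ 0, …, σ n` is at least `n`
    obtain ⟨j, hj, hjn⟩ : ∃ j ≤ n, n ≤ σ j := by
      by_contra! hcon
      have := Finset.card_le_card_of_injOn (s := Finset.range (n + 1)) (t := Finset.range n) σ
        (fun j hj => by simpa using hcon j (by simpa [Nat.lt_succ_iff] using hj))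
        σ.injective.injOn
      simp at this
    exact (hl' hjn).trans ((hσ j).le.trans (hl hj))
  funext n
  exact le_antisymm (key hl' hl (fun μ => (h μ).symm) n) (key hl hl' h n)

end AbstractSpectral

/-! ### Fourier analysis on the cell -/

lemma memLp_bounded_mul {g : Plane → ℂ} (hg : Measurable g) (h1 : ∀ y, ‖g y‖ ≤ 1)
    (u : ScalarL2) : MemLp (fun y => g y * u y) 2 cellMeasure :=
  (Lp.memLp u).mono (hg.aestronglyMeasurable.mul (Lp.memLp u).1) (Eventually.of_forall fun y => by
    rw [norm_mul]
    exact mul_le_of_le_one_left (norm_nonneg _) (h1 y))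

/-- Multiplication by a measurable function bounded by one, as an operator on `L²` of the cell. -/
def mulL (g : Plane → ℂ) (hg : Measurable g) (h1 : ∀ y, ‖g y‖ ≤ 1) : ScalarL2 →L[ℂ] ScalarL2 :=
  LinearMap.mkContinuous
    { toFun := fun u => (memLp_bounded_mul hg h1 u).toLp _
      map_add' := fun u v => by
        refine Lp.ext ?_
        filter_upwards [(memLp_bounded_mul hg h1 (u + v)).coeFn_toLp,
          (memLp_bounded_mul hg h1 u).coeFn_toLp, (memLp_bounded_mul hg h1 v).coeFn_toLp,
          Lp.coeFn_add u v, Lp.coeFn_add ((memLp_bounded_mul hg h1 u).toLp _)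
            ((memLp_bounded_mul hg h1 v).toLp _)] with y e1 e2 e3 e4 e5
        rw [e1, e5, Pi.add_apply, e2, e3, e4, Pi.add_apply, mul_add]
      map_smul' := fun a u => by
        refine Lp.ext ?_
        filter_upwards [(memLp_bounded_mul hg h1 (a • u)).coeFn_toLp,
          (memLp_bounded_mul hg h1 u).coeFn_toLp, Lp.coeFn_smul a u,
          Lp.coeFn_smul a ((memLp_bounded_mul hg h1 u).toLp _)] with y e1 e2 e3 e4
        rw [e1, RingHom.id_apply, e4, Pi.smul_apply, e2, e3, Pi.smul_apply, smul_eq_mul,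
          smul_eq_mul, mul_left_comm] }
    1 fun u => by
      rw [one_mul]
      refine Lp.norm_le_norm_of_ae_le ?_
      filter_upwards [(memLp_bounded_mul hg h1 u).coeFn_toLp] with y hy
      change ‖((memLp_bounded_mul hg h1 u).toLp _ : ScalarL2) y‖ ≤ _
      rw [hy, norm_mul]
      exact mul_le_of_le_one_left (norm_nonneg _) (h1 y)

section mulL

variable {g : Plane → ℂ} {hg : Measurable g} {h1 : ∀ y, ‖g y‖ ≤ 1}

lemma coeFn_mulL (u : ScalarL2) : mulL g hg h1 u =ᵐ[cellMeasure] fun y => g y * u y :=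
  (memLp_bounded_mul hg h1 u).coeFn_toLp

lemma norm_mulL_apply_le (u : ScalarL2) : ‖mulL g hg h1 u‖ ≤ ‖u‖ := by
  refine Lp.norm_le_norm_of_ae_le ?_
  filter_upwards [coeFn_mulL (hg := hg) (h1 := h1) u] with y hy
  rw [hy, norm_mul]
  exact mul_le_of_le_one_left (norm_nonneg _) (h1 y)

lemma inner_eq_integral (v w : ScalarL2) :
    inner ℂ v w = ∫ y, w y * star (v y) ∂cellMeasure := by
  rw [L2.inner_def]
  rfl

lemma inner_mulL_mulL (hu : ∀ y, ‖g y‖ = 1) (u v : ScalarL2) :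
    inner ℂ (mulL g hg h1 u) (mulL g hg h1 v) = inner ℂ u v := by
  rw [inner_eq_integral, inner_eq_integral]
  refine integral_congr_ae ?_
  filter_upwards [coeFn_mulL (hg := hg) (h1 := h1) u, coeFn_mulL (hg := hg) (h1 := h1) v]
    with y e1 e2
  rw [e1, e2, star_mul']
  have : g y * star (g y) = 1 := by
    rw [Complex.star_def, Complex.mul_conj, Complex.normSq_eq_norm_sq, hu]
    simp
  linear_combination (v y * star (u y)) * this

end mulL

/-- The plane wave `e^{iθ·y}`. -/
def wave (θ y : Plane) : ℂ := Complex.exp (Complex.I * ((θ ⬝ᵥ y : ℝ) : ℂ))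

lemma norm_wave (θ y : Plane) : ‖wave θ y‖ = 1 := by
  rw [wave, mul_comm, Complex.norm_exp_ofReal_mul_I]

lemma contDiff_wave (θ : Plane) : ContDiff ℝ ∞ (wave θ) := by
  have h : ContDiff ℝ ∞ fun y : Plane => ((θ ⬝ᵥ y : ℝ) : ℂ) := by
    refine Complex.ofRealCLM.contDiff.comp ?_
    change ContDiff ℝ ∞ fun y : Plane => ∑ i, θ i * y i
    exact ContDiff.sum fun i _ => contDiff_const.mul (contDiff_apply ℝ ℝ i)
  exact (contDiff_const.mul h).cexp

lemma measurable_wave (θ : Plane) : Measurable (wave θ) := (contDiff_wave θ).continuous.measurable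

lemma star_wave (θ y : Plane) : star (wave θ y) = wave (-θ) y := by
  rw [wave, wave, Complex.star_def, ← Complex.exp_conj, neg_dotProduct, map_mul, Complex.conj_I,
    Complex.conj_ofReal]
  push_cast
  ring_nf

lemma wave_add (θ θ' y : Plane) : wave (θ + θ') y = wave θ y * wave θ' y := by
  rw [wave, wave, wave, ← Complex.exp_add, add_dotProduct]
  push_cast
  ring_nf

lemma hasFDerivAt_wave (θ y : Plane) : ∃ L : Plane →L[ℝ] ℂ, HasFDerivAt (wave θ) L y ∧
    ∀ j, L (Pi.single j 1) = Complex.I * θ j * wave θ y := by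
  let L₀ : Plane →L[ℝ] ℝ := ∑ i, θ i • ContinuousLinearMap.proj i
  have h0 : ∀ z : Plane, L₀ z = θ ⬝ᵥ z := fun z => by
    simp [L₀, dotProduct]
  have h1 : HasFDerivAt (fun z : Plane => ((θ ⬝ᵥ z : ℝ) : ℂ)) (Complex.ofRealCLM ∘L L₀) y := by
    simp only [← h0]
    exact (Complex.ofRealCLM ∘L L₀).hasFDerivAt
  refine ⟨_, (h1.const_mul Complex.I).cexp, fun j => ?_⟩
  simp only [smul_apply, ContinuousLinearMap.comp_apply, h0, smul_eq_mul,
    Complex.ofRealCLM_apply, dotProduct_single, wave, mul_one]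
  ring

lemma pderiv_wave (θ : Plane) (j : Fin 2) (y : Plane) :
    pderiv j (wave θ) y = Complex.I * θ j * wave θ y := by
  obtain ⟨L, hL, h⟩ := hasFDerivAt_wave θ y
  rw [pderiv, hL.fderiv, h]

lemma pderiv_mul {φ ψ : Plane → ℂ} (hφ : ContDiff ℝ ∞ φ) (hψ : ContDiff ℝ ∞ ψ) (j : Fin 2)
    (y : Plane) :
    pderiv j (fun z => φ z * ψ z) y = pderiv j φ y * ψ y + φ y * pderiv j ψ y := by
  have h1 := (hφ.differentiable (by simp) y).hasFDerivAt
  have h2 := (hψ.differentiable (by simp) y).hasFDerivAt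
  rw [pderiv, show (fun z => φ z * ψ z) = φ * ψ from rfl, (h1.mul h2).fderiv]
  simp only [pderiv, add_apply, smul_apply, smul_eq_mul]
  ring

/-- `φ` takes the same values on the two opposite edges of the cell orthogonal to direction `j`. -/
def EdgePeriodic (j : Fin 2) (φ : Plane → ℂ) : Prop :=
  ∀ y : Plane, y j = -Real.pi → φ (y + Pi.single j (2 * Real.pi)) = φ y

lemma IsCellPeriodic.edgePeriodic {φ : Plane → ℂ} (h : IsCellPeriodic φ) (j : Fin 2) :
    EdgePeriodic j φ := fun y _ => h j y

lemma edgePeriodic_of_tsupport_subset {φ : Plane → ℂ} (h : tsupport φ ⊆ interior cell)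
    (j : Fin 2) : EdgePeriodic j φ := by
  have hz : ∀ z : Plane, ¬ (z j ∈ Set.Ioo (-Real.pi) Real.pi) → φ z = 0 := by
    intro z hz
    refine image_eq_zero_of_notMem_tsupport fun hz' => hz ?_
    have := h hz'
    rw [interior_cell_eq] at this
    exact this j trivial
  intro y hy
  rw [hz y (by simp [hy]), hz]
  simp only [Pi.add_apply, hy, Pi.single_eq_same, Set.mem_Ioo, not_and, not_lt]
  intro _
  linarith

lemma integrable_cell {φ : Plane → ℂ} (hφ : Continuous φ) : Integrable φ cellMeasure := by
  have : IntegrableOn φ (Set.Icc (fun _ : Fin 2 => -Real.pi) fun _ => Real.pi) volume :=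
    hφ.continuousOn.integrableOn_compact isCompact_Icc
  refine this.mono_set ?_
  rw [← Set.pi_univ_Icc]
  exact Set.pi_mono fun i _ => Set.Ico_subset_Icc_self

/-- The divergence theorem on the cell: the boundary terms on opposite edges cancel. -/
lemma integral_pderiv_eq_zero {ψ : Plane → ℂ} (hψ : ContDiff ℝ ∞ ψ) (j : Fin 2)
    (hp : EdgePeriodic j ψ) : ∫ y, pderiv j ψ y ∂cellMeasure = 0 := by
  have hπ : (fun _ : Fin 2 => -Real.pi) ≤ fun _ => Real.pi := fun _ => by
    have := Real.pi_pos
    simp only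
    linarith
  have hd : Differentiable ℝ ψ := hψ.differentiable (by simp)
  let f : Fin 2 → Plane → ℂ := fun i y => if i = j then ψ y else 0
  let f' : Fin 2 → Plane → Plane →L[ℝ] ℂ := fun i y => if i = j then fderiv ℝ ψ y else 0
  have hsum : ∀ y, ∑ i, f' i y (Pi.single i 1) = pderiv j ψ y := by
    intro y
    rw [Finset.sum_eq_single j]
    · simp [f', pderiv]
    · intro i _ hi
      simp [f', hi]
    · simp
  have hIcc : (cell : Set Plane) =ᵐ[volume]
      Set.Icc (fun _ : Fin 2 => -Real.pi) fun _ => Real.pi :=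
    Measure.univ_pi_Ico_ae_eq_Icc
  have key := integral_divergence_of_hasFDerivAt_off_countable' (fun _ : Fin 2 => -Real.pi)
    (fun _ => Real.pi) hπ f f' ∅ Set.countable_empty
    (fun i => by
      by_cases hi : i = j
      · simpa [f, hi] using hψ.continuous.continuousOn
      · simpa [f, hi] using continuousOn_const)
    (fun x _ i => by
      by_cases hi : i = j
      · simpa [f, f', hi] using (hd x).hasFDerivAt
      · simpa [f, f', hi] using hasFDerivAt_const (0 : ℂ) x)
    (by
      simp only [hsum]
      exact (continuous_pderiv hψ j).continuousOn.integrableOn_compact isCompact_Icc)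
  simp only [hsum] at key
  rw [setIntegral_congr_set hIcc, key]
  refine Finset.sum_eq_zero fun i _ => ?_
  rw [sub_eq_zero]
  refine integral_congr_ae (Eventually.of_forall fun x => ?_)
  by_cases hi : i = j
  · subst hi
    have hx : (Fin.insertNth i Real.pi x : Plane)
        = Fin.insertNth i (-Real.pi) x + Pi.single i (2 * Real.pi) := by
      funext k
      rcases Fin.eq_self_or_eq_succAbove i k with rfl | ⟨k, rfl⟩
      · simp
        ring
      · simp
    simp only [f, if_true]
    change ψ (Fin.insertNth i Real.pi x : Plane) = ψ (Fin.insertNth i (-Real.pi) x : Plane)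
    rw [hx]
    exact hp _ (by simp)
  · simp [f, hi]

/-- The frequencies of cell-periodic plane waves, as vectors in the plane. -/
def toPlane (k : Fin 2 → ℤ) : Plane := fun i => (k i : ℝ)

lemma isCellPeriodic_wave (k : Fin 2 → ℤ) : IsCellPeriodic (wave (toPlane k)) := by
  intro j y
  rw [wave, wave, dotProduct_add, dotProduct_single, toPlane, Complex.exp_eq_exp_iff_exists_int]
  refine ⟨k j, ?_⟩
  push_cast
  ring

lemma integral_wave (k : Fin 2 → ℤ) :
    ∫ y, wave (toPlane k) y ∂cellMeasure = if k = 0 then ((2 * Real.pi) ^ 2 : ℂ) else 0 := by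
  split_ifs with hk
  · have h1 : ∀ y, wave (toPlane k) y = 1 := fun y => by
      have : toPlane k = 0 := by
        funext i
        simp [toPlane, hk]
      simp [wave, this]
    simp only [h1]
    rw [integral_const, measureReal_def, Measure.restrict_apply_univ, cell, volume_pi_pi]
    have h2 : Real.pi + Real.pi = 2 * Real.pi := by ring
    simp only [Real.volume_Ico, sub_neg_eq_add, h2, Finset.prod_const, Finset.card_univ,
      Fintype.card_fin, ENNReal.toReal_pow, ENNReal.toReal_ofReal Real.two_pi_pos.le]
    simp
  · obtain ⟨j, hj⟩ := Function.ne_iff.1 hk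
    have h := integral_pderiv_eq_zero (contDiff_wave (toPlane k)) j
      ((isCellPeriodic_wave k).edgePeriodic j)
    simp only [pderiv_wave] at h
    rw [integral_const_mul] at h
    refine (mul_eq_zero.1 h).resolve_left (mul_ne_zero Complex.I_ne_zero ?_)
    simpa [toPlane] using hj

lemma memLp_wave (θ : Plane) : MemLp (fun y => (2 * Real.pi : ℂ)⁻¹ * wave θ y) 2 cellMeasure :=
  MemLp.of_bound ((contDiff_wave θ).continuous.aestronglyMeasurable.const_mul _) (2 * Real.pi)⁻¹
    (Eventually.of_forall fun y => by
      rw [norm_mul, norm_wave, mul_one, norm_inv, norm_mul, Complex.norm_real, Complex.norm_ofNat,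
        Real.norm_of_nonneg Real.pi_pos.le])

/-- The normalised periodic plane wave of frequency `k`, an element of `L²` of the cell. -/
def fourierVec (k : Fin 2 → ℤ) : ScalarL2 := (memLp_wave (toPlane k)).toLp _

lemma coeFn_fourierVec (k : Fin 2 → ℤ) :
    fourierVec k =ᵐ[cellMeasure] fun y => (2 * Real.pi : ℂ)⁻¹ * wave (toPlane k) y :=
  (memLp_wave (toPlane k)).coeFn_toLp

lemma toPlane_neg (k : Fin 2 → ℤ) : toPlane (-k) = -toPlane k := by
  funext i
  simp [toPlane]

lemma inner_fourierVec (k : Fin 2 → ℤ) (u : ScalarL2) :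
    inner ℂ (fourierVec k) u
      = (2 * Real.pi : ℂ)⁻¹ * ∫ y, u y * wave (toPlane (-k)) y ∂cellMeasure := by
  rw [inner_eq_integral, ← integral_const_mul]
  refine integral_congr_ae ?_
  filter_upwards [coeFn_fourierVec k] with y hy
  rw [hy, star_mul', star_wave, toPlane_neg]
  have : star (2 * (Real.pi : ℂ))⁻¹ = (2 * (Real.pi : ℂ))⁻¹ := by simp
  rw [this]
  ring

lemma orthonormal_fourierVec : Orthonormal ℂ fourierVec := by
  rw [orthonormal_iff_ite]
  intro k l
  have h1 : ∀ᵐ y ∂cellMeasure, fourierVec l y * wave (toPlane (-k)) y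
      = (2 * Real.pi : ℂ)⁻¹ * wave (toPlane (l - k)) y := by
    filter_upwards [coeFn_fourierVec l] with y hy
    have : toPlane (l - k) = toPlane l + toPlane (-k) := by
      funext i
      simp [toPlane]
      ring
    rw [hy, this, wave_add]
    ring
  rw [inner_fourierVec, integral_congr_ae h1, integral_const_mul, integral_wave]
  have h2 : (Real.pi : ℂ) ≠ 0 := Complex.ofReal_ne_zero.2 Real.pi_ne_zero
  by_cases h : k = l
  · subst h
    rw [if_pos (sub_self k), if_pos rfl]
    field_simp
  · rw [if_neg h, if_neg (fun h' => h (sub_eq_zero.1 h').symm)]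
    simp

/-- The covering map from the plane to the torus that identifies points congruent modulo the
periods of the cell. -/
def torusMap (y : Plane) : UnitAddTorus (Fin 2) := fun i =>
  ((y i / (2 * Real.pi) : ℝ) : UnitAddCircle)

/-- The section of `torusMap` with values in the cell. -/
def torusSection (t : UnitAddTorus (Fin 2)) : Plane :=
  fun i => (AddCircle.measurableEquivIco 1 (-(1 / 2) : ℝ) (t i) : ℝ) * (2 * Real.pi)

lemma measurable_torusMap : Measurable torusMap :=
  measurable_pi_iff.2 fun i => AddCircle.measurable_mk'.comp ((measurable_pi_apply i).div_const _)

lemma measurable_torusSection : Measurable torusSection :=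
  measurable_pi_iff.2 fun i => (measurable_subtype_coe.comp
    ((AddCircle.measurableEquivIco 1 (-(1 / 2) : ℝ)).measurable.comp
      (measurable_pi_apply i))).mul_const _

lemma torusSection_torusMap {y : Plane} (hy : y ∈ cell) : torusSection (torusMap y) = y := by
  funext i
  have h2 := Real.two_pi_pos
  have hi : y i / (2 * Real.pi) ∈ Set.Ico (-(1 / 2) : ℝ) (-(1 / 2) + 1) := by
    have := hy i trivial
    constructor
    · rw [le_div_iff₀ h2]
      linarith [this.1]
    · rw [div_lt_iff₀ h2]
      linarith [this.2]
  have : (AddCircle.measurableEquivIco 1 (-(1 / 2) : ℝ) (torusMap y i) : ℝ)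
      = y i / (2 * Real.pi) := AddCircle.equivIco_coe_of_mem hi
  rw [torusSection, this, div_mul_cancel₀ _ h2.ne']

lemma mFourier_torusMap (k : Fin 2 → ℤ) (y : Plane) :
    UnitAddTorus.mFourier k (torusMap y) = wave (toPlane k) y := by
  simp only [UnitAddTorus.mFourier, ContinuousMap.coe_mk, torusMap]
  simp only [fourier_coe_apply, ← Complex.exp_sum, wave]
  congr 1
  simp only [dotProduct, toPlane]
  push_cast
  rw [Finset.mul_sum]
  refine Finset.sum_congr rfl fun i _ => ?_
  have h2 : (Real.pi : ℂ) ≠ 0 := Complex.ofReal_ne_zero.2 Real.pi_ne_zero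
  field_simp

/-- Completeness of the plane waves. A function orthogonal to all of them is moved to the torus,
with the push-forward of the measure of the cell; there trigonometric polynomials are dense in the
continuous functions, hence in `L²`. -/
lemma orthogonal_span_fourierVec : (Submodule.span ℂ (Set.range fourierVec))ᗮ = ⊥ := by
  rw [Submodule.eq_bot_iff]
  intro u hu
  have hu' : ∀ k, ∫ y, u y * wave (toPlane (-k)) y ∂cellMeasure = 0 := by
    intro k
    have h := hu _ (Submodule.subset_span ⟨k, rfl⟩)
    rw [inner_fourierVec] at h
    have h2 : (Real.pi : ℂ) ≠ 0 := Complex.ofReal_ne_zero.2 Real.pi_ne_zero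
    exact (mul_eq_zero.1 h).resolve_left (by simp [h2])
  let ν : Measure (UnitAddTorus (Fin 2)) := cellMeasure.map torusMap
  have hν : IsFiniteMeasure ν := inferInstance
  have hsec : ∀ᵐ y ∂cellMeasure, torusSection (torusMap y) = y :=
    (ae_restrict_iff' measurableSet_cell).2 (Eventually.of_forall fun y => torusSection_torusMap)
  let w : UnitAddTorus (Fin 2) → ℂ := fun t => u (torusSection t)
  have hwm : StronglyMeasurable w :=
    (Lp.stronglyMeasurable u).comp_measurable measurable_torusSection
  have hwu : (fun y => w (torusMap y)) =ᵐ[cellMeasure] u := by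
    filter_upwards [hsec] with y hy
    simp only [w, hy]
  have hw : MemLp w 2 ν := by
    rw [memLp_map_measure_iff hwm.aestronglyMeasurable measurable_torusMap.aemeasurable]
    exact (memLp_congr_ae hwu).2 (Lp.memLp u)
  have hz : hw.toLp w = 0 := by
    have hdense : Dense ((Submodule.span ℂ (Set.range (UnitAddTorus.mFourier (d := Fin 2)))).map
        (ContinuousMap.toLp 2 ν ℂ : C(UnitAddTorus (Fin 2), ℂ) →L[ℂ] Lp ℂ 2 ν).toLinearMap
        : Set (Lp ℂ 2 ν)) := by
      refine (ContinuousMap.toLp_denseRange ℂ ν ℂ (by norm_num)).dense_image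
        (ContinuousLinearMap.continuous _) ?_
      exact Submodule.dense_iff_topologicalClosure_eq_top.2
        UnitAddTorus.span_mFourier_closure_eq_top
    refine hdense.eq_zero_of_inner_right ℂ fun v hv => ?_
    obtain ⟨p, hp, rfl⟩ := hv
    have hle : Submodule.span ℂ (Set.range (UnitAddTorus.mFourier (d := Fin 2))) ≤
        ((Submodule.span ℂ {hw.toLp w})ᗮ).comap
          (ContinuousMap.toLp 2 ν ℂ : C(UnitAddTorus (Fin 2), ℂ) →L[ℂ] Lp ℂ 2 ν).toLinearMap := by
      refine Submodule.span_le.2 ?_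
      rintro _ ⟨k, rfl⟩
      refine Submodule.mem_orthogonal_singleton_iff_inner_left.2 ?_
      rw [L2.inner_def]
      have e1 : ∫ t, inner ℂ (ContinuousMap.toLp 2 ν ℂ (UnitAddTorus.mFourier k) t) (hw.toLp w t) ∂ν
          = ∫ t, w t * star (UnitAddTorus.mFourier k t) ∂ν := by
        refine integral_congr_ae ?_
        filter_upwards [hw.coeFn_toLp, ContinuousMap.coeFn_toLp (p := 2) (𝕜 := ℂ) ν
          (UnitAddTorus.mFourier k)] with t h1 h2
        rw [h1, h2]
        rfl
      refine e1.trans ?_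
      have hm : StronglyMeasurable fun t => w t * star (UnitAddTorus.mFourier k t) :=
        hwm.mul (UnitAddTorus.mFourier k).continuous.star.stronglyMeasurable
      rw [integral_map measurable_torusMap.aemeasurable hm.aestronglyMeasurable, ← hu' k]
      refine integral_congr_ae ?_
      filter_upwards [hwu] with y hy
      rw [hy, mFourier_torusMap, star_wave, toPlane_neg]
    exact Submodule.mem_orthogonal_singleton_iff_inner_left.1 (hle hp)
  have h3 : w =ᵐ[ν] 0 := by
    have h := hw.coeFn_toLp
    rw [hz] at h
    exact h.symm.trans (Lp.coeFn_zero ℂ 2 ν)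
  have h4 : ∀ᵐ y ∂cellMeasure, w (torusMap y) = 0 :=
    ae_of_ae_map measurable_torusMap.aemeasurable h3
  refine Lp.ext ?_
  filter_upwards [h4, hwu, Lp.coeFn_zero ℂ 2 cellMeasure] with y e1 e2 e3
  rw [← e2, e1, e3, Pi.zero_apply]

/-- The Fourier basis of `L²` of the cell. -/
def fourierBasis : HilbertBasis (Fin 2 → ℤ) ℂ ScalarL2 :=
  HilbertBasis.mkOfOrthogonalEqBot orthonormal_fourierVec orthogonal_span_fourierVec

lemma coe_fourierBasis : ⇑fourierBasis = fourierVec := HilbertBasis.coe_mkOfOrthogonalEqBot _ _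

/-- The Fourier coefficients of a function on the cell. -/
def fc (u : ScalarL2) (k : Fin 2 → ℤ) : ℂ := fourierBasis.repr u k

lemma fc_eq_inner (u : ScalarL2) (k : Fin 2 → ℤ) : fc u k = inner ℂ (fourierVec k) u := by
  rw [fc, fourierBasis.repr_apply_apply, coe_fourierBasis]

lemma fc_eq_integral (u : ScalarL2) (k : Fin 2 → ℤ) :
    fc u k = (2 * Real.pi : ℂ)⁻¹ * ∫ y, u y * wave (toPlane (-k)) y ∂cellMeasure := by
  rw [fc_eq_inner, inner_fourierVec]

lemma fc_add (u v : ScalarL2) (k : Fin 2 → ℤ) : fc (u + v) k = fc u k + fc v k := by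
  simp only [fc_eq_inner, inner_add_right]

lemma fc_sub (u v : ScalarL2) (k : Fin 2 → ℤ) : fc (u - v) k = fc u k - fc v k := by
  simp only [fc_eq_inner, inner_sub_right]

lemma fc_smul (a : ℂ) (u : ScalarL2) (k : Fin 2 → ℤ) : fc (a • u) k = a * fc u k := by
  simp only [fc_eq_inner, inner_smul_right]

lemma fc_ext {u v : ScalarL2} (h : ∀ k, fc u k = fc v k) : u = v := by
  refine fourierBasis.repr.injective (lp.ext (funext fun k => ?_))
  exact h k

lemma fc_fourierVec (k l : Fin 2 → ℤ) : fc (fourierVec l) k = if k = l then 1 else 0 := by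
  rw [fc_eq_inner]
  exact orthonormal_iff_ite.1 orthonormal_fourierVec k l

lemma memℓp_mul_fc {m : (Fin 2 → ℤ) → ℂ} {C : ℝ} (hm : ∀ k, ‖m k‖ ≤ C) (u : ScalarL2) :
    Memℓp (fun k => m k * fc u k) 2 := by
  refine ((lp.memℓp ((C : ℂ) • fourierBasis.repr u)).mono' fun k => ?_)
  change ‖m k * fc u k‖ ≤ ‖(C : ℂ) * fc u k‖
  have hC : 0 ≤ C := (norm_nonneg _).trans (hm k)
  rw [norm_mul, norm_mul, Complex.norm_real, Real.norm_of_nonneg hC]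
  exact mul_le_mul_of_nonneg_right (hm k) (norm_nonneg _)

/-- The Fourier multiplier with bounded symbol `m`. -/
def fourierMult (m : (Fin 2 → ℤ) → ℂ) {C : ℝ} (hm : ∀ k, ‖m k‖ ≤ C) : ScalarL2 →L[ℂ] ScalarL2 :=
  LinearMap.mkContinuous
    { toFun := fun u => fourierBasis.repr.symm ⟨fun k => m k * fc u k, memℓp_mul_fc hm u⟩
      map_add' := fun u v => by
        rw [← map_add]
        congr 1
        refine lp.ext (funext fun k => ?_)
        change m k * fc (u + v) k = m k * fc u k + m k * fc v k
        rw [fc_add, mul_add]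
      map_smul' := fun a u => by
        rw [← map_smul]
        congr 1
        refine lp.ext (funext fun k => ?_)
        change m k * fc (a • u) k = a * (m k * fc u k)
        rw [fc_smul, mul_left_comm] }
    C fun u => by
      have hC : 0 ≤ C := (norm_nonneg _).trans (hm 0)
      change ‖fourierBasis.repr.symm _‖ ≤ _
      have e : C * ‖u‖ = ‖(C : ℂ) • fourierBasis.repr u‖ := by
        rw [norm_smul, Complex.norm_real, Real.norm_of_nonneg hC, LinearIsometryEquiv.norm_map]
      rw [LinearIsometryEquiv.norm_map, e]
      refine lp.norm_mono (by norm_num) fun k => ?_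
      change ‖m k * fc u k‖ ≤ ‖(C : ℂ) * fc u k‖
      rw [norm_mul, norm_mul, Complex.norm_real, Real.norm_of_nonneg hC]
      exact mul_le_mul_of_nonneg_right (hm k) (norm_nonneg _)

section fourierMult

variable {m : (Fin 2 → ℤ) → ℂ} {C : ℝ} {hm : ∀ k, ‖m k‖ ≤ C}

lemma fc_fourierMult (u : ScalarL2) (k : Fin 2 → ℤ) :
    fc (fourierMult m hm u) k = m k * fc u k := by
  rw [fc]
  change fourierBasis.repr (fourierBasis.repr.symm _) k = _
  rw [LinearIsometryEquiv.apply_symm_apply]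

lemma fourierMult_fourierVec (k : Fin 2 → ℤ) :
    fourierMult m hm (fourierVec k) = m k • fourierVec k := by
  refine fc_ext fun l => ?_
  rw [fc_fourierMult, fc_smul, fc_fourierVec]
  split_ifs with h
  · rw [h]
  · simp

lemma norm_fourierMult_apply_le (u : ScalarL2) : ‖fourierMult m hm u‖ ≤ C * ‖u‖ :=
  (fourierMult m hm).le_of_opNorm_le (LinearMap.mkContinuous_norm_le _
    ((norm_nonneg _).trans (hm 0)) _) u

/-- A multiplier whose symbol tends to zero is a norm limit of finite rank operators. -/
lemma isCompactOperator_fourierMult (h0 : Tendsto m cofinite (𝓝 0)) :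
    IsCompactOperator (fourierMult m hm) := by
  classical
  let P : Finset (Fin 2 → ℤ) → ScalarL2 →L[ℂ] ScalarL2 := fun s =>
    ∑ k ∈ s, (innerSL ℂ (fourierVec k)).smulRight (m k • fourierVec k)
  have hP : ∀ s u l, fc (P s u) l = if l ∈ s then m l * fc u l else 0 := by
    intro s u l
    have : P s u = ∑ k ∈ s, (fc u k * m k) • fourierVec k := by
      simp only [P, FunLike.coe_sum, Finset.sum_apply, fc_eq_inner, mul_smul]
      rfl
    rw [this, fc_eq_inner, inner_sum]
    simp only [inner_smul_right, orthonormal_iff_ite.1 orthonormal_fourierVec]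
    simp [mul_comm]
  have hPc : ∀ s, IsCompactOperator (P s) := fun s => by
    refine Submodule.sum_mem (compactOperator (RingHom.id ℂ) ScalarL2 ScalarL2) fun k _ => ?_
    have : IsCompactOperator (innerSL ℂ (fourierVec k)) :=
      isCompactOperator_of_locallyCompactSpace_dom (innerSL ℂ (fourierVec k))
    exact this.clm_comp (ContinuousLinearMap.toSpanSingleton ℂ (m k • fourierVec k))
  refine isCompactOperator_of_tendsto (l := atTop) (F := P) ?_ (Eventually.of_forall hPc)
  refine Metric.tendsto_atTop.2 fun ε hε => ?_
  have hfin : {k | ¬ ‖m k‖ < ε / 2}.Finite := by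
    have := h0.norm.eventually_lt_const (u := ε / 2) (by simpa using half_pos hε)
    exact Filter.eventually_cofinite.1 this
  refine ⟨hfin.toFinset, fun s hs => ?_⟩
  rw [dist_eq_norm]
  refine lt_of_le_of_lt (ContinuousLinearMap.opNorm_le_bound _ (half_pos hε).le fun u => ?_)
    (half_lt_self hε)
  have hb : ∀ k, ‖if k ∈ s then 0 else -m k‖ ≤ ε / 2 := by
    intro k
    split_ifs with hk
    · simpa using (half_pos hε).le
    · by_contra! hcon
      refine hk (hs ?_)
      rw [Set.Finite.mem_toFinset, Set.mem_ofPred_eq, not_lt]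
      rw [norm_neg] at hcon
      exact hcon.le
  have e : (P s - fourierMult m hm) u = fourierMult (fun k => if k ∈ s then 0 else -m k) hb u := by
    refine fc_ext fun k => ?_
    rw [sub_apply, fc_sub, hP, fc_fourierMult, fc_fourierMult]
    split_ifs <;> ring
  rw [e]
  exact norm_fourierMult_apply_le u

end fourierMult

/-- The weight `⟨k⟩ = (1 + |k|²)^{1/2}`. -/
def bracket (k : Fin 2 → ℤ) : ℝ := Real.sqrt (1 + (k 0 : ℝ) ^ 2 + (k 1 : ℝ) ^ 2)

lemma bracket_sq (k : Fin 2 → ℤ) : bracket k ^ 2 = 1 + (k 0 : ℝ) ^ 2 + (k 1 : ℝ) ^ 2 :=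
  Real.sq_sqrt (by positivity)

lemma one_le_bracket (k : Fin 2 → ℤ) : 1 ≤ bracket k := by
  refine Real.one_le_sqrt.2 ?_
  nlinarith [sq_nonneg (k 0 : ℝ), sq_nonneg (k 1 : ℝ)]

lemma bracket_pos (k : Fin 2 → ℤ) : 0 < bracket k := one_pos.trans_le (one_le_bracket k)

lemma bracket_ne_zero (k : Fin 2 → ℤ) : (bracket k : ℂ) ≠ 0 :=
  Complex.ofReal_ne_zero.2 (bracket_pos k).ne'

lemma abs_le_bracket (k : Fin 2 → ℤ) (j : Fin 2) : |(k j : ℝ)| ≤ bracket k := by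
  refine Real.abs_le_sqrt ?_
  fin_cases j
  · change (k 0 : ℝ) ^ 2 ≤ _
    nlinarith [sq_nonneg (k 1 : ℝ)]
  · change (k 1 : ℝ) ^ 2 ≤ _
    nlinarith [sq_nonneg (k 0 : ℝ)]

lemma tendsto_bracket_inv : Tendsto (fun k => (bracket k : ℂ)⁻¹) cofinite (𝓝 0) := by
  have h1 : Tendsto (fun k : Fin 2 → ℤ => ‖k‖) cofinite atTop := by
    rw [← cocompact_eq_cofinite]
    exact tendsto_norm_cocompact_atTop
  have h2 : Tendsto bracket cofinite atTop := by
    refine tendsto_atTop_mono (fun k => ?_) h1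
    refine (pi_norm_le_iff_of_nonneg (bracket_pos k).le).2 fun j => ?_
    rw [Int.norm_eq_abs]
    exact abs_le_bracket k j
  have h3 := (Complex.continuous_ofReal.tendsto 0).comp (tendsto_inv_atTop_zero.comp h2)
  simpa [Function.comp_def] using h3

lemma norm_bracket_inv_le (k : Fin 2 → ℤ) : ‖(bracket k : ℂ)⁻¹‖ ≤ 1 := by
  rw [norm_inv, Complex.norm_real, Real.norm_of_nonneg (bracket_pos k).le]
  exact inv_le_one_of_one_le₀ (one_le_bracket k)

lemma norm_deriv_symbol_le (j : Fin 2) (k : Fin 2 → ℤ) :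
    ‖Complex.I * (k j : ℂ) * (bracket k : ℂ)⁻¹‖ ≤ 1 := by
  rw [norm_mul, norm_mul, Complex.norm_I, one_mul, norm_inv, Complex.norm_real,
    Real.norm_of_nonneg (bracket_pos k).le, Complex.norm_intCast, ← div_eq_mul_inv]
  exact div_le_one_of_le₀ (abs_le_bracket k j) (bracket_pos k).le

/-- The operator `(1 - Δ)^{-1/2}` on periodic functions: a bijection from `L²` of the cell onto
`H¹_per`. -/
def smoothing : ScalarL2 →L[ℂ] ScalarL2 :=
  fourierMult (fun k => (bracket k : ℂ)⁻¹) norm_bracket_inv_le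

/-- The operator `∂_j (1 - Δ)^{-1/2}` on periodic functions. -/
def smoothDeriv (j : Fin 2) : ScalarL2 →L[ℂ] ScalarL2 :=
  fourierMult (fun k => Complex.I * (k j : ℂ) * (bracket k : ℂ)⁻¹) (norm_deriv_symbol_le j)

lemma fc_smoothing (a : ScalarL2) (k : Fin 2 → ℤ) :
    fc (smoothing a) k = (bracket k : ℂ)⁻¹ * fc a k := fc_fourierMult a k

lemma fc_smoothDeriv (j : Fin 2) (a : ScalarL2) (k : Fin 2 → ℤ) :
    fc (smoothDeriv j a) k = Complex.I * (k j : ℂ) * (bracket k : ℂ)⁻¹ * fc a k :=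
  fc_fourierMult a k

lemma isCompactOperator_smoothing : IsCompactOperator smoothing :=
  isCompactOperator_fourierMult tendsto_bracket_inv

lemma smoothing_injective : Function.Injective smoothing := by
  intro a b hab
  refine fc_ext fun k => ?_
  have := congrArg (fc · k) hab
  simp only [fc_smoothing] at this
  exact mul_left_cancel₀ (inv_ne_zero (bracket_ne_zero k)) this

/-! ### Periodic and quasi-periodic Sobolev functions -/

/-- Integration against a continuous function is a continuous functional on `L²` of the cell. -/
lemma exists_integral_functional {φ : Plane → ℂ} (hφ : Continuous φ) :
    ∃ L : ScalarL2 →L[ℂ] ℂ, ∀ u : ScalarL2, L u = ∫ y, u y * φ y ∂cellMeasure := by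
  have hb : MemLp (fun y => star (φ y)) 2 cellMeasure := by
    have hK : IsCompact (Set.univ.pi fun _ : Fin 2 => Set.Icc (-Real.pi) Real.pi) :=
      isCompact_univ_pi fun _ => isCompact_Icc
    obtain ⟨C, hC⟩ := hK.exists_bound_of_continuousOn hφ.star.continuousOn
    refine MemLp.of_bound hφ.star.aestronglyMeasurable C ?_
    refine (ae_restrict_iff' measurableSet_cell).2 (Eventually.of_forall fun y hy => hC y ?_)
    exact fun i hi => Set.Ico_subset_Icc_self (hy i hi)
  refine ⟨innerSL ℂ (hb.toLp _), fun u => ?_⟩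
  rw [innerSL_apply_apply, inner_eq_integral]
  refine integral_congr_ae ?_
  filter_upwards [hb.coeFn_toLp] with y hy
  rw [hy, star_star]

/-- Integration by parts without boundary terms. It holds for plane waves by the divergence
theorem, and in general because these span a dense subspace. -/
lemma integral_smoothing_mul_pderiv {φ : Plane → ℂ} (hφ : ContDiff ℝ ∞ φ) {j : Fin 2}
    (hp : EdgePeriodic j φ) (a : ScalarL2) :
    ∫ y, smoothing a y * pderiv j φ y ∂cellMeasure
      = -∫ y, smoothDeriv j a y * φ y ∂cellMeasure := by
  obtain ⟨L, hL⟩ := exists_integral_functional (continuous_pderiv hφ j)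
  obtain ⟨L', hL'⟩ := exists_integral_functional hφ.continuous
  have hwave : ∀ k, L (fourierVec k) = -(Complex.I * (k j : ℂ)) * L' (fourierVec k) := by
    intro k
    have e1 : ∀ ψ : Plane → ℂ, ∫ y, fourierVec k y * ψ y ∂cellMeasure
        = (2 * Real.pi : ℂ)⁻¹ * ∫ y, wave (toPlane k) y * ψ y ∂cellMeasure := by
      intro ψ
      rw [← integral_const_mul]
      refine integral_congr_ae ?_
      filter_upwards [coeFn_fourierVec k] with y hy
      rw [hy, mul_assoc]
    have hw := contDiff_wave (toPlane k)
    have h0 := integral_pderiv_eq_zero (hw.mul hφ) j fun y hy => by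
      change wave _ _ * φ _ = wave _ _ * φ _
      rw [hp y hy, isCellPeriodic_wave k j y]
    have e2 : ∀ y, pderiv j (wave (toPlane k) * φ) y = Complex.I * (k j : ℂ) *
        (wave (toPlane k) y * φ y) + wave (toPlane k) y * pderiv j φ y := by
      intro y
      rw [show wave (toPlane k) * φ = fun z => wave (toPlane k) z * φ z from rfl, pderiv_mul hw hφ,
        pderiv_wave, toPlane]
      push_cast
      ring
    change ∫ y, pderiv j (wave (toPlane k) * φ) y ∂cellMeasure = 0 at h0
    simp only [e2] at h0
    rw [integral_add, integral_const_mul] at h0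
    · rw [hL, hL', e1, e1, eq_neg_of_add_eq_zero_right h0]
      ring
    · exact (integrable_cell (hw.continuous.mul hφ.continuous)).const_mul _
    · exact integrable_cell (hw.continuous.mul (continuous_pderiv hφ j))
  have hd : Dense (Submodule.span ℂ (Set.range fourierVec) : Set ScalarL2) := by
    rw [← coe_fourierBasis]
    exact Submodule.dense_iff_topologicalClosure_eq_top.2 fourierBasis.dense_span
  have key : L ∘L smoothing = -(L' ∘L smoothDeriv j) := by
    refine ContinuousLinearMap.ext_on hd ?_
    rintro _ ⟨k, rfl⟩
    simp only [ContinuousLinearMap.comp_apply, neg_apply, smoothing,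
      smoothDeriv, fourierMult_fourierVec, map_smul, smul_eq_mul, hwave]
    ring
  have := DFunLike.congr_fun key a
  simpa only [ContinuousLinearMap.comp_apply, neg_apply, hL, hL'] using this

lemma hasWeakDeriv_smoothing (j : Fin 2) (a : ScalarL2) :
    HasWeakDeriv j (smoothing a) (smoothDeriv j a) := fun _ hφ _ hs =>
  integral_smoothing_mul_pderiv hφ (edgePeriodic_of_tsupport_subset hs j) a

lemma weakDeriv_smoothing (j : Fin 2) (a : ScalarL2) :
    weakDeriv j (smoothing a) = smoothDeriv j a := weakDeriv_eq (hasWeakDeriv_smoothing j a)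

lemma smoothing_mem_H1per (a : ScalarL2) : smoothing a ∈ H1per := by
  refine ⟨fun j => ⟨_, hasWeakDeriv_smoothing j a⟩, fun j φ hφ hp => ?_⟩
  rw [weakDeriv_smoothing]
  exact integral_smoothing_mul_pderiv hφ (hp.edgePeriodic j) a

lemma fc_weakDeriv {v : ScalarL2} (hv : v ∈ H1per) (j : Fin 2) (k : Fin 2 → ℤ) :
    fc (weakDeriv j v) k = Complex.I * (k j : ℂ) * fc v k := by
  have h := hv.2 j _ (contDiff_wave (toPlane (-k))) (isCellPeriodic_wave (-k))
  simp only [pderiv_wave] at h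
  have e : ∫ y, v y * (Complex.I * (toPlane (-k) j : ℝ) * wave (toPlane (-k)) y) ∂cellMeasure
      = -(Complex.I * (k j : ℂ)) * ∫ y, v y * wave (toPlane (-k)) y ∂cellMeasure := by
    rw [← integral_const_mul]
    refine integral_congr_ae (Eventually.of_forall fun y => ?_)
    simp only [toPlane, Pi.neg_apply]
    push_cast
    ring
  rw [e] at h
  rw [fc_eq_integral, fc_eq_integral, ← neg_neg (∫ y, weakDeriv j v y * _ ∂cellMeasure), ← h]
  ring

/-- Every function in `H¹_per` is `(1 - Δ)^{-1/2} a` with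
`a = (1 - Δ)^{-1/2} v - ∑ⱼ ∂ⱼ (1 - Δ)^{-1/2} ∂ⱼ v`. -/
lemma exists_smoothing_eq {v : ScalarL2} (hv : v ∈ H1per) : ∃ a, smoothing a = v := by
  refine ⟨smoothing v - smoothDeriv 0 (weakDeriv 0 v) - smoothDeriv 1 (weakDeriv 1 v),
    fc_ext fun k => ?_⟩
  rw [fc_smoothing, fc_sub, fc_sub, fc_smoothing, fc_smoothDeriv, fc_smoothDeriv,
    fc_weakDeriv hv, fc_weakDeriv hv]
  have h1 : (bracket k : ℂ) ^ 2 = 1 + (k 0 : ℂ) ^ 2 + (k 1 : ℂ) ^ 2 := by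
    exact_mod_cast bracket_sq k
  have h2 := bracket_ne_zero k
  field_simp
  linear_combination (-(fc v k)) * h1 + (-(k 0 : ℂ) ^ 2 - (k 1 : ℂ) ^ 2) * fc v k * Complex.I_sq

/-- Multiplication by `e^{iθ·y}` on `L²` of the cell. -/
def phase (θ : Plane) : ScalarL2 →L[ℂ] ScalarL2 :=
  mulL (wave θ) (measurable_wave θ) fun y => (norm_wave θ y).le

lemma coeFn_phase (θ : Plane) (u : ScalarL2) :
    phase θ u =ᵐ[cellMeasure] fun y => wave θ y * u y := coeFn_mulL u

lemma inner_phase_phase (θ : Plane) (u v : ScalarL2) :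
    inner ℂ (phase θ u) (phase θ v) = inner ℂ u v := inner_mulL_mulL (norm_wave θ) u v

lemma phase_injective (θ : Plane) : Function.Injective (phase θ) := by
  rw [injective_iff_map_eq_zero]
  intro u hu
  rw [← inner_self_eq_zero (𝕜 := ℂ), ← inner_phase_phase θ, hu, inner_zero_left]

/-- The operator `(∂_j + iθ_j)(1 - Δ)^{-1/2}` on periodic functions. -/
def thetaDeriv (θ : Plane) (j : Fin 2) : ScalarL2 →L[ℂ] ScalarL2 :=
  smoothDeriv j + (Complex.I * (θ j : ℂ)) • smoothing

lemma thetaDeriv_apply (θ : Plane) (j : Fin 2) (a : ScalarL2) :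
    thetaDeriv θ j a = smoothDeriv j a + (Complex.I * (θ j : ℂ)) • smoothing a := rfl

lemma hasWeakDeriv_phase {v g : ScalarL2} {j : Fin 2} (θ : Plane) (h : HasWeakDeriv j v g) :
    HasWeakDeriv j (phase θ v) (phase θ (g + (Complex.I * (θ j : ℂ)) • v)) := by
  intro φ hφ hc hs
  have hw := contDiff_wave θ
  have hwc : HasCompactSupport (wave θ * φ) := hc.mul_left
  have hws : tsupport (wave θ * φ) ⊆ interior cell := (tsupport_mul_subset_right).trans hs
  have h0 := h (wave θ * φ) (hw.mul hφ) hwc hws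
  have hm : ContDiff ℝ ∞ (wave θ * φ) := hw.mul hφ
  have hwφ : Continuous (wave θ * φ) := hm.continuous
  have e1 : ∫ y, phase θ v y * pderiv j φ y ∂cellMeasure
      = ∫ y, v y * pderiv j (wave θ * φ) y ∂cellMeasure
        - (Complex.I * (θ j : ℂ)) * ∫ y, v y * (wave θ * φ) y ∂cellMeasure := by
    rw [← integral_const_mul, ← integral_sub (integrable_mul_smooth
      (continuous_pderiv hm j) v) ((integrable_mul_smooth hwφ v).const_mul _)]
    refine integral_congr_ae ?_
    filter_upwards [coeFn_phase θ v] with y hy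
    rw [hy, show wave θ * φ = fun z => wave θ z * φ z from rfl, pderiv_mul hw hφ, pderiv_wave]
    ring
  have e2 : ∫ y, phase θ (g + (Complex.I * (θ j : ℂ)) • v) y * φ y ∂cellMeasure
      = ∫ y, g y * (wave θ * φ) y ∂cellMeasure
        + (Complex.I * (θ j : ℂ)) * ∫ y, v y * (wave θ * φ) y ∂cellMeasure := by
    rw [← integral_const_mul, ← integral_add (integrable_mul_smooth hwφ g)
      ((integrable_mul_smooth hwφ v).const_mul _)]
    refine integral_congr_ae ?_
    filter_upwards [coeFn_phase θ (g + (Complex.I * (θ j : ℂ)) • v),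
      Lp.coeFn_add g ((Complex.I * (θ j : ℂ)) • v),
      Lp.coeFn_smul (Complex.I * (θ j : ℂ)) v] with y h1 h2 h3
    rw [h1, h2, Pi.add_apply, h3, Pi.smul_apply, smul_eq_mul, Pi.mul_apply]
    ring
  rw [e1, e2, h0]
  ring

lemma hasWeakDeriv_phase_smoothing (θ : Plane) (j : Fin 2) (a : ScalarL2) :
    HasWeakDeriv j (phase θ (smoothing a)) (phase θ (thetaDeriv θ j a)) :=
  hasWeakDeriv_phase θ (hasWeakDeriv_smoothing j a)

lemma weakDeriv_phase_smoothing (θ : Plane) (j : Fin 2) (a : ScalarL2) :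
    weakDeriv j (phase θ (smoothing a)) = phase θ (thetaDeriv θ j a) :=
  weakDeriv_eq (hasWeakDeriv_phase_smoothing θ j a)

lemma phase_smoothing_mem_H1quasi (θ : Plane) (a : ScalarL2) :
    phase θ (smoothing a) ∈ H1quasi θ :=
  ⟨fun j => ⟨_, hasWeakDeriv_phase_smoothing θ j a⟩, smoothing a, smoothing_mem_H1per a,
    coeFn_phase θ _⟩

lemma exists_phase_smoothing_eq {θ : Plane} {u : ScalarL2} (hu : u ∈ H1quasi θ) :
    ∃ a, phase θ (smoothing a) = u := by
  obtain ⟨-, v, hv, huv⟩ := hu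
  obtain ⟨a, rfl⟩ := exists_smoothing_eq hv
  refine ⟨a, Lp.ext ?_⟩
  filter_upwards [coeFn_phase θ (smoothing a), huv] with y h1 h2
  rw [h1, h2, wave]

/-- Multiplication by the indicator function of `S`. -/
def cutoff (S : Set Plane) (hS : MeasurableSet S) : ScalarL2 →L[ℂ] ScalarL2 :=
  mulL (S.indicator 1) (measurable_one.indicator hS) fun y => by
    by_cases h : y ∈ S <;> simp [h]

section cutoff

variable {S : Set Plane} {hS : MeasurableSet S}

lemma coeFn_cutoff (u : ScalarL2) : cutoff S hS u =ᵐ[cellMeasure] S.indicator u := by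
  filter_upwards [coeFn_mulL (hg := measurable_one.indicator hS) (h1 := fun y => by
    by_cases h : y ∈ S <;> simp [h]) u] with y hy
  rw [cutoff, hy]
  by_cases h : y ∈ S <;> simp [h]

lemma norm_cutoff_apply_le (u : ScalarL2) : ‖cutoff S hS u‖ ≤ ‖u‖ := norm_mulL_apply_le u

lemma cutoff_eq_zero_iff {u : ScalarL2} :
    cutoff S hS u = 0 ↔ ∀ᵐ y ∂cellMeasure.restrict S, u y = 0 := by
  rw [ae_restrict_iff' hS, Lp.eq_zero_iff_ae_eq_zero]
  constructor
  · intro h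
    filter_upwards [h, coeFn_cutoff (hS := hS) u] with y h1 h2 hy
    rw [h1, Set.indicator_of_mem hy] at h2
    exact h2.symm
  · intro h
    filter_upwards [h, coeFn_cutoff (hS := hS) u] with y h1 h2
    rw [h2]
    by_cases hy : y ∈ S
    · rw [Set.indicator_of_mem hy, h1 hy, Pi.zero_apply]
    · rw [Set.indicator_of_notMem hy, Pi.zero_apply]

lemma inner_cutoff (u v : ScalarL2) :
    inner ℂ v (cutoff S hS u) = ∫ y in S, u y * star (v y) ∂cellMeasure := by
  rw [inner_eq_integral, ← integral_indicator hS]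
  refine integral_congr_ae ?_
  filter_upwards [coeFn_cutoff (hS := hS) u] with y hy
  rw [hy]
  by_cases h : y ∈ S <;> simp [h]

lemma inner_cutoff_cutoff (u v : ScalarL2) :
    inner ℂ (cutoff S hS v) (cutoff S hS u) = ∫ y in S, u y * star (v y) ∂cellMeasure := by
  rw [inner_cutoff]
  refine setIntegral_congr_ae hS ?_
  filter_upwards [coeFn_cutoff (hS := hS) v] with y hy h
  rw [hy, Set.indicator_of_mem h]

lemma cutoff_compl_cutoff {A : Set Plane} {hA : MeasurableSet A} (hAS : A ⊆ S) (u : ScalarL2) :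
    cutoff Sᶜ hS.compl (cutoff A hA u) = 0 := by
  rw [cutoff_eq_zero_iff, ae_restrict_iff' hS.compl]
  filter_upwards [coeFn_cutoff (hS := hA) u] with y hy h
  rw [hy, Set.indicator_of_notMem fun h' => h (hAS h')]

lemma inner_cutoff_of_disjoint {A : Set Plane} {hA : MeasurableSet A} (hd : Disjoint A S)
    (u v : ScalarL2) : inner ℂ (cutoff A hA v) (cutoff S hS u) = 0 := by
  rw [inner_cutoff, ← integral_zero Plane ℂ (μ := cellMeasure.restrict S)]
  refine setIntegral_congr_ae hS ?_
  filter_upwards [coeFn_cutoff (hS := hA) v] with y hy h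
  rw [hy, Set.indicator_of_notMem (fun h' => Set.disjoint_left.1 hd h' h), star_zero, mul_zero]

/-- The normalised constant function does not vanish on a non-empty open subset of the cell. -/
lemma cutoff_fourierVec_zero_ne_zero (hSo : IsOpen S) (hSne : S.Nonempty) (hSc : S ⊆ cell) :
    cutoff S hS (fourierVec 0) ≠ 0 := by
  intro h
  rw [cutoff_eq_zero_iff] at h
  have h1 : ∀ᵐ y ∂cellMeasure.restrict S, False := by
    filter_upwards [h, ae_restrict_of_ae (coeFn_fourierVec 0)] with y e1 e2
    rw [e2] at e1
    have h2 : (Real.pi : ℂ) ≠ 0 := Complex.ofReal_ne_zero.2 Real.pi_ne_zero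
    have h3 : wave (toPlane 0) y ≠ 0 := by
      rw [← norm_pos_iff, norm_wave]
      exact one_pos
    exact mul_ne_zero (by simp [h2]) h3 e1
  rw [Measure.restrict_restrict hS, Set.inter_eq_left.2 hSc] at h1
  rw [ae_iff, Measure.restrict_apply' hS] at h1
  simp only [not_false_eq_true, Set.univ_inter, Set.ofPred_true] at h1
  exact (hSo.measure_pos volume hSne).ne' h1

end cutoff

/-! ### The fibres and the forms -/

/-- The `i`-th component of `L²` vector fields, as a continuous linear map. -/
abbrev comp (i : Fin 2) : VectorL2 →L[ℂ] ScalarL2 := PiLp.proj 2 (fun _ : Fin 2 => ScalarL2) i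

/-- The continuous linear map into a Hilbert space of tuples with given components. -/
def tupleMap {W : Type*} [NormedAddCommGroup W] [NormedSpace ℂ W] {n : ℕ}
    (f : Fin n → W →L[ℂ] ScalarL2) : W →L[ℂ] PiLp 2 fun _ : Fin n => ScalarL2 :=
  ((PiLp.continuousLinearEquiv 2 ℂ fun _ : Fin n => ScalarL2).symm :
    (Fin n → ScalarL2) →L[ℂ] PiLp 2 fun _ : Fin n => ScalarL2) ∘L ContinuousLinearMap.pi f

section tupleMap

variable {W : Type*} [NormedAddCommGroup W] [NormedSpace ℂ W] {n : ℕ}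
  {f : Fin n → W →L[ℂ] ScalarL2}

lemma tupleMap_apply (x : W) (i : Fin n) : tupleMap f x i = f i x := rfl

lemma inner_tupleMap (x y : W) :
    inner ℂ (tupleMap f x) (tupleMap f y) = ∑ i, inner ℂ (f i x) (f i y) :=
  PiLp.inner_apply _ _

lemma norm_tuple_le_sum (z : PiLp 2 fun _ : Fin n => ScalarL2) : ‖z‖ ≤ ∑ i, ‖z i‖ := by
  refine le_of_sq_le_sq ?_ (Finset.sum_nonneg fun i _ => norm_nonneg _)
  rw [PiLp.norm_sq_eq_of_L2]
  exact Finset.sum_sq_le_sq_sum_of_nonneg fun i _ => norm_nonneg _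

lemma norm_apply_le_norm_tuple (z : PiLp 2 fun _ : Fin n => ScalarL2) (i : Fin n) :
    ‖z i‖ ≤ ‖z‖ := PiLp.norm_apply_le z i

lemma isCompactOperator_tupleMap (hf : ∀ i, IsCompactOperator (f i)) :
    IsCompactOperator (tupleMap f) := by
  let ι : Fin n → ScalarL2 →L[ℂ] PiLp 2 fun _ : Fin n => ScalarL2 := fun i =>
    tupleMap fun j => if i = j then ContinuousLinearMap.id ℂ ScalarL2 else 0
  have h : tupleMap f = ∑ i, ι i ∘L f i := by
    refine ContinuousLinearMap.ext fun x => ?_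
    refine PiLp.ext fun j => ?_
    rw [tupleMap_apply, FunLike.coe_sum, Finset.sum_apply, WithLp.ofLp_sum, Finset.sum_apply,
      Finset.sum_eq_single j]
    · simp [ι, tupleMap_apply]
    · intro i _ hi
      simp [ι, tupleMap_apply, hi]
    · simp
  rw [h]
  exact Submodule.sum_mem (compactOperator (RingHom.id ℂ) W _) fun i _ => (hf i).clm_comp (ι i)

end tupleMap

/-- The divergence of the vector field `e^{iθ·y} (1 - Δ)^{-1/2} x`, up to the phase. -/
def thetaDiv (θ : Plane) : VectorL2 →L[ℂ] ScalarL2 :=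
  thetaDeriv θ 0 ∘L comp 0 + thetaDeriv θ 1 ∘L comp 1

/-- The curl of the vector field `e^{iθ·y} (1 - Δ)^{-1/2} x`, up to the phase. -/
def thetaCurl (θ : Plane) : VectorL2 →L[ℂ] ScalarL2 :=
  thetaDeriv θ 0 ∘L comp 1 - thetaDeriv θ 1 ∘L comp 0

lemma thetaDiv_apply (θ : Plane) (x : VectorL2) :
    thetaDiv θ x = thetaDeriv θ 0 (x 0) + thetaDeriv θ 1 (x 1) := rfl

lemma thetaCurl_apply (θ : Plane) (x : VectorL2) :
    thetaCurl θ x = thetaDeriv θ 0 (x 1) - thetaDeriv θ 1 (x 0) := rfl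

/-- The map `x ↦ e^{iθ·y} (1 - Δ)^{-1/2} x`, a bijection from `L²` vector fields onto the
`θ`-quasi-periodic `H¹` vector fields. -/
def blochMap (θ : Plane) : VectorL2 →L[ℂ] VectorL2 :=
  tupleMap fun i => phase θ ∘L smoothing ∘L comp i

lemma blochMap_apply (θ : Plane) (x : VectorL2) (i : Fin 2) :
    blochMap θ x i = phase θ (smoothing (x i)) := rfl

lemma blochMap_injective (θ : Plane) : Function.Injective (blochMap θ) := by
  intro x y h
  refine PiLp.ext fun i => smoothing_injective (phase_injective θ ?_)
  rw [← blochMap_apply, ← blochMap_apply, h]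

lemma divergence_blochMap (θ : Plane) (x : VectorL2) :
    divergence (blochMap θ x) = phase θ (thetaDiv θ x) := by
  rw [divergence, blochMap_apply, blochMap_apply, weakDeriv_phase_smoothing,
    weakDeriv_phase_smoothing, thetaDiv_apply, map_add]

lemma curl_blochMap (θ : Plane) (x : VectorL2) :
    curl (blochMap θ x) = phase θ (thetaCurl θ x) := by
  rw [curl, blochMap_apply, blochMap_apply, weakDeriv_phase_smoothing,
    weakDeriv_phase_smoothing, thetaCurl_apply, map_sub]

/-- The vector fields `x` for which `e^{iθ·y} (1 - Δ)^{-1/2} x` lies in `V(θ)`. -/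
def fibre (R : Set Plane) (hR : MeasurableSet R) (θ : Plane) : Submodule ℂ VectorL2 :=
  (cutoff Rᶜ hR.compl ∘L thetaDiv θ).ker ⊓ (cutoff Rᶜ hR.compl ∘L thetaCurl θ).ker

section fibre

variable {R : Set Plane} {hR : MeasurableSet R} {θ : Plane}

lemma mem_fibre {x : VectorL2} : x ∈ fibre R hR θ ↔
    cutoff Rᶜ hR.compl (thetaDiv θ x) = 0 ∧ cutoff Rᶜ hR.compl (thetaCurl θ x) = 0 := Iff.rfl

instance : CompleteSpace (fibre R hR θ) := by
  have h : IsClosed (fibre R hR θ : Set VectorL2) :=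
    (ContinuousLinearMap.isClosed_ker _).inter (ContinuousLinearMap.isClosed_ker _)
  exact h.completeSpace_coe

lemma cutoff_phase_eq_zero_iff {S : Set Plane} {hS : MeasurableSet S} {u : ScalarL2} :
    cutoff S hS u = 0 ↔ ∀ᵐ y ∂cellMeasure.restrict S, phase θ u y = 0 := by
  rw [cutoff_eq_zero_iff]
  refine eventually_congr ?_
  filter_upwards [ae_restrict_of_ae (coeFn_phase θ u)] with y hy
  have h3 : wave θ y ≠ 0 := by
    rw [← norm_pos_iff, norm_wave]
    exact one_pos
  rw [hy, mul_eq_zero, or_iff_right h3]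

lemma blochMap_mem_iff {x : VectorL2} :
    blochMap θ x ∈ constrainedSpace R θ ↔ x ∈ fibre R hR θ := by
  rw [mem_fibre, cutoff_phase_eq_zero_iff (θ := θ), cutoff_phase_eq_zero_iff (θ := θ),
    ← eventually_and, ← divergence_blochMap, ← curl_blochMap]
  exact ⟨fun h => h.2, fun h => ⟨fun i => phase_smoothing_mem_H1quasi θ (x i), h⟩⟩

lemma mem_constrainedSpace_iff {u : VectorL2} :
    u ∈ constrainedSpace R θ ↔ ∃ x ∈ fibre R hR θ, blochMap θ x = u := by
  constructor
  · intro hu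
    choose a ha using fun i => exists_phase_smoothing_eq (hu.1 i)
    have h : blochMap θ (WithLp.toLp 2 a) = u := PiLp.ext fun i => ha i
    refine ⟨_, ?_, h⟩
    rw [← blochMap_mem_iff, h]
    exact hu
  · rintro ⟨x, hx, rfl⟩
    exact blochMap_mem_iff.2 hx

end fibre

/-- The tuple of `L²` functions whose inner products give the form `c`. -/
def massMap (R : Set Plane) (hR : MeasurableSet R) (γ : ℝ) :
    VectorL2 →L[ℂ] PiLp 2 fun _ : Fin 3 => ScalarL2 :=
  tupleMap ![smoothing ∘L comp 0, smoothing ∘L comp 1,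
    (Real.sqrt γ : ℂ) • (cutoff R hR ∘L smoothing ∘L comp 1)]

/-- The tuple of `L²` functions whose inner products give the form `b + c` on `V(θ)`. -/
def energyMap (R : Set Plane) (hR : MeasurableSet R) (γ : ℝ) (θ : Plane) :
    VectorL2 →L[ℂ] PiLp 2 fun _ : Fin 7 => ScalarL2 :=
  tupleMap ![smoothing ∘L comp 0, smoothing ∘L comp 1,
    (Real.sqrt γ : ℂ) • (cutoff R hR ∘L smoothing ∘L comp 1),
    thetaDeriv θ 0 ∘L comp 1, thetaDeriv θ 1 ∘L comp 1,
    (Real.sqrt γ : ℂ)⁻¹ • thetaDiv θ, (Real.sqrt γ : ℂ)⁻¹ • thetaCurl θ]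

section forms

variable {R : Set Plane} {hR : MeasurableSet R} {θ : Plane} {γ : ℝ}

lemma inner_massMap (hγ : 0 ≤ γ) (x y : VectorL2) :
    inner ℂ (massMap R hR γ y) (massMap R hR γ x)
      = inner ℂ (smoothing (y 0)) (smoothing (x 0)) + inner ℂ (smoothing (y 1)) (smoothing (x 1))
        + γ * inner ℂ (cutoff R hR (smoothing (y 1))) (cutoff R hR (smoothing (x 1))) := by
  rw [massMap, inner_tupleMap, Fin.sum_univ_three]
  have h : (Real.sqrt γ : ℂ) * (Real.sqrt γ : ℂ) = γ := by
    rw [← Complex.ofReal_mul, Real.mul_self_sqrt hγ]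
  simp only [Matrix.cons_val, smul_apply, ContinuousLinearMap.comp_apply, inner_smul_left,
    inner_smul_right, Complex.conj_ofReal, ← mul_assoc, h]
  rfl

lemma inner_energyMap (hγ : 0 ≤ γ) (x y : VectorL2) :
    inner ℂ (energyMap R hR γ θ y) (energyMap R hR γ θ x)
      = inner ℂ (massMap R hR γ y) (massMap R hR γ x)
        + (inner ℂ (thetaDeriv θ 0 (y 1)) (thetaDeriv θ 0 (x 1))
          + inner ℂ (thetaDeriv θ 1 (y 1)) (thetaDeriv θ 1 (x 1))
          + (γ : ℂ)⁻¹ * (inner ℂ (thetaDiv θ y) (thetaDiv θ x)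
            + inner ℂ (thetaCurl θ y) (thetaCurl θ x))) := by
  rw [inner_massMap hγ, energyMap, inner_tupleMap, Fin.sum_univ_seven]
  have h : (Real.sqrt γ : ℂ) * (Real.sqrt γ : ℂ) = γ := by
    rw [← Complex.ofReal_mul, Real.mul_self_sqrt hγ]
  have h' : (Real.sqrt γ : ℂ)⁻¹ * (Real.sqrt γ : ℂ)⁻¹ = (γ : ℂ)⁻¹ := by
    rw [← mul_inv, h]
  simp only [Matrix.cons_val, smul_apply, ContinuousLinearMap.comp_apply, inner_smul_left,
    inner_smul_right, Complex.conj_ofReal, map_inv₀, ← mul_assoc, h, h', mul_add, PiLp.proj_apply]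
  ring

lemma formC_blochMap {ε₀ : ℝ} (hε : 1 < ε₀) (x y : VectorL2) :
    formC R ε₀ (blochMap θ x) (blochMap θ y)
      = inner ℂ (massMap R hR (ε₀ - 1) y) (massMap R hR (ε₀ - 1) x) := by
  have hI := integrable_mul_star
  rw [inner_massMap (sub_pos.2 hε).le, formC, integral_add (hI _ _) (hI _ _), ← inner_eq_integral,
    ← inner_eq_integral, inner_cutoff_cutoff, blochMap_apply, blochMap_apply, blochMap_apply,
    blochMap_apply, inner_phase_phase, inner_phase_phase]
  congr 1
  push_cast
  congr 1
  refine integral_congr_ae (ae_restrict_of_ae ?_)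
  filter_upwards [coeFn_phase θ (smoothing (x 1)), coeFn_phase θ (smoothing (y 1))] with z h1 h2
  rw [h1, h2, star_mul', star_wave]
  have : wave θ z * wave (-θ) z = 1 := by
    rw [← wave_add, add_neg_cancel]
    simp [wave]
  linear_combination (smoothing (x 1) z * star (smoothing (y 1) z)) * this

/-- On `V(θ)` the form `b` is `∫ ∇u₂·∇φ₂ + γ⁻¹ ∫ (div u div φ + curl u curl φ)` over the whole cell:
outside `R` the constraints say that `∇u₂ = -∇^⊥u₁`, and inside `R` this is a rearrangement of the
integrand. -/
lemma formB_eq_inner (hR : MeasurableSet R) {ε₀ : ℝ} (hε : 1 < ε₀) {u φ : VectorL2}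
    (hu : u ∈ constrainedSpace R θ) (hφ : φ ∈ constrainedSpace R θ) :
    formB R ε₀ u φ = inner ℂ (weakDeriv 0 (φ 1)) (weakDeriv 0 (u 1))
      + inner ℂ (weakDeriv 1 (φ 1)) (weakDeriv 1 (u 1))
      + ((ε₀ - 1 : ℝ) : ℂ)⁻¹ * (inner ℂ (divergence φ) (divergence u)
        + inner ℂ (curl φ) (curl u)) := by
  have hγ : (ε₀ : ℂ) - 1 ≠ 0 := by
    have : ((ε₀ - 1 : ℝ) : ℂ) ≠ 0 := Complex.ofReal_ne_zero.2 (sub_pos.2 hε).ne'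
    simpa using this
  have hI := integrable_mul_star
  let G : Plane → ℂ := fun y =>
    weakDeriv 0 (u 1) y * star (weakDeriv 0 (φ 1) y)
      + weakDeriv 1 (u 1) y * star (weakDeriv 1 (φ 1) y)
      + ((ε₀ - 1 : ℝ) : ℂ)⁻¹ * (divergence u y * star (divergence φ y)
        + curl u y * star (curl φ y))
  have hG : Integrable G cellMeasure :=
    ((hI _ _).add (hI _ _)).add (((hI _ _).add (hI _ _)).const_mul _)
  have hdiv : ∀ v : VectorL2, ∀ᵐ y ∂cellMeasure,
      divergence v y = weakDeriv 0 (v 0) y + weakDeriv 1 (v 1) y := fun v => Lp.coeFn_add _ _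
  have hcurl : ∀ v : VectorL2, ∀ᵐ y ∂cellMeasure,
      curl v y = weakDeriv 0 (v 1) y - weakDeriv 1 (v 0) y := fun v => Lp.coeFn_sub _ _
  have e1 : -(1 / 2) * ∫ y in Rᶜ, (gradPerp (u 0) y ⬝ᵥ star (grad (φ 1) y)
      + grad (u 1) y ⬝ᵥ star (gradPerp (φ 0) y)) ∂cellMeasure = ∫ y in Rᶜ, G y ∂cellMeasure := by
    rw [← integral_const_mul]
    refine integral_congr_ae ?_
    filter_upwards [hu.2, hφ.2, ae_restrict_of_ae (hdiv u), ae_restrict_of_ae (hdiv φ),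
      ae_restrict_of_ae (hcurl u), ae_restrict_of_ae (hcurl φ)] with y h1 h2 h3 h4 h5 h6
    simp only [G, h1.1, h1.2, h2.1, h2.2]
    rw [h1.1] at h3
    rw [h2.1] at h4
    rw [h1.2] at h5
    rw [h2.2] at h6
    have a1 : weakDeriv 0 (u 0) y = -weakDeriv 1 (u 1) y := eq_neg_of_add_eq_zero_left h3.symm
    have a2 : weakDeriv 0 (φ 0) y = -weakDeriv 1 (φ 1) y := eq_neg_of_add_eq_zero_left h4.symm
    have a3 : weakDeriv 1 (u 0) y = weakDeriv 0 (u 1) y := (sub_eq_zero.1 h5.symm).symm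
    have a4 : weakDeriv 1 (φ 0) y = weakDeriv 0 (φ 1) y := (sub_eq_zero.1 h6.symm).symm
    simp only [grad, gradPerp, dotProduct, Fin.sum_univ_two, Pi.star_apply, Matrix.cons_val_zero,
      Matrix.cons_val_one, a1, a2, a3, a4, star_neg]
    simp
    ring
  have e2 : (1 / ((ε₀ : ℂ) - 1)) * ∫ y in R, (grad (u 0) y ⬝ᵥ star (grad (φ 0) y)
      + (ε₀ : ℂ) * (grad (u 1) y ⬝ᵥ star (grad (φ 1) y))
      + gradPerp (u 0) y ⬝ᵥ star (grad (φ 1) y)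
      + grad (u 1) y ⬝ᵥ star (gradPerp (φ 0) y)) ∂cellMeasure = ∫ y in R, G y ∂cellMeasure := by
    rw [← integral_const_mul]
    refine integral_congr_ae (ae_restrict_of_ae ?_)
    filter_upwards [hdiv u, hdiv φ, hcurl u, hcurl φ] with y h3 h4 h5 h6
    simp only [G, h3, h4, h5, h6, grad, gradPerp, dotProduct, Fin.sum_univ_two, Pi.star_apply,
      Matrix.cons_val_zero, Matrix.cons_val_one, star_neg, star_add, star_sub]
    push_cast
    field_simp
    ring
  rw [formB, e1, e2, add_comm, integral_add_compl hR hG]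
  have hs1 : Integrable (fun y => weakDeriv 0 (u 1) y * star (weakDeriv 0 (φ 1) y)
      + weakDeriv 1 (u 1) y * star (weakDeriv 1 (φ 1) y)) cellMeasure := (hI _ _).add (hI _ _)
  have hs2 : Integrable (fun y => divergence u y * star (divergence φ y)
      + curl u y * star (curl φ y)) cellMeasure := (hI _ _).add (hI _ _)
  rw [integral_add hs1 (hs2.const_mul _), integral_const_mul, integral_add (hI _ _) (hI _ _),
    integral_add (hI _ _) (hI _ _)]
  simp only [← inner_eq_integral]

lemma formB_blochMap {ε₀ : ℝ} (hε : 1 < ε₀) {x y : VectorL2} (hx : x ∈ fibre R hR θ)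
    (hy : y ∈ fibre R hR θ) :
    formB R ε₀ (blochMap θ x) (blochMap θ y)
      = inner ℂ (energyMap R hR (ε₀ - 1) θ y) (energyMap R hR (ε₀ - 1) θ x)
        - inner ℂ (massMap R hR (ε₀ - 1) y) (massMap R hR (ε₀ - 1) x) := by
  rw [formB_eq_inner hR hε (blochMap_mem_iff.2 hx) (blochMap_mem_iff.2 hy),
    inner_energyMap (sub_pos.2 hε).le]
  simp only [divergence_blochMap, curl_blochMap, blochMap_apply, weakDeriv_phase_smoothing,
    inner_phase_phase]
  ring

end forms

/-! ### Uniform estimates -/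

lemma norm_pair_le (x : VectorL2) : ‖x‖ ≤ ‖x 0‖ + ‖x 1‖ := by
  simpa using norm_tuple_le_sum x

lemma norm_smoothing_le (a : ScalarL2) : ‖smoothing a‖ ≤ ‖a‖ :=
  (norm_fourierMult_apply_le a).trans_eq (one_mul _)

lemma norm_smoothDeriv_le (j : Fin 2) (a : ScalarL2) : ‖smoothDeriv j a‖ ≤ ‖a‖ :=
  (norm_fourierMult_apply_le a).trans_eq (one_mul _)

lemma abs_le_one_of_mem_dualCell {θ : Plane} (hθ : θ ∈ dualCell) (j : Fin 2) : |θ j| ≤ 1 := by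
  have := hθ j trivial
  rw [abs_le]
  constructor <;> linarith [this.1, this.2]

lemma norm_I_mul_ofReal_smul (t : ℝ) (a : ScalarL2) :
    ‖(Complex.I * (t : ℂ)) • a‖ = |t| * ‖a‖ := by
  rw [norm_smul, norm_mul, Complex.norm_I, one_mul, Complex.norm_real, Real.norm_eq_abs]

lemma norm_thetaDeriv_sub_le (θ θ' : Plane) (j : Fin 2) (a : ScalarL2) :
    ‖thetaDeriv θ' j a - thetaDeriv θ j a‖ ≤ ‖θ' - θ‖ * ‖a‖ := by
  have e : thetaDeriv θ' j a - thetaDeriv θ j a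
      = (Complex.I * ((θ' j - θ j : ℝ) : ℂ)) • smoothing a := by
    rw [thetaDeriv_apply, thetaDeriv_apply, add_sub_add_left_eq_sub, ← sub_smul]
    push_cast
    ring_nf
  rw [e, norm_I_mul_ofReal_smul]
  exact mul_le_mul (norm_le_pi_norm (θ' - θ) j) (norm_smoothing_le a) (norm_nonneg _)
    (norm_nonneg _)

/-- Since `x = (1 - Δ)^{-1} x - Δ (1 - Δ)^{-1} x`, the `L²` norm of `x` is controlled by the `H¹`
norm of `(1 - Δ)^{-1/2} x`. -/
lemma norm_le_smoothing_add_thetaDeriv {θ : Plane} (hθ : θ ∈ dualCell) (a : ScalarL2) :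
    ‖a‖ ≤ 3 * ‖smoothing a‖ + ‖thetaDeriv θ 0 a‖ + ‖thetaDeriv θ 1 a‖ := by
  have e : a = smoothing (smoothing a) - smoothDeriv 0 (smoothDeriv 0 a)
      - smoothDeriv 1 (smoothDeriv 1 a) := by
    refine fc_ext fun k => ?_
    simp only [fc_sub, fc_smoothing, fc_smoothDeriv]
    have h1 : (bracket k : ℂ) ^ 2 = 1 + (k 0 : ℂ) ^ 2 + (k 1 : ℂ) ^ 2 := by
      exact_mod_cast bracket_sq k
    have h2 := bracket_ne_zero k
    field_simp
    linear_combination fc a k * h1 + ((k 0 : ℂ) ^ 2 + (k 1 : ℂ) ^ 2) * fc a k * Complex.I_sq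
  have h1 : ∀ j, ‖smoothDeriv j a‖ ≤ ‖thetaDeriv θ j a‖ + ‖smoothing a‖ := by
    intro j
    have e1 : smoothDeriv j a = thetaDeriv θ j a - (Complex.I * (θ j : ℂ)) • smoothing a := by
      rw [thetaDeriv_apply, add_sub_cancel_right]
    rw [e1]
    refine (norm_sub_le _ _).trans ?_
    rw [norm_I_mul_ofReal_smul]
    have := mul_le_mul_of_nonneg_right (abs_le_one_of_mem_dualCell hθ j) (norm_nonneg (smoothing a))
    linarith
  have h2 := norm_sub_le (smoothing (smoothing a) - smoothDeriv 0 (smoothDeriv 0 a))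
    (smoothDeriv 1 (smoothDeriv 1 a))
  have h3 := norm_sub_le (smoothing (smoothing a)) (smoothDeriv 0 (smoothDeriv 0 a))
  rw [← e] at h2
  linarith [norm_smoothing_le (smoothing a), norm_smoothDeriv_le 0 (smoothDeriv 0 a),
    norm_smoothDeriv_le 1 (smoothDeriv 1 a), h1 0, h1 1]

section bounds

variable {R : Set Plane} {hR : MeasurableSet R} {θ θ' : Plane} {γ : ℝ}

lemma norm_ofReal_inv_smul {s : ℝ} (hs : 0 < s) (a : ScalarL2) :
    ‖(s : ℂ)⁻¹ • a‖ = s⁻¹ * ‖a‖ := by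
  rw [norm_smul, norm_inv, Complex.norm_real, Real.norm_of_nonneg hs.le]

/-- Coercivity of the form `b + c`: the derivatives of `u₂` are controlled directly, those of `u₁`
through the divergence and the curl. -/
lemma norm_le_energyMap (hγ : 0 < γ) (hθ : θ ∈ dualCell) (x : VectorL2) :
    (10 + 2 * Real.sqrt γ)⁻¹ * ‖x‖ ≤ ‖energyMap R hR γ θ x‖ := by
  have hs : 0 < Real.sqrt γ := Real.sqrt_pos.2 hγ
  set N := ‖energyMap R hR γ θ x‖ with hN
  have h := norm_apply_le_norm_tuple (energyMap R hR γ θ x)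
  have h0 : ‖smoothing (x 0)‖ ≤ N := h 0
  have h1 : ‖smoothing (x 1)‖ ≤ N := h 1
  have h3 : ‖thetaDeriv θ 0 (x 1)‖ ≤ N := h 3
  have h4 : ‖thetaDeriv θ 1 (x 1)‖ ≤ N := h 4
  have h5 : ‖(Real.sqrt γ : ℂ)⁻¹ • thetaDiv θ x‖ ≤ N := h 5
  have h6 : ‖(Real.sqrt γ : ℂ)⁻¹ • thetaCurl θ x‖ ≤ N := h 6
  rw [norm_ofReal_inv_smul hs, inv_mul_le_iff₀ hs] at h5 h6
  have e1 : thetaDeriv θ 0 (x 0) = thetaDiv θ x - thetaDeriv θ 1 (x 1) := by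
    rw [thetaDiv_apply, add_sub_cancel_right]
  have e2 : thetaDeriv θ 1 (x 0) = thetaDeriv θ 0 (x 1) - thetaCurl θ x := by
    rw [thetaCurl_apply, sub_sub_cancel]
  have k1 := norm_sub_le (thetaDiv θ x) (thetaDeriv θ 1 (x 1))
  have k2 := norm_sub_le (thetaDeriv θ 0 (x 1)) (thetaCurl θ x)
  rw [← e1] at k1
  rw [← e2] at k2
  rw [inv_mul_le_iff₀ (by positivity)]
  linarith [norm_pair_le x, norm_le_smoothing_add_thetaDeriv hθ (x 0),
    norm_le_smoothing_add_thetaDeriv hθ (x 1)]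

lemma norm_apply_le (x : VectorL2) (i : Fin 2) : ‖x i‖ ≤ ‖x‖ := PiLp.norm_apply_le x i

lemma norm_thetaDiv_sub_le (x : VectorL2) :
    ‖thetaDiv θ' x - thetaDiv θ x‖ ≤ 2 * ‖θ' - θ‖ * ‖x‖ := by
  rw [thetaDiv_apply, thetaDiv_apply, add_sub_add_comm]
  refine (norm_add_le _ _).trans ?_
  have h0 := (norm_thetaDeriv_sub_le θ θ' 0 (x 0)).trans
    (mul_le_mul_of_nonneg_left (norm_apply_le x 0) (norm_nonneg _))
  have h1 := (norm_thetaDeriv_sub_le θ θ' 1 (x 1)).trans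
    (mul_le_mul_of_nonneg_left (norm_apply_le x 1) (norm_nonneg _))
  linarith

lemma norm_thetaCurl_sub_le (x : VectorL2) :
    ‖thetaCurl θ' x - thetaCurl θ x‖ ≤ 2 * ‖θ' - θ‖ * ‖x‖ := by
  rw [thetaCurl_apply, thetaCurl_apply, sub_sub_sub_comm]
  refine (norm_sub_le _ _).trans ?_
  have h0 := (norm_thetaDeriv_sub_le θ θ' 0 (x 1)).trans
    (mul_le_mul_of_nonneg_left (norm_apply_le x 1) (norm_nonneg _))
  have h1 := (norm_thetaDeriv_sub_le θ θ' 1 (x 0)).trans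
    (mul_le_mul_of_nonneg_left (norm_apply_le x 0) (norm_nonneg _))
  linarith

lemma norm_energyMap_sub_le (hγ : 0 < γ) (x : VectorL2) :
    ‖energyMap R hR γ θ' x - energyMap R hR γ θ x‖
      ≤ (2 + 4 * (Real.sqrt γ)⁻¹) * ‖θ' - θ‖ * ‖x‖ := by
  have hs : 0 < Real.sqrt γ := Real.sqrt_pos.2 hγ
  refine (norm_tuple_le_sum _).trans ?_
  rw [Fin.sum_univ_seven]
  have e0 : ‖(energyMap R hR γ θ' x - energyMap R hR γ θ x) 0‖ = 0 := by
    change ‖smoothing (x 0) - smoothing (x 0)‖ = 0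
    rw [sub_self, norm_zero]
  have e1 : ‖(energyMap R hR γ θ' x - energyMap R hR γ θ x) 1‖ = 0 := by
    change ‖smoothing (x 1) - smoothing (x 1)‖ = 0
    rw [sub_self, norm_zero]
  have e2 : ‖(energyMap R hR γ θ' x - energyMap R hR γ θ x) 2‖ = 0 := by
    change ‖(Real.sqrt γ : ℂ) • cutoff R hR (smoothing (x 1))
      - (Real.sqrt γ : ℂ) • cutoff R hR (smoothing (x 1))‖ = 0
    rw [sub_self, norm_zero]
  have e3 : ‖(energyMap R hR γ θ' x - energyMap R hR γ θ x) 3‖ ≤ ‖θ' - θ‖ * ‖x‖ :=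
    (norm_thetaDeriv_sub_le θ θ' 0 (x 1)).trans
      (mul_le_mul_of_nonneg_left (norm_apply_le x 1) (norm_nonneg _))
  have e4 : ‖(energyMap R hR γ θ' x - energyMap R hR γ θ x) 4‖ ≤ ‖θ' - θ‖ * ‖x‖ :=
    (norm_thetaDeriv_sub_le θ θ' 1 (x 1)).trans
      (mul_le_mul_of_nonneg_left (norm_apply_le x 1) (norm_nonneg _))
  have e5 : ‖(energyMap R hR γ θ' x - energyMap R hR γ θ x) 5‖
      ≤ (Real.sqrt γ)⁻¹ * (2 * ‖θ' - θ‖ * ‖x‖) := by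
    change ‖(Real.sqrt γ : ℂ)⁻¹ • thetaDiv θ' x - (Real.sqrt γ : ℂ)⁻¹ • thetaDiv θ x‖ ≤ _
    rw [← smul_sub, norm_ofReal_inv_smul hs]
    exact mul_le_mul_of_nonneg_left (norm_thetaDiv_sub_le x) (by positivity)
  have e6 : ‖(energyMap R hR γ θ' x - energyMap R hR γ θ x) 6‖
      ≤ (Real.sqrt γ)⁻¹ * (2 * ‖θ' - θ‖ * ‖x‖) := by
    change ‖(Real.sqrt γ : ℂ)⁻¹ • thetaCurl θ' x - (Real.sqrt γ : ℂ)⁻¹ • thetaCurl θ x‖ ≤ _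
    rw [← smul_sub, norm_ofReal_inv_smul hs]
    exact mul_le_mul_of_nonneg_left (norm_thetaCurl_sub_le x) (by positivity)
  linarith

lemma zero_mem_dualCell : (0 : Plane) ∈ dualCell := fun i _ => by
  simp only [Pi.zero_apply, Set.mem_Ico]
  norm_num

lemma norm_sub_le_one (hθ : θ ∈ dualCell) (hθ' : θ' ∈ dualCell) : ‖θ' - θ‖ ≤ 1 := by
  refine (pi_norm_le_iff_of_nonneg zero_le_one).2 fun j => ?_
  have h1 := hθ j trivial
  have h2 := hθ' j trivial
  rw [Real.norm_eq_abs, abs_le, Pi.sub_apply]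
  constructor <;> linarith [h1.1, h1.2, h2.1, h2.2]

/-- The energy maps are uniformly bounded, by the estimate for their dependence on `θ`. -/
lemma exists_norm_energyMap_le (R : Set Plane) (hR : MeasurableSet R) (hγ : 0 < γ) :
    ∃ M : ℝ, 0 ≤ M ∧ ∀ θ ∈ dualCell, ∀ x, ‖energyMap R hR γ θ x‖ ≤ M * ‖x‖ := by
  have hs : 0 < Real.sqrt γ := Real.sqrt_pos.2 hγ
  refine ⟨‖energyMap R hR γ 0‖ + (2 + 4 * (Real.sqrt γ)⁻¹), by positivity, fun θ hθ x => ?_⟩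
  have h1 := norm_energyMap_sub_le (R := R) (hR := hR) (θ := 0) (θ' := θ) hγ x
  have h2 := norm_sub_le_one zero_mem_dualCell hθ
  have h3 := (energyMap R hR γ 0).le_opNorm x
  have h4 := norm_add_le (energyMap R hR γ 0 x) (energyMap R hR γ θ x - energyMap R hR γ 0 x)
  rw [add_sub_cancel] at h4
  have h5 : (2 + 4 * (Real.sqrt γ)⁻¹) * ‖θ - 0‖ * ‖x‖ ≤ (2 + 4 * (Real.sqrt γ)⁻¹) * ‖x‖ :=
    mul_le_mul_of_nonneg_right (mul_le_of_le_one_right (by positivity) h2) (norm_nonneg _)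
  linarith

lemma norm_massMap_le_energyMap (hγ : 0 < γ) (x : VectorL2) :
    ‖massMap R hR γ x‖ ≤ ‖energyMap R hR γ θ x‖ := by
  refine le_of_sq_le_sq ?_ (norm_nonneg _)
  have h := congrArg Complex.re (inner_energyMap (R := R) (hR := hR) (θ := θ) hγ.le x x)
  simp only [inner_self_eq_ofReal] at h
  have e : ‖energyMap R hR γ θ x‖ ^ 2 = ‖massMap R hR γ x‖ ^ 2
      + (‖thetaDeriv θ 0 (x 1)‖ ^ 2 + ‖thetaDeriv θ 1 (x 1)‖ ^ 2
        + γ⁻¹ * (‖thetaDiv θ x‖ ^ 2 + ‖thetaCurl θ x‖ ^ 2)) := by exact_mod_cast h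
  rw [e]
  exact le_add_of_nonneg_right (by positivity)

lemma massMap_injective : Function.Injective (massMap R hR γ) := by
  intro x y h
  refine PiLp.ext fun i => smoothing_injective ?_
  fin_cases i
  · exact congrArg (fun z : PiLp 2 fun _ : Fin 3 => ScalarL2 => z 0) h
  · exact congrArg (fun z : PiLp 2 fun _ : Fin 3 => ScalarL2 => z 1) h

lemma isCompactOperator_massMap : IsCompactOperator (massMap R hR γ) := by
  refine isCompactOperator_tupleMap fun i => ?_
  have h : ∀ j, IsCompactOperator (smoothing ∘L comp j) := fun j =>
    isCompactOperator_smoothing.comp_clm (comp j)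
  fin_cases i
  · exact h 0
  · exact h 1
  · exact ((h 1).clm_comp (cutoff R hR)).smul (Real.sqrt γ : ℂ)

end bounds

/-! ### The div-curl system -/

/-- The symbol of the operator `(1 - Δ)^{1/2} (∂_j + iθ_j) Δ_θ⁻¹` with
`Δ_θ = (∂_0 + iθ_0)² + (∂_1 + iθ_1)²`, set to zero at the zero frequency, where `Δ_θ` is singular
for `θ = 0`. -/
def solveSymbol (θ : Plane) (j : Fin 2) (k : Fin 2 → ℤ) : ℂ :=
  if k = 0 then 0 else -Complex.I * ((bracket k * (k j + θ j) /
    (((k 0 : ℝ) + θ 0) ^ 2 + ((k 1 : ℝ) + θ 1) ^ 2) : ℝ) : ℂ)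

/-- For `θ` in the dual cell the shifted non-zero frequencies `k + θ` are at least half as long as
`k`. -/
lemma bracket_sq_le {θ : Plane} (hθ : θ ∈ dualCell) {k : Fin 2 → ℤ} (hk : k ≠ 0) :
    bracket k ^ 2 ≤ 8 * (((k 0 : ℝ) + θ 0) ^ 2 + ((k 1 : ℝ) + θ 1) ^ 2) := by
  have h1 : ∀ j, (k j : ℝ) ^ 2 ≤ 4 * ((k j : ℝ) + θ j) ^ 2 := by
    intro j
    have hj := hθ j trivial
    -- `|θ j| ≤ 1 / 2 ≤ |k j| / 2` unless `k j = 0`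
    rcases lt_trichotomy (k j) 0 with h | h | h
    · have : (k j : ℝ) ≤ -1 := by exact_mod_cast Int.le_sub_one_of_lt h
      nlinarith [hj.1, hj.2]
    · rw [h]
      push_cast
      nlinarith [sq_nonneg (θ j)]
    · have : (1 : ℝ) ≤ k j := by exact_mod_cast h
      nlinarith [hj.1, hj.2]
  have h2 : (1 : ℝ) ≤ (k 0 : ℝ) ^ 2 + (k 1 : ℝ) ^ 2 := by
    have : (1 : ℤ) ≤ k 0 ^ 2 + k 1 ^ 2 := by
      by_contra! hcon
      have a0 : k 0 = 0 := by nlinarith [sq_nonneg (k 0), sq_nonneg (k 1)]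
      have a1 : k 1 = 0 := by nlinarith [sq_nonneg (k 0), sq_nonneg (k 1)]
      exact hk (funext fun i => by fin_cases i <;> assumption)
    exact_mod_cast this
  rw [bracket_sq]
  linarith [h1 0, h1 1]

lemma norm_solveSymbol_le {θ : Plane} (hθ : θ ∈ dualCell) (j : Fin 2) (k : Fin 2 → ℤ) :
    ‖solveSymbol θ j k‖ ≤ 3 := by
  rw [solveSymbol]
  split_ifs with hk
  · simp
  · have h1 := bracket_sq_le hθ hk
    set q := ((k 0 : ℝ) + θ 0) ^ 2 + ((k 1 : ℝ) + θ 1) ^ 2 with hq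
    have hb := one_le_bracket k
    have hq0 : 0 < q := by nlinarith
    rw [norm_mul, norm_neg, Complex.norm_I, one_mul, Complex.norm_real, Real.norm_eq_abs, abs_div,
      abs_of_pos hq0, div_le_iff₀ hq0]
    refine abs_le_of_sq_le_sq ?_ (by positivity)
    have h2 : ((k j : ℝ) + θ j) ^ 2 ≤ q := by
      rw [hq]
      fin_cases j
      · exact le_add_of_nonneg_right (sq_nonneg _)
      · exact le_add_of_nonneg_left (sq_nonneg _)
    have h3 : bracket k ^ 2 * ((k j : ℝ) + θ j) ^ 2 ≤ (8 * q) * q :=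
      mul_le_mul h1 h2 (sq_nonneg _) (by positivity)
    nlinarith

section solve

variable {θ : Plane} (hθ : θ ∈ dualCell)

/-- The solution `x` of the div-curl system `thetaDiv θ x = g`, `thetaCurl θ x = h` for right-hand
sides without zero frequency. -/
def solve (g h : ScalarL2) : VectorL2 :=
  WithLp.toLp 2
    ![fourierMult _ (norm_solveSymbol_le hθ 0) g - fourierMult _ (norm_solveSymbol_le hθ 1) h,
      fourierMult _ (norm_solveSymbol_le hθ 1) g + fourierMult _ (norm_solveSymbol_le hθ 0) h]

lemma solve_apply_zero (g h : ScalarL2) : solve hθ g h 0 =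
    fourierMult _ (norm_solveSymbol_le hθ 0) g - fourierMult _ (norm_solveSymbol_le hθ 1) h := rfl

lemma solve_apply_one (g h : ScalarL2) : solve hθ g h 1 =
    fourierMult _ (norm_solveSymbol_le hθ 1) g + fourierMult _ (norm_solveSymbol_le hθ 0) h := rfl

lemma solve_add (g g' h h' : ScalarL2) :
    solve hθ (g + g') (h + h') = solve hθ g h + solve hθ g' h' := by
  refine PiLp.ext fun i => ?_
  fin_cases i
  · change solve hθ _ _ 0 = solve hθ _ _ 0 + solve hθ _ _ 0
    simp only [solve_apply_zero, map_add]
    abel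
  · change solve hθ _ _ 1 = solve hθ _ _ 1 + solve hθ _ _ 1
    simp only [solve_apply_one, map_add]
    abel

lemma solve_smul (a : ℂ) (g h : ScalarL2) : solve hθ (a • g) (a • h) = a • solve hθ g h := by
  refine PiLp.ext fun i => ?_
  fin_cases i
  · change solve hθ _ _ 0 = a • solve hθ _ _ 0
    simp only [solve_apply_zero, map_smul, smul_sub]
  · change solve hθ _ _ 1 = a • solve hθ _ _ 1
    simp only [solve_apply_one, map_smul, smul_add]

lemma norm_solve_le (g h : ScalarL2) : ‖solve hθ g h‖ ≤ 6 * (‖g‖ + ‖h‖) := by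
  refine (norm_pair_le _).trans ?_
  have h0 := norm_sub_le (fourierMult _ (norm_solveSymbol_le hθ 0) g)
    (fourierMult _ (norm_solveSymbol_le hθ 1) h)
  have h1 := norm_add_le (fourierMult _ (norm_solveSymbol_le hθ 1) g)
    (fourierMult _ (norm_solveSymbol_le hθ 0) h)
  have hm : ∀ j u, ‖fourierMult _ (norm_solveSymbol_le hθ j) u‖ ≤ 3 * ‖u‖ := fun j u =>
    norm_fourierMult_apply_le u
  rw [solve_apply_zero, solve_apply_one]
  linarith [hm 0 g, hm 1 g, hm 0 h, hm 1 h]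

lemma fc_thetaDeriv (θ : Plane) (j : Fin 2) (a : ScalarL2) (k : Fin 2 → ℤ) :
    fc (thetaDeriv θ j a) k = Complex.I * (k j + θ j) * (bracket k : ℂ)⁻¹ * fc a k := by
  rw [thetaDeriv_apply, fc_add, fc_smul, fc_smoothDeriv, fc_smoothing]
  ring

lemma symbol_ne_zero {k : Fin 2 → ℤ} (hθ : θ ∈ dualCell) (hk : k ≠ 0) :
    ((k 0 : ℂ) + θ 0) ^ 2 + ((k 1 : ℂ) + θ 1) ^ 2 ≠ 0 := by
  have h1 := bracket_sq_le hθ hk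
  have hb := one_le_bracket k
  have : ((k 0 : ℝ) + θ 0) ^ 2 + ((k 1 : ℝ) + θ 1) ^ 2 ≠ 0 := by nlinarith
  exact_mod_cast this

lemma thetaDiv_solve {g : ScalarL2} (h : ScalarL2) (hg : fc g 0 = 0) :
    thetaDiv θ (solve hθ g h) = g := by
  refine fc_ext fun k => ?_
  rw [thetaDiv_apply, fc_add, fc_thetaDeriv, fc_thetaDeriv, solve_apply_zero, solve_apply_one,
    fc_sub, fc_add, fc_fourierMult, fc_fourierMult, fc_fourierMult, fc_fourierMult]
  by_cases hk : k = 0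
  · subst hk
    simp [solveSymbol, hg]
  · have hq := symbol_ne_zero hθ hk
    have hb := bracket_ne_zero k
    simp only [solveSymbol, if_neg hk]
    push_cast
    field_simp
    linear_combination (-(fc g k) * (((k 0 : ℂ) + θ 0) ^ 2 + ((k 1 : ℂ) + θ 1) ^ 2)) * Complex.I_sq

lemma thetaCurl_solve (g : ScalarL2) {h : ScalarL2} (hh : fc h 0 = 0) :
    thetaCurl θ (solve hθ g h) = h := by
  refine fc_ext fun k => ?_
  rw [thetaCurl_apply, fc_sub, fc_thetaDeriv, fc_thetaDeriv, solve_apply_zero, solve_apply_one,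
    fc_sub, fc_add, fc_fourierMult, fc_fourierMult, fc_fourierMult, fc_fourierMult]
  by_cases hk : k = 0
  · subst hk
    simp [solveSymbol, hh]
  · have hq := symbol_ne_zero hθ hk
    have hb := bracket_ne_zero k
    simp only [solveSymbol, if_neg hk]
    push_cast
    field_simp
    linear_combination (-(fc h k) * (((k 0 : ℂ) + θ 0) ^ 2 + ((k 1 : ℂ) + θ 1) ^ 2)) * Complex.I_sq

end solve

/-- The linear map that subtracts from `g` a multiple of the function `r` so as to remove its zero
frequency. -/
def removeMean (r : ScalarL2) : ScalarL2 →L[ℂ] ScalarL2 :=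
  ContinuousLinearMap.id ℂ ScalarL2 -
    (innerSL ℂ (fourierVec 0)).smulRight ((fc r 0)⁻¹ • r)

lemma removeMean_apply (r g : ScalarL2) :
    removeMean r g = g - fc g 0 • (fc r 0)⁻¹ • r := by
  rw [fc_eq_inner g]
  rfl

lemma fc_removeMean {r : ScalarL2} (hr : fc r 0 ≠ 0) (g : ScalarL2) :
    fc (removeMean r g) 0 = 0 := by
  rw [removeMean_apply, fc_sub, fc_smul, fc_smul, inv_mul_cancel₀ hr, mul_one, sub_self]

lemma fc_cutoff_fourierVec_zero {S : Set Plane} {hS : MeasurableSet S} :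
    fc (cutoff S hS (fourierVec 0)) 0 = ((‖cutoff S hS (fourierVec 0)‖ ^ 2 : ℝ) : ℂ) := by
  rw [← inner_self_eq_ofReal, inner_cutoff_cutoff, fc_eq_inner, inner_cutoff]

lemma fc_cutoff_fourierVec_zero_ne_zero {S : Set Plane} {hS : MeasurableSet S} (hSo : IsOpen S)
    (hSne : S.Nonempty) (hSc : S ⊆ cell) : fc (cutoff S hS (fourierVec 0)) 0 ≠ 0 := by
  rw [fc_cutoff_fourierVec_zero, Complex.ofReal_ne_zero]
  exact pow_ne_zero 2 (norm_ne_zero_iff.2 (cutoff_fourierVec_zero_ne_zero hSo hSne hSc))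

/-! ### Correction of the constraints and dimension of the fibres -/

section transfer

variable {R : Set Plane} {hR : MeasurableSet R}

/-- Removing the mean by means of a function supported in `R` changes nothing outside `R`. -/
lemma cutoff_removeMean (g : ScalarL2) :
    cutoff Rᶜ hR.compl (removeMean (cutoff R hR (fourierVec 0)) g) = cutoff Rᶜ hR.compl g := by
  rw [removeMean_apply, map_sub, map_smul, map_smul, cutoff_compl_cutoff (hS := hR) subset_rfl,
    smul_zero, smul_zero, sub_zero]

lemma cutoff_cutoff (u : ScalarL2) : cutoff R hR (cutoff R hR u) = cutoff R hR u := by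
  refine Lp.ext ?_
  filter_upwards [coeFn_cutoff (hS := hR) u, coeFn_cutoff (hS := hR) (cutoff R hR u)] with y h1 h2
  rw [h2, h1]
  by_cases h : y ∈ R <;> simp [h, h1]

/-- The vector field `x` minus a solution of the div-curl system whose data agree outside `R` with
the divergence and the curl of `x`. Elements of the fibre at `θ` are left unchanged. -/
def fibreProj (R : Set Plane) (hR : MeasurableSet R) {θ : Plane} (hθ : θ ∈ dualCell) :
    VectorL2 →ₗ[ℂ] VectorL2 where
  toFun x := x - solve hθ
    (removeMean (cutoff R hR (fourierVec 0)) (cutoff Rᶜ hR.compl (thetaDiv θ x)))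
    (removeMean (cutoff R hR (fourierVec 0)) (cutoff Rᶜ hR.compl (thetaCurl θ x)))
  map_add' x y := by
    simp only [map_add, solve_add]
    abel
  map_smul' a x := by
    simp only [map_smul, solve_smul, RingHom.id_apply, smul_sub]

lemma fibreProj_apply {θ : Plane} (hθ : θ ∈ dualCell) (x : VectorL2) :
    fibreProj R hR hθ x = x - solve hθ
      (removeMean (cutoff R hR (fourierVec 0)) (cutoff Rᶜ hR.compl (thetaDiv θ x)))
      (removeMean (cutoff R hR (fourierVec 0)) (cutoff Rᶜ hR.compl (thetaCurl θ x))) := rfl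

lemma fibreProj_mem (hr : fc (cutoff R hR (fourierVec 0)) 0 ≠ 0) {θ : Plane} (hθ : θ ∈ dualCell)
    (x : VectorL2) : fibreProj R hR hθ x ∈ fibre R hR θ := by
  rw [mem_fibre, fibreProj_apply]
  constructor
  · rw [map_sub, thetaDiv_solve hθ _ (fc_removeMean hr _), map_sub, cutoff_removeMean,
      cutoff_cutoff, sub_self]
  · rw [map_sub, thetaCurl_solve hθ _ (fc_removeMean hr _), map_sub, cutoff_removeMean,
      cutoff_cutoff, sub_self]

lemma norm_fibreProj_sub_le {θ θ' : Plane} (hθ' : θ' ∈ dualCell) {x : VectorL2}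
    (hx : x ∈ fibre R hR θ) :
    ‖fibreProj R hR hθ' x - x‖
      ≤ 24 * ‖removeMean (cutoff R hR (fourierVec 0))‖ * ‖θ' - θ‖ * ‖x‖ := by
  set K := removeMean (cutoff R hR (fourierVec 0))
  have e : fibreProj R hR hθ' x - x = -solve hθ' (K (cutoff Rᶜ hR.compl (thetaDiv θ' x)))
      (K (cutoff Rᶜ hR.compl (thetaCurl θ' x))) := by
    rw [fibreProj_apply, sub_sub_cancel_left]
  rw [e, norm_neg]
  have h1 : ‖cutoff Rᶜ hR.compl (thetaDiv θ' x)‖ ≤ 2 * ‖θ' - θ‖ * ‖x‖ := by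
    have : cutoff Rᶜ hR.compl (thetaDiv θ' x)
        = cutoff Rᶜ hR.compl (thetaDiv θ' x - thetaDiv θ x) := by
      rw [map_sub, (mem_fibre.1 hx).1, sub_zero]
    rw [this]
    exact (norm_cutoff_apply_le _).trans (norm_thetaDiv_sub_le x)
  have h2 : ‖cutoff Rᶜ hR.compl (thetaCurl θ' x)‖ ≤ 2 * ‖θ' - θ‖ * ‖x‖ := by
    have : cutoff Rᶜ hR.compl (thetaCurl θ' x)
        = cutoff Rᶜ hR.compl (thetaCurl θ' x - thetaCurl θ x) := by
      rw [map_sub, (mem_fibre.1 hx).2, sub_zero]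
    rw [this]
    exact (norm_cutoff_apply_le _).trans (norm_thetaCurl_sub_le x)
  have k1 := K.le_opNorm_of_le h1
  have k2 := K.le_opNorm_of_le h2
  linarith [norm_solve_le hθ' (K (cutoff Rᶜ hR.compl (thetaDiv θ' x)))
    (K (cutoff Rᶜ hR.compl (thetaCurl θ' x)))]

/-- The fibres contain solutions of the div-curl system with divergences supported in `R`, and hence
have infinite dimension. -/
lemma not_finiteDimensional_fibre (hRo : IsOpen R) (hRne : R.Nonempty) (hRc : R ⊆ cell)
    {θ : Plane} (hθ : θ ∈ dualCell) : ¬ FiniteDimensional ℂ (fibre R hR θ) := by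
  obtain ⟨U, hU, hUo, hUd⟩ : ∃ U : ℕ → Set Plane, (∀ n, (U n).Nonempty ∧ U n ⊆ R) ∧
      (∀ n, IsOpen (U n)) ∧ ∀ m n, m ≠ n → Disjoint (U m) (U n) := by
    have hinf : Infinite R := by
      obtain ⟨p, hp⟩ := hRne
      exact (infinite_of_mem_nhds p (hRo.mem_nhds hp)).to_subtype
    obtain ⟨W, hWi, hWo, hWd⟩ := exists_seq_infinite_isOpen_pairwise_disjoint R
    refine ⟨fun n => Subtype.val '' W n, fun n => ⟨(hWi n).nonempty.image _, ?_⟩,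
      fun n => hRo.isOpenMap_subtype_val _ (hWo n), fun m n hmn => ?_⟩
    · rintro _ ⟨x, -, rfl⟩
      exact x.2
    · exact (Set.disjoint_image_iff Subtype.val_injective).2 (hWd hmn)
  let v : ℕ → ScalarL2 := fun n => cutoff (U n) (hUo n).measurableSet (fourierVec 0)
  have hv0 : ∀ n, fc (v n) 0 ≠ 0 := fun n =>
    fc_cutoff_fourierVec_zero_ne_zero (hUo n) (hU n).1 ((hU n).2.trans hRc)
  have hvv : ∀ m n, m ≠ n → inner ℂ (v m) (v n) = 0 := fun m n hmn =>
    inner_cutoff_of_disjoint (hUd m n hmn) _ _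
  have hvn : ∀ n, inner ℂ (v n) (v n) ≠ 0 := fun n =>
    inner_self_ne_zero.2 (cutoff_fourierVec_zero_ne_zero (hUo n) (hU n).1 ((hU n).2.trans hRc))
  have hvR : ∀ n, cutoff Rᶜ hR.compl (v n) = 0 := fun n => cutoff_compl_cutoff (hS := hR) (hU n).2 _
  -- the means of `v 1, v 2, …` are removed by means of `v 0`
  let g : ℕ → ScalarL2 := fun n => removeMean (v 0) (v (n + 1))
  have hg : ∀ n, fc (g n) 0 = 0 := fun n => fc_removeMean (hv0 0) _
  have hgR : ∀ n, cutoff Rᶜ hR.compl (g n) = 0 := fun n => by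
    simp only [g, removeMean_apply, map_sub, map_smul, hvR, smul_zero, sub_zero]
  have hgv : ∀ m n, inner ℂ (v (m + 1)) (g n) = inner ℂ (v (m + 1)) (v (n + 1)) := by
    intro m n
    simp only [g, removeMean_apply, inner_sub_right, inner_smul_right, hvv _ _ (Nat.succ_ne_zero m),
      mul_zero, sub_zero]
  have hz : fc (0 : ScalarL2) 0 = 0 := by rw [fc_eq_inner, inner_zero_right]
  let x : ℕ → fibre R hR θ := fun n => ⟨solve hθ (g n) 0, mem_fibre.2 (by
    rw [thetaDiv_solve hθ _ (hg n), thetaCurl_solve hθ _ hz, hgR, map_zero]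
    exact ⟨rfl, rfl⟩)⟩
  have hx : ∀ n, thetaDiv θ (x n) = g n := fun n => thetaDiv_solve hθ _ (hg n)
  have hli : LinearIndependent ℂ x := by
    rw [linearIndependent_iff']
    intro s c hc m hm
    have h1 := congrArg (fun z : fibre R hR θ => inner ℂ (v (m + 1)) (thetaDiv θ z)) hc
    simp only [AddSubmonoidClass.coe_finsetSum, SetLike.val_smul, map_sum, map_smul, hx,
      inner_sum, inner_smul_right, hgv, ZeroMemClass.coe_zero, map_zero, inner_zero_right] at h1
    rw [Finset.sum_eq_single m] at h1
    · exact (mul_eq_zero.1 h1).resolve_right (hvn _)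
    · intro n _ hn
      rw [hvv _ _ (fun h => hn (Nat.succ_injective h).symm), mul_zero]
    · exact fun h => absurd hm h
  intro hfin
  exact Module.Finite.not_linearIndependent_of_infinite x hli

end transfer

/-! ### The eigenvalues and their dependence on the quasi-momentum -/

section resolution

variable {R : Set Plane} {hR : MeasurableSet R} {θ : Plane} {γ : ℝ}

/-- The energy map on the fibre at `θ`. -/
def fibreEnergy (R : Set Plane) (hR : MeasurableSet R) (γ : ℝ) (θ : Plane) :
    fibre R hR θ →L[ℂ] PiLp 2 fun _ : Fin 7 => ScalarL2 :=
  energyMap R hR γ θ ∘L (fibre R hR θ).subtypeL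

/-- The mass map on the fibre at `θ`. -/
def fibreMass (R : Set Plane) (hR : MeasurableSet R) (γ : ℝ) (θ : Plane) :
    fibre R hR θ →L[ℂ] PiLp 2 fun _ : Fin 3 => ScalarL2 :=
  massMap R hR γ ∘L (fibre R hR θ).subtypeL

lemma fibreEnergy_apply (x : fibre R hR θ) : fibreEnergy R hR γ θ x = energyMap R hR γ θ x := rfl

lemma fibreMass_apply (x : fibre R hR θ) : fibreMass R hR γ θ x = massMap R hR γ x := rfl

lemma fibreMass_injective : Function.Injective (fibreMass R hR γ θ) :=
  massMap_injective.comp Subtype.val_injective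

lemma exists_spectralResolution_fibre (hRo : IsOpen R) (hRne : R.Nonempty) (hRc : R ⊆ cell)
    (hγ : 0 < γ) (hθ : θ ∈ dualCell) :
    ∃ l x, SpectralResolution (fibreEnergy R hR γ θ) (fibreMass R hR γ θ) l x :=
  exists_spectralResolution (not_finiteDimensional_fibre hRo hRne hRc hθ) _ _
    (isCompactOperator_massMap.comp_clm _) fibreMass_injective
    (c := (10 + 2 * Real.sqrt γ)⁻¹) (by positivity) fun x => norm_le_energyMap hγ hθ (x : VectorL2)

lemma eigenspace_criticalOperator {ε₀ : ℝ} (hε : 1 < ε₀) (μ : ℂ) :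
    eigenspace (criticalOperator R ε₀ θ) μ
      = (SpectralResolution.pencilEigenspace (fibreEnergy R hR (ε₀ - 1) θ)
          (fibreMass R hR (ε₀ - 1) θ) (μ + 1)).map
            ((blochMap θ).toLinearMap ∘ₗ (fibre R hR θ).subtype) := by
  ext u
  have h0 : u ∈ eigenspace (criticalOperator R ε₀ θ) μ ↔ (u, μ • u) ∈ criticalGraph R ε₀ θ := by
    rw [← mem_criticalOperator_graph hR hε θ]
    rfl
  have key : ∀ x ∈ fibre R hR θ, ∀ y ∈ fibre R hR θ,
      (formB R ε₀ (blochMap θ x) (blochMap θ y) = formC R ε₀ (μ • blochMap θ x) (blochMap θ y) ↔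
        inner ℂ (energyMap R hR (ε₀ - 1) θ y) (energyMap R hR (ε₀ - 1) θ x)
          = (μ + 1) * inner ℂ (massMap R hR (ε₀ - 1) y) (massMap R hR (ε₀ - 1) x)) := by
    intro x hx y hy
    rw [formC_smul_left, formB_blochMap hε hx hy, formC_blochMap (hR := hR) hε, sub_eq_iff_eq_add,
      add_mul, one_mul]
  rw [h0]
  constructor
  · rintro ⟨h1, -, h3⟩
    obtain ⟨x, hx, rfl⟩ := (mem_constrainedSpace_iff (hR := hR)).1 h1
    exact ⟨⟨x, hx⟩, fun y => (key x hx y y.2).1 (h3 _ (blochMap_mem_iff.2 y.2)), rfl⟩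
  · rintro ⟨x, hx, rfl⟩
    have hmem : blochMap θ x ∈ constrainedSpace R θ := blochMap_mem_iff.2 x.2
    refine ⟨hmem, Submodule.smul_mem _ _ (Submodule.le_topologicalClosure _ hmem), ?_⟩
    intro φ hφ
    obtain ⟨y, hy, rfl⟩ := (mem_constrainedSpace_iff (hR := hR)).1 hφ
    exact (key x x.2 y hy).2 (hx ⟨y, hy⟩)

/-- The eigenvalues of `𝓑(θ)` are those of the pair of forms `b + c` and `c`, shifted by one. -/
lemma isOrderedEigenvalues_sub_one {ε₀ : ℝ} (hε : 1 < ε₀) {l : ℕ → ℝ} {x : ℕ → fibre R hR θ}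
    (h : SpectralResolution (fibreEnergy R hR (ε₀ - 1) θ) (fibreMass R hR (ε₀ - 1) θ) l x) :
    IsOrderedEigenvalues (criticalOperator R ε₀ θ) fun n => l n - 1 where
  nonneg n := sub_nonneg.2 (h.one_le (fun y => norm_massMap_le_energyMap (sub_pos.2 hε) _) n)
  monotone m n hmn := sub_le_sub_right (h.monotone hmn) 1
  tendsto := tendsto_atTop_add_const_right _ (-1) h.tendsto
  multiplicity μ := by
    have hinj : Function.Injective ((blochMap θ).toLinearMap ∘ₗ (fibre R hR θ).subtype) :=
      (blochMap_injective θ).comp Subtype.val_injective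
    rw [eigenspace_criticalOperator (hR := hR) hε,
      ← (Submodule.equivMapOfInjective _ hinj _).rank_eq,
      h.rank_pencilEigenspace fibreMass_injective]
    congr 1
    push_cast
    simp only [sub_eq_iff_eq_add]

/-- The transfer map from the fibre at `θ` to the fibre at `θ'`. -/
def transfer (hr : fc (cutoff R hR (fourierVec 0)) 0 ≠ 0) (θ : Plane) {θ' : Plane}
    (hθ' : θ' ∈ dualCell) : fibre R hR θ →ₗ[ℂ] fibre R hR θ' :=
  ((fibreProj R hR hθ').codRestrict (fibre R hR θ') (fibreProj_mem hr hθ')) ∘ₗ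
    (fibre R hR θ).subtype

lemma coe_transfer (hr : fc (cutoff R hR (fourierVec 0)) 0 ≠ 0) {θ' : Plane}
    (hθ' : θ' ∈ dualCell) (y : fibre R hR θ) :
    (transfer hr θ hθ' y : VectorL2) = fibreProj R hR hθ' y := rfl

/-- The transfer maps change the forms by an amount of order `‖θ' - θ‖`. -/
lemma exists_transfer_bounds (hr : fc (cutoff R hR (fourierVec 0)) 0 ≠ 0) (hγ : 0 < γ) :
    ∃ C : ℝ, 0 ≤ C ∧ ∀ θ ∈ dualCell, ∀ (θ' : Plane) (hθ' : θ' ∈ dualCell) (y : fibre R hR θ),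
      ‖fibreEnergy R hR γ θ' (transfer hr θ hθ' y)‖
          ≤ (1 + C * ‖θ' - θ‖) * ‖fibreEnergy R hR γ θ y‖ ∧
        ‖fibreMass R hR γ θ y‖ - C * ‖θ' - θ‖ * ‖fibreEnergy R hR γ θ y‖
          ≤ ‖fibreMass R hR γ θ' (transfer hr θ hθ' y)‖ := by
  -- `M` bounds the energy maps, `K` the correction of the constraints and `L` the dependence of the
  -- energy map on `θ`; `c` comes from coercivity
  obtain ⟨M, hM0, hM⟩ := exists_norm_energyMap_le R hR hγ
  obtain ⟨K, hK0, hK⟩ : ∃ K : ℝ, 0 ≤ K ∧ ∀ (θ θ' : Plane) (hθ' : θ' ∈ dualCell),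
      ∀ x ∈ fibre R hR θ, ‖fibreProj R hR hθ' x - x‖ ≤ K * ‖θ' - θ‖ * ‖x‖ :=
    ⟨_, by positivity, fun θ θ' hθ' x hx => norm_fibreProj_sub_le hθ' hx⟩
  obtain ⟨L, hL0, hL⟩ : ∃ L : ℝ, 0 ≤ L ∧ ∀ (θ θ' : Plane) (x : VectorL2),
      ‖energyMap R hR γ θ' x - energyMap R hR γ θ x‖ ≤ L * ‖θ' - θ‖ * ‖x‖ :=
    ⟨_, by positivity, fun θ θ' x => norm_energyMap_sub_le hγ x⟩
  obtain ⟨c, hc0, hc⟩ : ∃ c : ℝ, 0 ≤ c ∧ ∀ θ ∈ dualCell, ∀ x : VectorL2,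
      ‖x‖ ≤ c * ‖energyMap R hR γ θ x‖ := by
    refine ⟨10 + 2 * Real.sqrt γ, by positivity, fun θ hθ x => ?_⟩
    rw [← inv_mul_le_iff₀ (by positivity)]
    exact norm_le_energyMap hγ hθ x
  refine ⟨(M * K + L) * c, by positivity, fun θ hθ θ' hθ' y => ?_⟩
  rw [fibreEnergy_apply, fibreEnergy_apply, fibreMass_apply, fibreMass_apply, coe_transfer]
  have hy := y.2
  generalize (y : VectorL2) = x at hy
  have hb := hc θ hθ x
  have h1 := hM θ' hθ' (fibreProj R hR hθ' x - x)
  have h2 := hK θ θ' hθ' x hy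
  have h3 := hL θ θ' x
  have h4 := norm_massMap_le_energyMap (R := R) (hR := hR) (θ := θ') hγ (fibreProj R hR hθ' x - x)
  have h5 : ‖energyMap R hR γ θ' (fibreProj R hR hθ' x)‖ ≤
      ‖energyMap R hR γ θ' (fibreProj R hR hθ' x - x)‖
        + (‖energyMap R hR γ θ' x - energyMap R hR γ θ x‖ + ‖energyMap R hR γ θ x‖) := by
    have e : energyMap R hR γ θ' (fibreProj R hR hθ' x)
        = energyMap R hR γ θ' (fibreProj R hR hθ' x - x)
          + ((energyMap R hR γ θ' x - energyMap R hR γ θ x) + energyMap R hR γ θ x) := by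
      rw [sub_add_cancel, ← map_add, sub_add_cancel]
    rw [e]
    exact (norm_add_le _ _).trans (add_le_add_right (norm_add_le _ _) _)
  have h6 : ‖massMap R hR γ x‖ - ‖massMap R hR γ (fibreProj R hR hθ' x)‖
      ≤ ‖massMap R hR γ (fibreProj R hR hθ' x - x)‖ := by
    rw [map_sub, norm_sub_rev]
    exact norm_sub_norm_le _ _
  have h7 : M * ‖fibreProj R hR hθ' x - x‖
      ≤ M * (K * ‖θ' - θ‖ * (c * ‖energyMap R hR γ θ x‖)) :=
    mul_le_mul_of_nonneg_left
      (h2.trans (mul_le_mul_of_nonneg_left hb (mul_nonneg hK0 (norm_nonneg _)))) hM0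
  have h8 : L * ‖θ' - θ‖ * ‖x‖ ≤ L * ‖θ' - θ‖ * (c * ‖energyMap R hR γ θ x‖) :=
    mul_le_mul_of_nonneg_left hb (mul_nonneg hL0 (norm_nonneg _))
  have h9 : 0 ≤ L * ‖θ' - θ‖ * (c * ‖energyMap R hR γ θ x‖) :=
    mul_nonneg (mul_nonneg hL0 (norm_nonneg _)) (mul_nonneg hc0 (norm_nonneg _))
  generalize ‖energyMap R hR γ θ x‖ = e at *
  generalize ‖θ' - θ‖ = t at *
  constructor
  · refine (h5.trans (add_le_add (h1.trans h7) (add_le_add_left (h3.trans h8) _))).trans_eq ?_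
    ring
  · rw [sub_le_comm]
    refine (h6.trans ((h4.trans h1).trans h7)).trans ?_
    refine (le_add_of_nonneg_right h9).trans_eq ?_
    ring

/-- The square roots of the reciprocal eigenvalues of the pair of forms `b + c` and `c` depend on
`θ` in a Lipschitz continuous way. -/
lemma exists_lipschitz_eigenvalues (hr : fc (cutoff R hR (fourierVec 0)) 0 ≠ 0) (hγ : 0 < γ) :
    ∃ C : ℝ, 0 ≤ C ∧ ∀ θ ∈ dualCell, ∀ θ' ∈ dualCell, ∀ (l l' : ℕ → ℝ) (x : ℕ → fibre R hR θ)
      (x' : ℕ → fibre R hR θ'),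
      SpectralResolution (fibreEnergy R hR γ θ) (fibreMass R hR γ θ) l x →
      SpectralResolution (fibreEnergy R hR γ θ') (fibreMass R hR γ θ') l' x' →
      ∀ n, (Real.sqrt (l n))⁻¹ - (Real.sqrt (l' n))⁻¹ ≤ C * ‖θ' - θ‖ := by
  obtain ⟨C, hC0, hC⟩ := exists_transfer_bounds hr hγ
  refine ⟨2 * C, by positivity, ?_⟩
  intro θ hθ θ' hθ' l l' x x' h h' n
  have hη0 : 0 ≤ C * ‖θ' - θ‖ := by positivity
  have hcmp := h.sqrt_compare h' (transfer hr θ hθ') hη0 (fun y => (hC θ hθ θ' hθ' y).1)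
    (fun y => (hC θ hθ θ' hθ' y).2) n
  have hle : ∀ {θ : Plane} (y : fibre R hR θ), ‖fibreMass R hR γ θ y‖ ≤ ‖fibreEnergy R hR γ θ y‖ :=
    fun y => norm_massMap_le_energyMap hγ _
  have h1 : 1 ≤ Real.sqrt (l n) := Real.one_le_sqrt.2 (h.one_le hle n)
  have h1' : 1 ≤ Real.sqrt (l' n) := Real.one_le_sqrt.2 (h'.one_le hle n)
  rw [mul_assoc]
  generalize C * ‖θ' - θ‖ = η at *
  generalize Real.sqrt (l n) = s at *
  generalize Real.sqrt (l' n) = s' at *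
  have hs : 0 < s := one_pos.trans_le h1
  have hs' : 0 < s' := one_pos.trans_le h1'
  rw [inv_sub_inv hs.ne' hs'.ne', div_le_iff₀ (by positivity)]
  have h2 : η * s ≤ η * (s * s') :=
    mul_le_mul_of_nonneg_left (le_mul_of_one_le_right hs.le h1') hη0
  linarith

end resolution

end CriticalFibre

end

theorem mainTheorem8 (R : Set CriticalFibre.Plane) (hRopen : IsOpen R) (hRne : R.Nonempty)
    (hRcell : closure R ⊆ CriticalFibre.cell) (ε₀ : ℝ) (hε₀ : 1 < ε₀) :
    (∀ θ ∈ CriticalFibre.dualCell,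
      ∃! l : ℕ → ℝ,
        CriticalFibre.IsOrderedEigenvalues (CriticalFibre.criticalOperator R ε₀ θ) l) ∧
    ∀ lam : ℕ → CriticalFibre.Plane → ℝ,
      (∀ θ ∈ CriticalFibre.dualCell,
        CriticalFibre.IsOrderedEigenvalues (CriticalFibre.criticalOperator R ε₀ θ)
          (fun n => lam n θ)) →
      ∀ n : ℕ, ContinuousOn (lam n) CriticalFibre.dualCell := by
  have hR : MeasurableSet R := hRopen.measurableSet
  have hRc : R ⊆ CriticalFibre.cell := subset_closure.trans hRcell
  have hγ : 0 < ε₀ - 1 := sub_pos.2 hε₀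
  have hex : ∀ θ ∈ CriticalFibre.dualCell, ∃ l x, CriticalFibre.SpectralResolution
      (CriticalFibre.fibreEnergy R hR (ε₀ - 1) θ) (CriticalFibre.fibreMass R hR (ε₀ - 1) θ) l x :=
    fun θ hθ => CriticalFibre.exists_spectralResolution_fibre hRopen hRne hRc hγ hθ
  have huniq : ∀ {T : CriticalFibre.VectorL2 →ₗ.[ℂ] CriticalFibre.VectorL2} {l l' : ℕ → ℝ},
      CriticalFibre.IsOrderedEigenvalues T l → CriticalFibre.IsOrderedEigenvalues T l' → l = l' :=
    fun h h' => CriticalFibre.eq_of_monotone_of_mk_fiber_eq h.monotone h'.monotone fun μ =>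
      (h.multiplicity μ).symm.trans (h'.multiplicity μ)
  refine ⟨fun θ hθ => ?_, fun lam hlam n => ?_⟩
  · obtain ⟨l, x, h⟩ := hex θ hθ
    exact ⟨_, CriticalFibre.isOrderedEigenvalues_sub_one hε₀ h, fun l' hl' =>
      huniq hl' (CriticalFibre.isOrderedEigenvalues_sub_one hε₀ h)⟩
  · choose! l x hlx using hex
    have hl : ∀ θ ∈ CriticalFibre.dualCell, lam n θ = l θ n - 1 := fun θ hθ =>
      congrFun (huniq (hlam θ hθ) (CriticalFibre.isOrderedEigenvalues_sub_one hε₀ (hlx θ hθ))) n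
    obtain ⟨C, hC0, hC⟩ := CriticalFibre.exists_lipschitz_eigenvalues (R := R) (hR := hR)
      (CriticalFibre.fc_cutoff_fourierVec_zero_ne_zero hRopen hRne hRc) hγ
    -- `λₙ + 1 = l n` is recovered from its inverse square root
    have hlip : LipschitzOnWith C.toNNReal (fun θ => (Real.sqrt (l θ n))⁻¹)
        CriticalFibre.dualCell := by
      refine LipschitzOnWith.of_le_add_mul _ fun θ hθ θ' hθ' => ?_
      have := hC θ hθ θ' hθ' _ _ _ _ (hlx θ hθ) (hlx θ' hθ') n
      rw [Real.coe_toNNReal _ hC0, dist_comm, dist_eq_norm]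
      linarith
    have hl1 : ∀ θ ∈ CriticalFibre.dualCell, 1 ≤ l θ n := fun θ hθ =>
      (hlx θ hθ).one_le (fun y => CriticalFibre.norm_massMap_le_energyMap hγ _) n
    have hcont : ContinuousOn (fun θ => (((Real.sqrt (l θ n))⁻¹)⁻¹) ^ 2 - 1)
        CriticalFibre.dualCell := by
      refine ((hlip.continuousOn.inv₀ fun θ hθ => ?_).pow 2).sub continuousOn_const
      exact inv_ne_zero (Real.sqrt_pos.2 (one_pos.trans_le (hl1 θ hθ))).ne'
    refine hcont.congr fun θ hθ => ?_
    rw [hl θ hθ]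
    simp only [inv_inv]
    rw [Real.sq_sqrt (zero_le_one.trans (hl1 θ hθ))]
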